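/- Let $G=(V,E)$ be a finite directed graph with $n=|V|\ge 3$ vertices and $E\subseteq V\times V$. A vertex $w$ is a \emph{strong articulation point} if $G\setminus\{w\}$ is not strongly connected, and an edge $e$ is a \emph{strong bridge} if $(V,E\setminus\{e\})$ is not strongly connected. $G$ is \emph{$2$-edge-connected} if it is strongly connected and has no strong bridge, and \emph{$2$-vertex-connected} if it is strongly connected, $n\ge 3$, and it has no strong articulation point. For $T\subseteq V$, $G$ is \emph{$2$-$T$-connected} if it is $2$-edge-connected and no vertex of $T$ is a strong articulation point. The problem M2TC asks, for a $2$-$T$-connected graph $G=(V,E)$, for a set $F\subseteq E$ of minimum cardinality such that $(V,F)$ is $2$-$T$-connected. A $2$-edge- or $2$-vertex-connected graph is \emph{minimal} if it loses this property on deletion of any single edge. In the graph $G$ with start vertex $u$, a vertex $x$ is a \emph{dominator} of $y$ if $x$ lies on every path from $u$ to $y$. Two spanning trees of $G$ rooted at $u$ (edges directed away from $u$) are \emph{independent} if for every $x\ne u$ the paths from $u$ to $x$ in the two trees have only dominators of $x$ in common. Let $G^R$ be the graph obtained by reversing all edges. \textbf{Algorithm 1.} Input: a $2$-$T$-connected graph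 $G=(V,E)$ and $T$. Output: $(V,E_\alpha)$. \begin{itemize} \item If $T=\emptyset$, let $(V,E_\alpha)$ be a minimal $2$-edge-connected spanning subgraph of $G$. \item If $T=V$, let $(V,E_\alpha)$ be a minimal $2$-vertex-connected spanning subgraph of $G$. \item Otherwise let $(V,E_\alpha)$ be a minimal $2$-edge-connected spanning subgraph of $G$, and then add edges: \begin{itemize} \item if $|T|\le 2$, for each $y\in T$ choose $q\in V\setminus\{y\}$ and add to $E_\alpha$ the edges of a spanning tree of $G\setminus\{y\}$ rooted at $q$ and the reversals of the edges of a spanning tree of $G^R\setminus\{y\}$ rooted at $q$; \item if $|T|>2$, choose $w\in V\setminus T$ and add to $E_\alpha$ the edges of two independent spanning trees of $G$ rooted at $w$ and the reversals of the edges of two independent spanning trees of $G^R$ rooted at $w$. \end{itemize} \end{itemize} \textbf{Theorem.} Let $T \subseteq V$ and let $G=(V,E)$ be a $2$-$T$-connected directed graph with $n\ge 3$ vertices. \begin{enumerate} \item $|E|\ge 2n$. \item Whatever choices are made, the graph $(V,E_\alpha)$ returned by Algorithm 1 has at most $8n$ edges, satisfies $E_\alpha\subseteq E$, is $2$-$T$-connected,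 and $|E_\alpha|\le 4\,|E_O|$ for every optimal solution $E_O$ of M2TC for $G$ and $T$. \item Algorithm 1 can be implemented in polynomial time: there are a program for a random access machine (with addition and truncated subtraction, at unit cost) and a polynomial $p$ such that for all $n\ge 3$ and all $2$-$T$-connected graphs on $n$ numbered vertices, given by $n$, the adjacency matrix and the indicator of $T$, the program halts after at most $p(n)$ steps with a set $E_\alpha$ that is a possible result of Algorithm 1. \end{enumerate} Hence there is a polynomial-time $4$-approximation algorithm for M2TC. -/

import Mathlib

namespace M2TC

/-! ### Finite directed graphs

A directed graph `G = (V, E)` is given by its edge set `E : Finset (V × V)` on a finite type `V`. -/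

section Graphs

variable {V : Type*}

/-- There is a directed walk from `u` to `v` using edges of `E`. -/
def Reach (E : Finset (V × V)) (u v : V) : Prop :=
  Relation.ReflTransGen (fun a b => (a, b) ∈ E) u v

/-- `(V, E)` is strongly connected. -/
def StronglyConnected (E : Finset (V × V)) : Prop :=
  ∀ u v : V, Reach E u v

variable [DecidableEq V]

/-- The edge set of `G ∖ {w}`. -/
def deleteVertex (E : Finset (V × V)) (w : V) : Finset (V × V) :=
  E.filter fun e => e.1 ≠ w ∧ e.2 ≠ w

/-- The edge set of the reverse graph `Gᴿ`. -/
def reverse (E : Finset (V × V)) : Finset (V × V) :=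
  E.image Prod.swap

/-- `w` is a strong articulation point: `G ∖ {w}`, a graph on `V ∖ {w}`, is not strongly
connected. -/
def IsStrongArticulationPoint (E : Finset (V × V)) (w : V) : Prop :=
  ¬ ∀ u v : V, u ≠ w → v ≠ w → Reach (deleteVertex E w) u v

/-- `e` is a strong bridge. -/
def IsStrongBridge (E : Finset (V × V)) (e : V × V) : Prop :=
  e ∈ E ∧ ¬ StronglyConnected (E.erase e)

/-- `(V, E)` is `2`-edge-connected. -/
def TwoEdgeConnected (E : Finset (V × V)) : Prop :=
  StronglyConnected E ∧ ∀ e ∈ E, ¬ IsStrongBridge E e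

/-- `(V, E)` is `2`-vertex-connected. -/
def TwoVertexConnected [Fintype V] (E : Finset (V × V)) : Prop :=
  3 ≤ Fintype.card V ∧ StronglyConnected E ∧ ∀ w : V, ¬ IsStrongArticulationPoint E w

/-- `(V, E)` is `2`-`T`-connected. -/
def TwoTConnected (E : Finset (V × V)) (T : Finset V) : Prop :=
  StronglyConnected E ∧ TwoEdgeConnected E ∧ ∀ w ∈ T, ¬ IsStrongArticulationPoint E w

/-- `F` is the edge set of a minimal `2`-edge-connected spanning subgraph of `(V, E)`. -/
def IsMinimalTwoEdgeConnectedSubgraph (E F : Finset (V × V)) : Prop :=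
  F ⊆ E ∧ TwoEdgeConnected F ∧ ∀ e ∈ F, ¬ TwoEdgeConnected (F.erase e)

/-- `F` is the edge set of a minimal `2`-vertex-connected spanning subgraph of `(V, E)`. -/
def IsMinimalTwoVertexConnectedSubgraph [Fintype V] (E F : Finset (V × V)) : Prop :=
  F ⊆ E ∧ TwoVertexConnected F ∧ ∀ e ∈ F, ¬ TwoVertexConnected (F.erase e)

/-! ### Spanning trees, dominators, independent trees -/

/-- `A` is the edge set of a spanning tree, rooted at `q`, of the graph with vertex set `S` and
edge set `E`: edges point away from the root, the root has indegree `0`, every vertex has indegree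
at most `1`, and all vertices of `S` are reached from `q`. -/
def IsSpanningTree (S : Set V) (E : Finset (V × V)) (q : V) (A : Finset (V × V)) : Prop :=
  q ∈ S ∧ A ⊆ E ∧ (∀ a b : V, (a, b) ∈ A → a ∈ S ∧ b ∈ S) ∧
    (∀ a : V, (a, q) ∉ A) ∧
    (∀ a b v : V, (a, v) ∈ A → (b, v) ∈ A → a = b) ∧
    ∀ v ∈ S, Reach A q v

/-- `p` lists the vertices of a (simple, directed) path from `u` to `v` in `(V, E)`. -/
def IsPath (E : Finset (V × V)) (u v : V) (p : List V) : Prop :=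
  p.head? = some u ∧ p.getLast? = some v ∧ p.Nodup ∧ p.IsChain (fun a b => (a, b) ∈ E)

/-- `x` is a dominator of `y` in the flowgraph `(V, E, u)`. -/
def IsDominator (E : Finset (V × V)) (u x y : V) : Prop :=
  ∀ p : List V, IsPath E u y p → x ∈ p

/-- `A` and `B` are (the edge sets of) two independent spanning trees of the flowgraph
`(V, E, u)`. -/
def AreIndependentTrees (E : Finset (V × V)) (u : V) (A B : Finset (V × V)) : Prop :=
  IsSpanningTree Set.univ E u A ∧ IsSpanningTree Set.univ E u B ∧
    ∀ x : V, x ≠ u → ∀ p r : List V, IsPath A u x p → IsPath B u x r →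
      ∀ z : V, z ∈ p → z ∈ r → IsDominator E u z x

/-! ### The problem M2TC -/

/-- `F` is a feasible solution of M2TC for the graph `(V, E)` and the set `T`. -/
def IsFeasible (E : Finset (V × V)) (T : Finset V) (F : Finset (V × V)) : Prop :=
  F ⊆ E ∧ TwoTConnected F T

/-- `F` is an optimal solution of M2TC for the graph `(V, E)` and the set `T`. -/
def IsOptimal (E : Finset (V × V)) (T : Finset V) (F : Finset (V × V)) : Prop :=
  IsFeasible E T F ∧ ∀ F' : Finset (V × V), IsFeasible E T F' → F.card ≤ F'.card

/-! ### The algorithm -/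

/-- `AlgorithmOutput E T F`: for the input `(V, E)` and `T`, the algorithm can return `(V, F)`.
It is a relation since the algorithm leaves choices open (which minimal subgraph, which vertices
`q` and `w`, which trees); each constructor is one branch of the pseudocode. -/
inductive AlgorithmOutput [Fintype V] (E : Finset (V × V)) (T : Finset V) :
    Finset (V × V) → Prop
  /-- `T = ∅`: a minimal `2`-edge-connected subgraph. -/
  | empty (hT : T = ∅) (F : Finset (V × V))
      (hF : IsMinimalTwoEdgeConnectedSubgraph E F) : AlgorithmOutput E T F
  /-- `T = V`: a minimal `2`-vertex-connected subgraph. -/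
  | full (hT : T ≠ ∅) (hT' : T = Finset.univ) (F : Finset (V × V))
      (hF : IsMinimalTwoVertexConnectedSubgraph E F) : AlgorithmOutput E T F
  /-- `T ≠ ∅`, `T ≠ V`, `|T| ≤ 2`: a minimal `2`-edge-connected subgraph, and for each `y ∈ T`
  the edges of a spanning tree `A y` of `G ∖ {y}` and the reversed edges of a spanning tree `B y`
  of `Gᴿ ∖ {y}`, both rooted at some vertex `q y ≠ y`. -/
  | small (hT : T ≠ ∅) (hT' : T ≠ Finset.univ) (hcard : 0 < T.card ∧ T.card ≤ 2)
      (F : Finset (V × V)) (hF : IsMinimalTwoEdgeConnectedSubgraph E F)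
      (q : V → V) (A B : V → Finset (V × V))
      (hq : ∀ y ∈ T, q y ≠ y)
      (hA : ∀ y ∈ T, IsSpanningTree {y}ᶜ (deleteVertex E y) (q y) (A y))
      (hB : ∀ y ∈ T, IsSpanningTree {y}ᶜ (deleteVertex (reverse E) y) (q y) (B y)) :
      AlgorithmOutput E T (F ∪ T.biUnion fun y => A y ∪ reverse (B y))
  /-- `T ≠ ∅`, `T ≠ V`, `|T| > 2`: a minimal `2`-edge-connected subgraph, the edges of two
  independent trees of `G` and the reversed edges of two independent trees of `Gᴿ`, all rooted at
  some vertex `w ∉ T`. -/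
  | large (hT : T ≠ ∅) (hT' : T ≠ Finset.univ) (hcard : ¬ (0 < T.card ∧ T.card ≤ 2))
      (F : Finset (V × V)) (hF : IsMinimalTwoEdgeConnectedSubgraph E F)
      (w : V) (hw : w ∉ T) (A₁ A₂ B₁ B₂ : Finset (V × V))
      (hA : AreIndependentTrees E w A₁ A₂)
      (hB : AreIndependentTrees (reverse E) w B₁ B₂) :
      AlgorithmOutput E T (F ∪ (A₁ ∪ A₂) ∪ reverse (B₁ ∪ B₂))

end Graphs

/-! ### Running time

A random access machine with addition and truncated subtraction, unit cost per operation, written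
as a structured language. A program is a fixed finite object; it works on natural-number variables
and two-dimensional arrays of natural numbers, which are named by numbers occurring in the
program. There is no multiplication, so that numbers have at most linearly many bits in the number
of steps, and unit cost is polynomially equivalent to Turing machine time. -/

/-- Contents of the variables and of the arrays. -/
structure Store where
  var : ℕ → ℕ
  arr : ℕ → ℕ → ℕ → ℕ

/-- Expressions: constants, variables, array entries, sums and truncated differences. -/
inductive Exp where
  | const (c : ℕ)
  | var (x : ℕ)
  | read (a : ℕ) (i j : Exp)
  | add (e f : Exp)
  | sub (e f : Exp)

/-- The value of an expression. -/
def Exp.eval (s : Store) : Exp → ℕ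
  | .const c => c
  | .var x => s.var x
  | .read a i j => s.arr a (i.eval s) (j.eval s)
  | .add e f => e.eval s + f.eval s
  | .sub e f => e.eval s - f.eval s

/-- The number of operations needed to evaluate an expression. -/
def Exp.cost : Exp → ℕ
  | .const _ => 1
  | .var _ => 1
  | .read _ i j => i.cost + j.cost + 1
  | .add e f => e.cost + f.cost + 1
  | .sub e f => e.cost + f.cost + 1

/-- Assign the value `v` to the variable `x`. -/
def Store.setVar (s : Store) (x v : ℕ) : Store :=
  { s with var := Function.update s.var x v }

/-- Write the value `v` to the entry `(i, j)` of the array `a`. -/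
def Store.setArr (s : Store) (a i j v : ℕ) : Store :=
  { s with arr := fun a' i' j' => if a' = a ∧ i' = i ∧ j' = j then v else s.arr a' i' j' }

/-- Programs. A test succeeds if the value of its expression is not `0`. -/
inductive Prog where
  | skip
  | assign (x : ℕ) (e : Exp)
  | write (a : ℕ) (i j e : Exp)
  | seq (P Q : Prog)
  | ite (b : Exp) (P Q : Prog)
  | loop (b : Exp) (P : Prog)

/-- `Exec P s k s'`: started in `s`, the program `P` halts in `s'` after exactly `k` steps. -/
inductive Exec : Prog → Store → ℕ → Store → Prop
  | skip (s : Store) : Exec .skip s 1 s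
  | assign (x : ℕ) (e : Exp) (s : Store) :
      Exec (.assign x e) s (e.cost + 1) (s.setVar x (e.eval s))
  | write (a : ℕ) (i j e : Exp) (s : Store) :
      Exec (.write a i j e) s (i.cost + j.cost + e.cost + 1)
        (s.setArr a (i.eval s) (j.eval s) (e.eval s))
  | seq {P Q : Prog} {s s' s'' : Store} {k l : ℕ} (hP : Exec P s k s') (hQ : Exec Q s' l s'') :
      Exec (.seq P Q) s (k + l) s''
  | iteTrue {b : Exp} {P Q : Prog} {s s' : Store} {k : ℕ} (hb : b.eval s ≠ 0)
      (hP : Exec P s k s') : Exec (.ite b P Q) s (b.cost + k + 1) s'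
  | iteFalse {b : Exp} {P Q : Prog} {s s' : Store} {k : ℕ} (hb : b.eval s = 0)
      (hQ : Exec Q s k s') : Exec (.ite b P Q) s (b.cost + k + 1) s'
  | loopDone {b : Exp} {P : Prog} {s : Store} (hb : b.eval s = 0) :
      Exec (.loop b P) s (b.cost + 1) s
  | loopStep {b : Exp} {P : Prog} {s s' s'' : Store} {k l : ℕ} (hb : b.eval s ≠ 0)
      (hP : Exec P s k s') (hL : Exec (.loop b P) s' l s'') :
      Exec (.loop b P) s (b.cost + k + 1 + l) s''

/-- The input for a graph on `Fin n` and a vertex set `T`: variable `0` holds `n`, array `0` the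
adjacency matrix, column `0` of array `1` the indicator of `T`; everything else is `0`. -/
def inputStore (n : ℕ) (E : Finset (Fin n × Fin n)) (T : Finset (Fin n)) : Store where
  var x := if x = 0 then n else 0
  arr a i j :=
    if h : i < n then
      if h' : j < n then
        if a = 0 ∧ ((⟨i, h⟩, ⟨j, h'⟩) : Fin n × Fin n) ∈ E then 1
        else if a = 1 ∧ j = 0 ∧ (⟨i, h⟩ : Fin n) ∈ T then 1
        else 0
      else 0
    else 0

/-- The edge set that is read off from array `2` at the end. -/
def outputEdges (n : ℕ) (s : Store) : Finset (Fin n × Fin n) :=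
  Finset.univ.filter fun e => s.arr 2 e.1 e.2 ≠ 0

/-- `P` implements the algorithm in polynomial time: for some polynomial `p`, on every
`2`-`T`-connected graph with `n ≥ 3` vertices, `P` halts after at most `p n` steps and its output
is one that the algorithm can return. -/
def ImplementsInPolynomialTime (P : Prog) : Prop :=
  ∃ p : Polynomial ℕ, ∀ (n : ℕ) (E : Finset (Fin n × Fin n)) (T : Finset (Fin n)),
    3 ≤ n → TwoTConnected E T →
      ∃ (k : ℕ) (s : Store), Exec P (inputStore n E T) k s ∧ k ≤ p.eval n ∧
        AlgorithmOutput E T (outputEdges n s)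

end M2TC

open M2TC

namespace M2TC

/-! ### Reachability, reversal, vertex deletion and monotonicity of the connectivity notions. -/

section Basics

variable {V : Type*}

/-! In a 2-edge-connected graph on at least three vertices every vertex is entered by two edges, so
every feasible solution has at least `2n` edges (`TwoEdgeConnected.two_mul_card_le`). The factor 4
therefore follows once every output has at most `8n` edges.

A minimal 2-edge-connected graph has at most `4n` edges. Fix a root `r` and keep a minimal set of
edges such that every nonempty vertex set avoiding `r` is still entered twice. Uncrossing tight cuts
bounds its indegrees by 2 (`TwoEdgeRooted.card_le_of_minimal`). One such set for the graph and one
for its reverse together form a 2-edge-connected subgraph, hence by minimality the whole graph. The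
trees added by the algorithm contribute at most `4n` further edges. If `T = V`, a minimal
2-vertex-connected graph is the union of four independent trees rooted at some `w` and two spanning
trees avoiding `w`.

The central structural fact is that independent spanning trees exist (`exists_areIndependentTrees`).
The children of each vertex in the dominator tree are ordered so that every `x ≠ u` has an
in-neighbour that is its dominator-tree parent, or else in-neighbours below both an earlier and a
later sibling. Parents chosen according to the order give one tree, parents chosen according to its
reversal the other. A vertex lying before `x` in both induced preorders is an ancestor of `x`, so
the two paths to `x` share only dominators. The order is built by appending one vertex at a time
while a cut condition is maintained; `CutOK.exists_placeable` shows that the process never gets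
stuck.

For the running time, the algorithm is written in a small language of loops over the vertices whose
tests are first-order formulas with transitive closure. Every such program compiles to the random
access machine with a polynomial bound (`LProg.exists_correct`). Minimal subgraphs and spanning
trees then come from greedy deletion, independent trees from the order above, and all open choices
are resolved by taking least vertices (`eval_main`). -/

theorem Reach.mono {E F : Finset (V × V)} (h : E ⊆ F) {u v : V} (hr : Reach E u v) :
    Reach F u v :=
  Relation.ReflTransGen.mono (fun _ _ hab => h hab) _ _ hr

theorem Reach.refl (E : Finset (V × V)) (u : V) : Reach E u u :=
  Relation.ReflTransGen.refl

theorem Reach.trans {E : Finset (V × V)} {u v w : V} (h : Reach E u v) (h' : Reach E v w) :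
    Reach E u w :=
  Relation.ReflTransGen.trans h h'

theorem Reach.mem_of_closed {E : Finset (V × V)} {u v : V} (h : Reach E u v) {S : Set V}
    (hu : u ∈ S) (hS : ∀ a b, (a, b) ∈ E → a ∈ S → b ∈ S) : v ∈ S := by
  induction h with
  | refl => exact hu
  | tail _ hbc ih => exact hS _ _ hbc ih

theorem StronglyConnected.mono {E F : Finset (V × V)} (h : E ⊆ F) (hE : StronglyConnected E) :
    StronglyConnected F := fun u v => (hE u v).mono h

variable [DecidableEq V]

theorem mem_reverse {E : Finset (V × V)} {a b : V} : (a, b) ∈ reverse E ↔ (b, a) ∈ E := by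
  simp [reverse]

theorem reverse_reverse (E : Finset (V × V)) : reverse (reverse E) = E := by
  ext ⟨a, b⟩; simp [mem_reverse]

theorem card_reverse (E : Finset (V × V)) : (reverse E).card = E.card :=
  Finset.card_image_of_injective _ Prod.swap_injective

theorem reverse_subset {E F : Finset (V × V)} (h : E ⊆ F) : reverse E ⊆ reverse F :=
  Finset.image_subset_image h

theorem reverse_subset_iff {E F : Finset (V × V)} : reverse E ⊆ F ↔ E ⊆ reverse F :=
  ⟨fun h => reverse_reverse E ▸ reverse_subset h, fun h => reverse_reverse F ▸ reverse_subset h⟩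

theorem reach_reverse {E : Finset (V × V)} {u v : V} :
    Reach (reverse E) u v ↔ Reach E v u := by
  unfold Reach
  rw [← Relation.reflTransGen_swap]
  simp only [mem_reverse]

theorem mem_deleteVertex {E : Finset (V × V)} {w a b : V} :
    (a, b) ∈ deleteVertex E w ↔ (a, b) ∈ E ∧ a ≠ w ∧ b ≠ w := by
  simp [deleteVertex]

theorem deleteVertex_subset (E : Finset (V × V)) (w : V) : deleteVertex E w ⊆ E :=
  Finset.filter_subset _ _

theorem deleteVertex_mono {E F : Finset (V × V)} (h : E ⊆ F) (w : V) :
    deleteVertex E w ⊆ deleteVertex F w :=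
  Finset.filter_subset_filter _ h

theorem deleteVertex_reverse (E : Finset (V × V)) (w : V) :
    deleteVertex (reverse E) w = reverse (deleteVertex E w) := by
  ext ⟨a, b⟩; simp only [mem_deleteVertex, mem_reverse]; tauto

theorem erase_reverse (E : Finset (V × V)) (a b : V) :
    (reverse E).erase (a, b) = reverse (E.erase (b, a)) := by
  ext ⟨c, d⟩; simp only [Finset.mem_erase, mem_reverse, ne_eq, Prod.mk.injEq]; tauto

theorem StronglyConnected.reverse {E : Finset (V × V)} (h : StronglyConnected E) :
    StronglyConnected (M2TC.reverse E) := fun u v => reach_reverse.2 (h v u)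

theorem twoEdgeConnected_iff {E : Finset (V × V)} :
    TwoEdgeConnected E ↔ StronglyConnected E ∧ ∀ e, StronglyConnected (E.erase e) := by
  constructor
  · rintro ⟨h, h'⟩
    refine ⟨h, fun e => ?_⟩
    by_cases he : e ∈ E
    · by_contra hc
      exact h' e he ⟨he, hc⟩
    · rwa [Finset.erase_eq_of_notMem he]
  · rintro ⟨h, h'⟩
    exact ⟨h, fun e _ hb => hb.2 (h' e)⟩

theorem TwoEdgeConnected.mono {E F : Finset (V × V)} (h : E ⊆ F) (hE : TwoEdgeConnected E) :
    TwoEdgeConnected F := by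
  rw [twoEdgeConnected_iff] at *
  exact ⟨hE.1.mono h, fun e => (hE.2 e).mono (Finset.erase_subset_erase e h)⟩

theorem TwoEdgeConnected.reverse {E : Finset (V × V)} (hE : TwoEdgeConnected E) :
    TwoEdgeConnected (M2TC.reverse E) := by
  rw [twoEdgeConnected_iff] at *
  refine ⟨hE.1.reverse, fun ⟨a, b⟩ => ?_⟩
  rw [erase_reverse]
  exact (hE.2 _).reverse

theorem not_isStrongArticulationPoint_iff {E : Finset (V × V)} {w : V} :
    ¬ IsStrongArticulationPoint E w ↔
      ∀ u v : V, u ≠ w → v ≠ w → Reach (deleteVertex E w) u v :=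
  not_not

theorem not_isStrongArticulationPoint_mono {E F : Finset (V × V)} (h : E ⊆ F) {w : V}
    (hE : ¬ IsStrongArticulationPoint E w) : ¬ IsStrongArticulationPoint F w := by
  rw [not_isStrongArticulationPoint_iff] at *
  exact fun u v hu hv => (hE u v hu hv).mono (deleteVertex_mono h w)

theorem TwoVertexConnected.mono [Fintype V] {E F : Finset (V × V)} (h : E ⊆ F)
    (hE : TwoVertexConnected E) : TwoVertexConnected F :=
  ⟨hE.1, hE.2.1.mono h, fun w => not_isStrongArticulationPoint_mono h (hE.2.2 w)⟩

theorem not_isStrongArticulationPoint_reverse {E : Finset (V × V)} {w : V}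
    (hE : ¬ IsStrongArticulationPoint E w) : ¬ IsStrongArticulationPoint (reverse E) w := by
  rw [not_isStrongArticulationPoint_iff] at *
  intro u v hu hv
  rw [deleteVertex_reverse, reach_reverse]
  exact hE v u hv hu

theorem exists_ne_ne [Fintype V] (h : 3 ≤ Fintype.card V) (a b : V) : ∃ c : V, c ≠ a ∧ c ≠ b := by
  have h2 : ({a, b} : Finset V).card < Fintype.card V := lt_of_le_of_lt Finset.card_le_two (by omega)
  obtain ⟨c, -, hc⟩ := Finset.exists_mem_notMem_of_card_lt_card
    (s := {a, b}) (t := Finset.univ) (by simpa using h2)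
  exact ⟨c, by simp_all⟩

/-- Two vertices remain connected after the deletion of a third one, which exists since `n ≥ 3`. -/
theorem stronglyConnected_of_no_articulationPoint [Fintype V] (hn : 3 ≤ Fintype.card V)
    {E : Finset (V × V)} (h : ∀ w, ¬ IsStrongArticulationPoint E w) : StronglyConnected E := by
  intro u v
  obtain ⟨w, hu, hv⟩ := exists_ne_ne hn u v
  exact ((not_isStrongArticulationPoint_iff.1 (h w)) u v hu.symm hv.symm).mono
    (deleteVertex_subset E w)

/-- A deleted edge `(a, b)` is bypassed through a third vertex `c`: a walk from `a` to `c` avoiding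
`b`, then one from `c` to `b` avoiding `a`. Neither can use the edge. -/
theorem TwoVertexConnected.twoEdgeConnected [Fintype V] {E : Finset (V × V)}
    (h : TwoVertexConnected E) : TwoEdgeConnected E := by
  rw [twoEdgeConnected_iff]
  refine ⟨h.2.1, fun ⟨a, b⟩ u v => ?_⟩
  have hab : Reach (E.erase (a, b)) a b := by
    by_cases hne : a = b
    · subst hne; exact Relation.ReflTransGen.refl
    obtain ⟨c, hca, hcb⟩ := exists_ne_ne h.1 a b
    have h1 := (not_isStrongArticulationPoint_iff.1 (h.2.2 b)) a c hne hcb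
    have h2 := (not_isStrongArticulationPoint_iff.1 (h.2.2 a)) c b hca (Ne.symm hne)
    refine (h1.mono ?_).trans (h2.mono ?_) <;> rintro ⟨x, y⟩ hxy <;>
      rw [mem_deleteVertex] at hxy <;> simp only [Finset.mem_erase, ne_eq, Prod.mk.injEq] <;> tauto
  have huv := h.2.1 u v
  induction huv with
  | refl => exact Relation.ReflTransGen.refl
  | @tail x y _ hxy ih =>
    by_cases he : (x, y) = (a, b)
    · rw [Prod.mk.injEq] at he
      obtain ⟨rfl, rfl⟩ := he
      exact ih.trans hab
    · exact ih.tail (Finset.mem_erase.2 ⟨he, hxy⟩)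

theorem exists_erase_minimal {α : Type*} [DecidableEq α] (P : Finset α → Prop) (E : Finset α)
    (hE : P E) : ∃ F ⊆ E, P F ∧ ∀ e ∈ F, ¬ P (F.erase e) := by
  induction E using Finset.strongInduction with
  | H E ih =>
    by_cases h : ∀ e ∈ E, ¬ P (E.erase e)
    · exact ⟨E, subset_rfl, hE, h⟩
    · push Not at h
      obtain ⟨e, he, hP⟩ := h
      obtain ⟨F, hF, hPF, hmin⟩ := ih _ (Finset.erase_ssubset he) hP
      exact ⟨F, hF.trans (Finset.erase_subset _ _), hPF, hmin⟩

/-- For a monotone property, minimality under single deletions is already minimality under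
inclusion. Hence a minimal graph can be counted through any convenient subgraph with the property.
-/
theorem eq_of_erase_minimal {α : Type*} [DecidableEq α] {P : Finset α → Prop}
    (hmono : ∀ {C F}, C ⊆ F → P C → P F) {F C : Finset α} (hF : ∀ e ∈ F, ¬ P (F.erase e))
    (hCF : C ⊆ F) (hC : P C) : C = F := by
  refine hCF.antisymm fun e he => ?_
  by_contra hn
  exact hF e he (hmono (fun x hx => Finset.mem_erase.2 ⟨fun h => hn (h ▸ hx), hCF hx⟩) hC)

end Basics

/-! ### Cuts and the size of minimal 2-edge-connected graphs -/

section Cuts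

variable {V : Type*} [DecidableEq V]

/-- The edges of `E` that enter `X`. -/
def inCut (E : Finset (V × V)) (X : Finset V) : Finset (V × V) :=
  E.filter fun e => e.1 ∉ X ∧ e.2 ∈ X

theorem mem_inCut {E : Finset (V × V)} {X : Finset V} {e : V × V} :
    e ∈ inCut E X ↔ e ∈ E ∧ e.1 ∉ X ∧ e.2 ∈ X := Finset.mem_filter

theorem inCut_erase (E : Finset (V × V)) (X : Finset V) (e : V × V) :
    inCut (E.erase e) X = (inCut E X).erase e := Finset.filter_erase _ _ _

/-- An edge entering `X ∩ Y` or `X ∪ Y` enters `X` or `Y`, and an edge entering both of the former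
enters both of the latter. -/
theorem card_inCut_submodular (E : Finset (V × V)) (X Y : Finset V) :
    (inCut E (X ∩ Y)).card + (inCut E (X ∪ Y)).card ≤ (inCut E X).card + (inCut E Y).card := by
  rw [← Finset.card_union_add_card_inter (inCut E X), ← Finset.card_union_add_card_inter]
  refine add_le_add (Finset.card_le_card fun e => ?_) (Finset.card_le_card fun e => ?_) <;>
    simp only [Finset.mem_union, Finset.mem_inter, mem_inCut] <;> tauto

/-- Every nonempty vertex set not containing `r` is entered by at least two edges. -/
def TwoEdgeRooted (r : V) (E : Finset (V × V)) : Prop :=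
  ∀ X : Finset V, X.Nonempty → r ∉ X → 2 ≤ (inCut E X).card

theorem inCut_nonempty_of_reach {E : Finset (V × V)} {r x : V} {X : Finset V} (hr : r ∉ X)
    (hx : x ∈ X) (h : Reach E r x) : (inCut E X).Nonempty := by
  by_contra hc
  rw [Finset.not_nonempty_iff_eq_empty] at hc
  refine h.mem_of_closed (S := {y | y ∉ X}) hr (fun a b hab ha hb => ?_) hx
  have : (a, b) ∈ inCut E X := mem_inCut.2 ⟨hab, ha, hb⟩
  simp [hc] at this

theorem TwoEdgeConnected.twoEdgeRooted {E : Finset (V × V)} (h : TwoEdgeConnected E) (r : V) :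
    TwoEdgeRooted r E := by
  rintro X ⟨x, hx⟩ hr
  rw [twoEdgeConnected_iff] at h
  obtain ⟨e, he⟩ := inCut_nonempty_of_reach hr hx (h.1 r x)
  have h2 := inCut_nonempty_of_reach hr hx (h.2 e r x)
  rw [inCut_erase, ← Finset.card_pos, Finset.card_erase_of_mem he] at h2
  omega

/-- The set of vertices not reached from `r` without `e` would be entered by two edges, one of which
survives the deletion of `e`. -/
theorem TwoEdgeRooted.reach_erase [Fintype V] {E : Finset (V × V)} {r : V}
    (h : TwoEdgeRooted r E) (e : V × V) (x : V) : Reach (E.erase e) r x := by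
  classical
  by_contra hx
  have h2 := h (Finset.univ.filter fun y => ¬ Reach (E.erase e) r y) ⟨x, by simpa using hx⟩
    (by simpa using Reach.refl _ _)
  have h3 : (inCut (E.erase e) (Finset.univ.filter fun y => ¬ Reach (E.erase e) r y)).Nonempty := by
    rw [inCut_erase, ← Finset.card_pos]
    have := Finset.pred_card_le_card_erase
      (s := inCut E (Finset.univ.filter fun y => ¬ Reach (E.erase e) r y)) (a := e)
    omega
  obtain ⟨⟨a, b⟩, hab⟩ := h3
  simp only [mem_inCut, Finset.mem_filter, Finset.mem_univ, true_and, not_not] at hab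
  exact hab.2.2 (hab.2.1.tail hab.1)

theorem card_le_mul_of_indegree_le [Fintype V] {E : Finset (V × V)} {k : ℕ}
    (h : ∀ v, (E.filter fun e => e.2 = v).card ≤ k) : E.card ≤ k * Fintype.card V := by
  rw [Finset.card_eq_sum_card_fiberwise (f := Prod.snd) (t := Finset.univ) (by simp)]
  calc _ ≤ ∑ _v : V, k := Finset.sum_le_sum fun v _ => h v
    _ = _ := by simp [mul_comm]

/-- By minimality every edge enters a tight set, that is, one entered by exactly two edges. All
edges into a given `v` turn out to enter a single tight set, so the indegree of `v` is at most 2. -/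
theorem TwoEdgeRooted.card_le_of_minimal [Fintype V] {F : Finset (V × V)} {r : V}
    (h : TwoEdgeRooted r F) (hmin : ∀ e ∈ F, ¬ TwoEdgeRooted r (F.erase e)) :
    F.card ≤ 2 * Fintype.card V := by
  have tight : ∀ e ∈ F, ∃ X : Finset V, r ∉ X ∧ e ∈ inCut F X ∧ (inCut F X).card = 2 := by
    intro e he
    have := hmin e he
    unfold TwoEdgeRooted at this
    push Not at this
    obtain ⟨X, hX, hr, hlt⟩ := this
    have h2 := h X hX hr
    rw [inCut_erase] at hlt
    have he' : e ∈ inCut F X := by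
      by_contra hc
      rw [Finset.erase_eq_of_notMem hc] at hlt
      omega
    rw [Finset.card_erase_of_mem he'] at hlt
    exact ⟨X, hr, he', by omega⟩
  refine card_le_mul_of_indegree_le fun v => ?_
  rcases (F.filter fun e => e.2 = v).eq_empty_or_nonempty with h0 | ⟨e, he⟩
  · simp [h0]
  rw [Finset.mem_filter] at he
  obtain ⟨X₀, hX₀⟩ := tight e he.1
  have hv₀ : v ∈ X₀ := he.2 ▸ (mem_inCut.1 hX₀.2.1).2.2
  classical
  -- A smallest tight set around `v`. For a tight `Y` belonging to another edge into `v`,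
  -- submodularity makes `X ∩ Y` tight too, so `X ⊆ Y` and that edge enters `X` as well.
  obtain ⟨X, hX, hXmin⟩ := Finset.exists_min_image
    (Finset.univ.filter fun X : Finset V => r ∉ X ∧ v ∈ X ∧ (inCut F X).card = 2) Finset.card
    ⟨X₀, by simp [hX₀.1, hv₀, hX₀.2.2]⟩
  simp only [Finset.mem_filter, Finset.mem_univ, true_and] at hX hXmin
  rw [← hX.2.2]
  refine Finset.card_le_card fun f hf => ?_
  rw [Finset.mem_filter] at hf
  obtain ⟨Y, hrY, hfY, hY⟩ := tight f hf.1
  have hvY : v ∈ Y := hf.2 ▸ (mem_inCut.1 hfY).2.2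
  have hsub := card_inCut_submodular F X Y
  have h1 := h (X ∩ Y) ⟨v, Finset.mem_inter.2 ⟨hX.2.1, hvY⟩⟩ (by simp [hX.1])
  have h2 := h (X ∪ Y) ⟨v, Finset.mem_union_left _ hX.2.1⟩ (by simp [hX.1, hrY])
  have h3 := hXmin (X ∩ Y) ⟨by simp [hX.1], Finset.mem_inter.2 ⟨hX.2.1, hvY⟩, by omega⟩
  have h4 : X ⊆ Y := Finset.inter_eq_left.1 (Finset.eq_of_subset_of_card_le Finset.inter_subset_left h3)
  exact mem_inCut.2 ⟨hf.1, fun hc => (mem_inCut.1 hfY).2.1 (h4 hc), hf.2 ▸ hX.2.1⟩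

/-- After any deletion, `A` still leads from `r` to every vertex and the reversal of `B` from every
vertex to `r`. So `A ∪ reverse B` is 2-edge-connected and equals `F`. -/
theorem IsMinimalTwoEdgeConnectedSubgraph.card_le [Fintype V] {E F : Finset (V × V)}
    (h : IsMinimalTwoEdgeConnectedSubgraph E F) : F.card ≤ 4 * Fintype.card V := by
  obtain ⟨-, hF, hmin⟩ := h
  rcases F.eq_empty_or_nonempty with h0 | ⟨⟨r, -⟩, -⟩
  · simp [h0]
  obtain ⟨A, hAF, hA, hAmin⟩ := exists_erase_minimal (TwoEdgeRooted r) F (hF.twoEdgeRooted r)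
  obtain ⟨B, hBF, hB, hBmin⟩ :=
    exists_erase_minimal (TwoEdgeRooted r) (reverse F) (hF.reverse.twoEdgeRooted r)
  have hsub : A ∪ reverse B ⊆ F := Finset.union_subset hAF (reverse_subset_iff.2 hBF)
  have hconn : TwoEdgeConnected (A ∪ reverse B) := by
    have key : ∀ e, StronglyConnected ((A ∪ reverse B).erase e) := by
      rintro ⟨a, b⟩ u v
      have h1 := hB.reach_erase (b, a) u
      rw [← reach_reverse, ← erase_reverse] at h1
      exact (h1.mono (Finset.erase_subset_erase _ Finset.subset_union_right)).trans
        ((hA.reach_erase (a, b) v).mono (Finset.erase_subset_erase _ Finset.subset_union_left))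
    exact twoEdgeConnected_iff.2 ⟨(key (r, r)).mono (Finset.erase_subset _ _), key⟩
  rw [← eq_of_erase_minimal TwoEdgeConnected.mono hmin hsub hconn]
  have h1 := hA.card_le_of_minimal hAmin
  have h2 := hB.card_le_of_minimal hBmin
  have h3 := Finset.card_union_le A (reverse B)
  rw [card_reverse] at h3
  omega

theorem TwoEdgeConnected.two_mul_card_le [Fintype V] (hn : 3 ≤ Fintype.card V)
    {E : Finset (V × V)} (h : TwoEdgeConnected E) : 2 * Fintype.card V ≤ E.card := by
  rw [Finset.card_eq_sum_card_fiberwise (f := Prod.snd) (s := E) (t := Finset.univ) (by simp)]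
  calc 2 * Fintype.card V = ∑ _v : V, 2 := by simp [mul_comm]
    _ ≤ _ := Finset.sum_le_sum fun v _ => by
      obtain ⟨r, hr, -⟩ := exists_ne_ne hn v v
      refine (h.twoEdgeRooted r {v} (by simp) (by simpa using hr)).trans
        (Finset.card_le_card fun e => ?_)
      simp only [mem_inCut, Finset.mem_filter, Finset.mem_singleton]
      tauto

end Cuts

/-! ### Dominators -/

section Dominators

variable {V : Type*} (E : Finset (V × V)) (u : V)

/-- There is a walk from `u` to `y` that avoids `z`. -/
def Avoids (z y : V) : Prop :=
  u ≠ z ∧ Relation.ReflTransGen (fun a b => (a, b) ∈ E ∧ b ≠ z) u y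

/-- Every walk from `u` to `y` visits `z`. -/
def Dom (z y : V) : Prop := ¬ Avoids E u z y

/-- `z` is a dominator of `y` other than `y`. -/
def SDom (z y : V) : Prop := z ≠ y ∧ Dom E u z y

/-- `c` and `x` have the same dominators other than themselves. -/
def Sib (c x : V) : Prop := ∀ z, SDom E u z c ↔ SDom E u z x

/-- Some in-neighbour of `x` strictly dominates `x`. -/
def RootEdge (x : V) : Prop := ∃ p, (p, x) ∈ E ∧ SDom E u p x

/-- There is an edge to `x` from a vertex dominated by the sibling `c` of `x`. -/
def Derived (c x : V) : Prop := c ≠ x ∧ Sib E u c x ∧ ∃ p, (p, x) ∈ E ∧ Dom E u c p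

variable {E u}

theorem Avoids.ne {z y : V} (h : Avoids E u z y) : y ≠ z := by
  rcases Relation.ReflTransGen.cases_tail h.2 with h' | ⟨b, -, hb⟩
  · exact h' ▸ h.1
  · exact hb.2

theorem Avoids.tail {z a b : V} (h : Avoids E u z a) (hab : (a, b) ∈ E) (hb : b ≠ z) :
    Avoids E u z b := ⟨h.1, h.2.tail ⟨hab, hb⟩⟩

theorem avoids_root {z : V} (h : u ≠ z) : Avoids E u z u := ⟨h, Relation.ReflTransGen.refl⟩

theorem Avoids.rec_on {z y : V} (h : Avoids E u z y) {P : V → Prop} (h0 : P u)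
    (hs : ∀ a b, Avoids E u z a → P a → (a, b) ∈ E → b ≠ z → P b) : P y := by
  obtain ⟨hne, h⟩ := h
  induction h with
  | refl => exact h0
  | tail hab hbc ih => exact hs _ _ ⟨hne, hab⟩ ih hbc.1 hbc.2

theorem dom_self (y : V) : Dom E u y y := fun h => h.ne rfl

theorem dom_root (y : V) : Dom E u u y := fun h => h.1 rfl

theorem eq_root_of_dom {z : V} (h : Dom E u z u) : z = u := by
  by_contra hc
  exact h (avoids_root (Ne.symm hc))

theorem Dom.of_edge {z a b : V} (h : Dom E u z b) (hab : (a, b) ∈ E) (hb : z ≠ b) :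
    Dom E u z a := fun h' => h (h'.tail hab hb.symm)

/-- A walk to `y` avoiding `c` must visit `d`, and its initial part would reach `d` without meeting
`c`. -/
theorem Dom.trans {c d y : V} (h : Dom E u c d) (h' : Dom E u d y) : Dom E u c y := by
  intro hc
  by_cases hdy : Avoids E u d y
  · exact h' hdy
  refine h ?_
  revert hdy
  refine hc.rec_on (P := fun y => ¬ Avoids E u d y → Avoids E u c d) ?_ ?_
  · intro hd
    rw [← eq_root_of_dom hd] at hc
    obtain rfl := eq_root_of_dom hd
    exact avoids_root hc.1
  · intro a b ha ih hab hb hd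
    by_cases hbd : b = d
    · exact hbd ▸ ha.tail hab hb
    · exact ih fun h'' => hd (h''.tail hab hbd)

/-- Neither of two distinct mutually dominating vertices could be the first of them on a walk from
the root. -/
theorem Dom.antisymm {c d : V} (hr : Reach E u c) (h : Dom E u c d) (h' : Dom E u d c) :
    c = d := by
  by_contra hne
  have key : ∀ y, Reach E u y → Avoids E u c y ∧ Avoids E u d y := by
    intro y hy
    induction hy with
    | refl =>
      refine ⟨avoids_root ?_, avoids_root ?_⟩ <;> rintro rfl
      · exact hne (eq_root_of_dom h').symm
      · exact hne (eq_root_of_dom h)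
    | @tail a b _ hab ih =>
      refine ⟨ih.1.tail hab ?_, ih.2.tail hab ?_⟩ <;> rintro rfl
      · exact h' (ih.2.tail hab hne)
      · exact h (ih.1.tail hab (Ne.symm hne))
  exact (key c hr).1.ne rfl

/-- The dominators of a vertex form a chain, because those other than the vertex itself also
dominate each of its in-neighbours. -/
theorem Dom.comparable {c d y : V} (hr : Reach E u y) (h : Dom E u c y) (h' : Dom E u d y) :
    Dom E u c d ∨ Dom E u d c := by
  induction hr with
  | refl =>
    rw [eq_root_of_dom h]
    exact Or.inl (dom_root _)
  | @tail a b _ hab ih =>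
    by_cases hc : c = b
    · exact Or.inr (hc ▸ h')
    by_cases hd : d = b
    · exact Or.inl (hd ▸ h)
    exact ih (h.of_edge hab hc) (h'.of_edge hab hd)

theorem not_sDom_self (x : V) : ¬ SDom E u x x := fun h => h.1 rfl

theorem SDom.trans (hr : ∀ x, Reach E u x) {a b c : V} (h : SDom E u a b) (h' : SDom E u b c) :
    SDom E u a c := by
  refine ⟨?_, h.2.trans h'.2⟩
  rintro rfl
  exact h.1 (h.2.antisymm (hr _) h'.2)

theorem Sib.symm {c x : V} (h : Sib E u c x) : Sib E u x c := fun z => (h z).symm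

theorem Sib.trans {c x y : V} (h : Sib E u c x) (h' : Sib E u x y) : Sib E u c y :=
  fun z => (h z).trans (h' z)

theorem sDom_root {x : V} (hx : x ≠ u) : SDom E u u x := ⟨hx.symm, dom_root x⟩

theorem not_sDom_to_root {z : V} : ¬ SDom E u z u := fun h => h.1 (eq_root_of_dom h.2)

theorem Sib.ne_root {c x : V} (h : Sib E u c x) (hx : x ≠ u) : c ≠ u := by
  rintro rfl
  exact not_sDom_to_root ((h c).2 (sDom_root hx))

theorem Derived.ne_root {c x : V} (h : Derived E u c x) : c ≠ u ∧ x ≠ u := by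
  have hx : x ≠ u := by
    rintro rfl
    exact not_sDom_to_root ((h.2.1 x).1 (sDom_root h.1))
  exact ⟨h.2.1.ne_root hx, hx⟩

/-- Distinct siblings have disjoint subtrees in the dominator tree. -/
theorem Sib.eq_of_dom (hr : ∀ x, Reach E u x) {c c' y : V} (h : Sib E u c c')
    (hc : Dom E u c y) (hc' : Dom E u c' y) : c = c' := by
  by_contra hne
  rcases hc.comparable (hr y) hc' with h1 | h1
  · exact not_sDom_self c ((h c).2 ⟨hne, h1⟩)
  · exact not_sDom_self c' ((h c').1 ⟨Ne.symm hne, h1⟩)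

/-- Take the topmost dominator `c` of `p` that does not strictly dominate `x`. The strict dominators
of `x` dominate `p` because of the edge, so they are comparable with `c`, and they lie above it. -/
theorem exists_sib_of_edge [Finite V] (hr : ∀ x, Reach E u x) {p x : V} (hpx : (p, x) ∈ E)
    (hx : ¬ Dom E u x p) (hp : ¬ SDom E u p x) : ∃ c, Dom E u c p ∧ Sib E u c x := by
  have : IsTrans V (SDom E u) := ⟨fun _ _ _ h h' => h.trans hr h'⟩
  have : Std.Irrefl (SDom E u) := ⟨not_sDom_self⟩
  have hwf : WellFounded (SDom E u) := Finite.wellFounded_of_trans_of_irrefl _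
  obtain ⟨c, ⟨hcp, hcx⟩, hmin⟩ := hwf.has_min {d | Dom E u d p ∧ ¬ SDom E u d x} ⟨p, dom_self p, hp⟩
  refine ⟨c, hcp, fun z => ⟨fun hz => ?_, fun hz => ?_⟩⟩
  · by_contra hzx
    exact hmin z ⟨hz.2.trans hcp, hzx⟩ hz
  · have hzp : Dom E u z p := hz.2.of_edge hpx hz.1
    refine ⟨fun h => hcx (h ▸ hz), ?_⟩
    rcases hzp.comparable (hr p) hcp with h1 | h1
    · exact h1
    · exact absurd ⟨fun h => hx (h ▸ hcp), h1.trans hz.2⟩ hcx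

/-- This supplies the initial cut condition. If it failed, follow a walk to `x` that avoids `z` if
possible. When a vertex dominated by a sibling of `x` in `X` first appears, it is that sibling
itself, entered by an edge that is derived from some sibling `d`; the failure forces `d = z`, which
is impossible. So the walk never meets such a vertex, although it ends in `x`. -/
theorem exists_rootEdge_or_derived [Finite V] (hr : ∀ x, Reach E u x) {X : Set V} {x : V}
    (hx : x ∈ X) (hu : u ∉ X) (z : V) :
    (∃ y ∈ X, RootEdge E u y) ∨ ∃ y ∈ X, ∃ c, c ∉ X ∧ c ≠ z ∧ Derived E u c y := by
  by_contra hneg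
  push Not at hneg
  obtain ⟨hroot, hder⟩ := hneg
  have h0 : ∀ c ∈ X, ¬ Dom E u c u := fun c hc h => hu (eq_root_of_dom h ▸ hc)
  have step : ∀ a b, (a, b) ∈ E → (Dom E u z x ∨ ¬ Dom E u z a) →
      (∀ c ∈ X, Sib E u c x → ¬ Dom E u c a) → ∀ c ∈ X, Sib E u c x → ¬ Dom E u c b := by
    intro a b hab hz ha c hc hcx hcb
    have hca := ha c hc hcx
    obtain rfl : c = b := by
      by_contra hne
      exact hca (hcb.of_edge hab hne)
    have hac : ¬ SDom E u a c := fun h => hroot c hc ⟨a, hab, h⟩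
    obtain ⟨d, hda, hdc⟩ := exists_sib_of_edge hr hab hca hac
    have hdX : d ∉ X := fun hd => ha d hd (hdc.trans hcx) hda
    have hdz : d = z := by
      by_contra hne
      exact hder c hc d hdX hne ⟨fun h => hca (h ▸ hda), hdc, a, hab, hda⟩
    subst hdz
    -- Here `z` is a sibling of `x`. It cannot strictly dominate `x`, and a vertex reached while
    -- avoiding `z` is not dominated by it.
    rcases hz with hz | hz
    · exact not_sDom_self d (((hdc.trans hcx) d).2 ⟨fun h => hdX (h ▸ hx), hz⟩)
    · exact hz hda
  by_cases hz : Dom E u z x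
  · have : ∀ y, Reach E u y → ∀ c ∈ X, Sib E u c x → ¬ Dom E u c y := by
      intro y hy
      induction hy with
      | refl => exact fun c hc _ => h0 c hc
      | tail _ hab ih => exact step _ _ hab (Or.inl hz) ih
    exact this x (hr x) x hx (fun _ => Iff.rfl) (dom_self x)
  · exact (not_not.1 hz).rec_on (P := fun y => ∀ c ∈ X, Sib E u c x → ¬ Dom E u c y)
      (fun c hc _ => h0 c hc) (fun a b ha ih hab _ => step a b hab (Or.inr (not_not.2 ha)) ih)
      x hx (fun _ => Iff.rfl) (dom_self x)

/-! ### Orders of siblings and independent trees -/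

/-- The preorder of the dominator tree whose siblings are ordered by `lt`. -/
def Precedes (E : Finset (V × V)) (u : V) (lt : V → V → Prop) (x y : V) : Prop :=
  SDom E u x y ∨ ∃ c c', Dom E u c x ∧ Dom E u c' y ∧ Sib E u c c' ∧ lt c c'

/-- `p` may be the parent of `x` in the tree belonging to `lt`. -/
def Cand (E : Finset (V × V)) (u : V) (lt : V → V → Prop) (p x : V) : Prop :=
  (p, x) ∈ E ∧ (SDom E u p x ∨ ∃ c, Dom E u c p ∧ Sib E u c x ∧ lt c x)

theorem Cand.precedes {lt : V → V → Prop} {p x : V} (h : Cand E u lt p x) :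
    Precedes E u lt p x := by
  rcases h.2 with h | ⟨c, h1, h2, h3⟩
  · exact Or.inl h
  · exact Or.inr ⟨c, x, h1, dom_self x, h2, h3⟩

theorem Precedes.irrefl (hr : ∀ x, Reach E u x) {lt : V → V → Prop} (hirr : ∀ x, ¬ lt x x)
    (x : V) : ¬ Precedes E u lt x x := by
  rintro (h | ⟨c, c', h1, h2, h3, h4⟩)
  · exact not_sDom_self x h
  · rw [h3.eq_of_dom hr h1 h2] at h4
    exact hirr _ h4

/-- Compare the two ancestors of the middle vertex `y` that witness the two relations: they are
equal, or one lies above the other, and the higher one decides. -/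
theorem Precedes.trans (hr : ∀ x, Reach E u x) {lt : V → V → Prop}
    (htr : ∀ x y z, lt x y → lt y z → lt x z) {x y z : V} (hxy : Precedes E u lt x y)
    (hyz : Precedes E u lt y z) : Precedes E u lt x z := by
  rcases hxy with h | ⟨c, c', h1, h2, h3, h4⟩ <;>
    rcases hyz with k | ⟨d, d', k1, k2, k3, k4⟩
  · exact Or.inl (h.trans hr k)
  · rcases h.2.comparable (hr y) k1 with h' | h'
    · by_cases hxd : x = d
      · exact Or.inr ⟨d, d', hxd ▸ dom_self x, k2, k3, k4⟩
      · have := (k3 x).1 ⟨hxd, h'⟩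
        by_cases hxd' : d' = z
        · exact Or.inl (hxd' ▸ this)
        · exact Or.inl (this.trans hr ⟨hxd', k2⟩)
    · exact Or.inr ⟨d, d', h', k2, k3, k4⟩
  · exact Or.inr ⟨c, c', h1, h2.trans k.2, h3, h4⟩
  · by_cases he : c' = d
    · subst he
      exact Or.inr ⟨c, d', h1, k2, h3.trans k3, htr _ _ _ h4 k4⟩
    rcases h2.comparable (hr y) k1 with h' | h'
    · exact Or.inr ⟨c, c', h1, ((k3 c').1 ⟨he, h'⟩).2.trans k2, h3, h4⟩
    · exact Or.inr ⟨d, d', ((h3 d).2 ⟨Ne.symm he, h'⟩).2.trans h1, k2, k3, k4⟩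

/-- Non-ancestors are compared through the siblings at which their branches separate, and reversing
the sibling order reverses that comparison. This is what makes the two trees independent. -/
theorem sDom_of_precedes_of_precedes (hr : ∀ x, Reach E u x) {lt : V → V → Prop}
    (hirr : ∀ x, ¬ lt x x) (htr : ∀ x y z, lt x y → lt y z → lt x z) {x z : V}
    (h : Precedes E u lt z x) (h' : Precedes E u (Function.swap lt) z x) : SDom E u z x := by
  rcases h with h | ⟨c, c', h1, h2, h3, h4⟩
  · exact h
  rcases h' with h | ⟨d, d', k1, k2, k3, k4⟩
  · exact h
  exfalso
  by_cases he : c = d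
  · subst he
    rw [(h3.symm.trans k3).eq_of_dom hr h2 k2] at h4
    exact hirr _ (htr _ _ _ h4 k4)
  rcases h1.comparable (hr z) k1 with h' | h'
  · have h5 := ((k3 c).1 ⟨he, h'⟩).2.trans k2
    rw [h3.eq_of_dom hr h5 h2] at h4
    exact hirr _ h4
  · have h5 := ((h3 d).1 ⟨Ne.symm he, h'⟩).2.trans h2
    rw [k3.eq_of_dom hr h5 k2] at k4
    exact hirr _ k4

theorem dom_of_isPath {p : List V} {x z : V} (hz : Dom E u z x) (hp : IsPath E u x p) :
    z ∈ p := by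
  obtain ⟨hhead, hlast, -, hchain⟩ := hp
  by_contra hzp
  refine hz ?_
  cases p with
  | nil => simp at hhead
  | cons a l =>
    obtain rfl : a = u := by simpa using hhead
    have key : ∀ (l : List V) (b : V), (b :: l).IsChain (fun a b => (a, b) ∈ E) → z ∉ b :: l →
        Avoids E a z b → ∀ y, (b :: l).getLast? = some y → Avoids E a z y := by
      intro l
      induction l with
      | nil =>
        intro b _ _ hb y hy
        obtain rfl : b = y := by simpa using hy
        exact hb
      | cons c l ih =>
        intro b hch hmem hb y hy
        rw [List.isChain_cons_cons] at hch
        rw [List.mem_cons, not_or] at hmem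
        refine ih c hch.2 hmem.2 (hb.tail hch.1 ?_) y (by simpa using hy)
        rintro rfl
        exact hmem.2 List.mem_cons_self
    exact key l a hchain hzp (avoids_root fun h => hzp (h ▸ List.mem_cons_self)) x hlast

theorem IsPath.rel_of_mem {A : Finset (V × V)} {x y z : V} {p : List V} (hp : IsPath A y x p)
    {R : V → V → Prop} (hR : ∀ a b, (a, b) ∈ A → R a b) (hz : z ∈ p) :
    Relation.ReflTransGen R z x := by
  obtain ⟨-, hlast, -, hchain⟩ := hp
  have hhead : ∀ (b : V) (l : List V), (b :: l).getLast? = some x →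
      (b :: l).IsChain (fun a b => (a, b) ∈ A) → Relation.ReflTransGen R b x := by
    intro b l
    induction l generalizing b with
    | nil =>
      intro hl _
      obtain rfl : b = x := by simpa using hl
      exact Relation.ReflTransGen.refl
    | cons c l ih =>
      intro hl hch
      rw [List.isChain_cons_cons] at hch
      exact Relation.ReflTransGen.head (hR _ _ hch.1) (ih c (by simpa using hl) hch.2)
  induction p with
  | nil => simp at hz
  | cons a l ih =>
    cases l with
    | nil =>
      obtain rfl : z = a := by simpa using hz
      obtain rfl : z = x := by simpa using hlast
      exact Relation.ReflTransGen.refl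
    | cons b l =>
      rw [List.isChain_cons_cons] at hchain
      have hlast' : (b :: l).getLast? = some x := by simpa using hlast
      rcases List.mem_cons.1 hz with rfl | hz
      · exact Relation.ReflTransGen.head (hR _ _ hchain.1) (hhead b l hlast' hchain.2)
      · exact ih hz hlast' hchain.2

variable [Fintype V] [DecidableEq V]

/-- The tree in which the parent of `x ≠ u` is `a x`. -/
def parentTree (u : V) (a : V → V) : Finset (V × V) :=
  (Finset.univ.erase u).image fun x => (a x, x)

theorem mem_parentTree {a : V → V} {p x : V} :
    (p, x) ∈ parentTree u a ↔ x ≠ u ∧ p = a x := by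
  simp only [parentTree, Finset.mem_image, Finset.mem_erase, Finset.mem_univ, and_true,
    Prod.mk.injEq]
  constructor
  · rintro ⟨y, hy, rfl, rfl⟩; exact ⟨hy, rfl⟩
  · rintro ⟨hx, rfl⟩; exact ⟨x, hx, rfl, rfl⟩

/-- Every parent precedes its child in a well-founded preorder, so following parents ends at `u`. -/
theorem isSpanningTree_parentTree (hr : ∀ x, Reach E u x) {lt : V → V → Prop}
    (hirr : ∀ x, ¬ lt x x) (htr : ∀ x y z, lt x y → lt y z → lt x z) {a : V → V}
    (ha : ∀ x, x ≠ u → Cand E u lt (a x) x) : IsSpanningTree Set.univ E u (parentTree u a) := by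
  refine ⟨trivial, ?_, fun _ _ _ => ⟨trivial, trivial⟩, ?_, ?_, ?_⟩
  · rintro ⟨p, x⟩ hpx
    obtain ⟨hx, rfl⟩ := mem_parentTree.1 hpx
    exact (ha x hx).1
  · intro p hp
    exact (mem_parentTree.1 hp).1 rfl
  · intro p q x hp hq
    rw [(mem_parentTree.1 hp).2, (mem_parentTree.1 hq).2]
  · have : IsTrans V (Precedes E u lt) := ⟨fun _ _ _ h h' => h.trans hr htr h'⟩
    have : Std.Irrefl (Precedes E u lt) := ⟨Precedes.irrefl hr hirr⟩
    have hwf : WellFounded (Precedes E u lt) := Finite.wellFounded_of_trans_of_irrefl _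
    intro x _
    induction x using hwf.induction with
    | _ x ih =>
      by_cases hx : x = u
      · subst hx; exact Reach.refl _ _
      · exact Relation.ReflTransGen.tail (ih _ (ha x hx).precedes trivial)
          (mem_parentTree.2 ⟨hx, rfl⟩)

/-- Paths in the first tree increase for the preorder of `lt`, those in the second for the preorder
of its reversal. A common vertex other than the endpoint precedes it in both. -/
theorem areIndependentTrees_parentTree (hr : ∀ x, Reach E u x) {lt : V → V → Prop}
    (hirr : ∀ x, ¬ lt x x) (htr : ∀ x y z, lt x y → lt y z → lt x z) {a b : V → V}
    (ha : ∀ x, x ≠ u → Cand E u lt (a x) x)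
    (hb : ∀ x, x ≠ u → Cand E u (Function.swap lt) (b x) x) :
    AreIndependentTrees E u (parentTree u a) (parentTree u b) := by
  have hirr' : ∀ x, ¬ Function.swap lt x x := hirr
  have htr' : ∀ x y z, Function.swap lt x y → Function.swap lt y z → Function.swap lt x z :=
    fun x y z h h' => htr z y x h' h
  refine ⟨isSpanningTree_parentTree hr hirr htr ha, isSpanningTree_parentTree hr hirr' htr' hb, ?_⟩
  have key : ∀ {lt' : V → V → Prop} {c : V → V} (_ : ∀ x y z, lt' x y → lt' y z → lt' x z)
      (_ : ∀ x, x ≠ u → Cand E u lt' (c x) x) {x z : V} {p : List V},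
      IsPath (parentTree u c) u x p → z ∈ p → z = x ∨ Precedes E u lt' z x := by
    intro lt' c htr' hc x z p hp hz
    have h := hp.rel_of_mem (R := Precedes E u lt') (fun a b hab => by
      obtain ⟨hb, rfl⟩ := mem_parentTree.1 hab
      exact (hc b hb).precedes) hz
    have : IsTrans V (Precedes E u lt') := ⟨fun _ _ _ h h' => h.trans hr htr' h'⟩
    rw [Relation.reflTransGen_iff_eq_or_transGen, Relation.transGen_eq_self] at h
    exact h.imp_left Eq.symm
  intro x _ p r hp hr' z hzp hzr q hq
  rcases key htr ha hp hzp with rfl | h1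
  · exact dom_of_isPath (dom_self z) hq
  rcases key htr' hb hr' hzr with rfl | h2
  · exact dom_of_isPath (dom_self z) hq
  exact dom_of_isPath (sDom_of_precedes_of_precedes hr hirr htr h1 h2).2 hq

end Dominators

/-! ### Construction of the order -/

section Order

variable {V : Type*}

/-- No vertex, and neither of two additional sources, separates a nonempty subset of `U` from the
sources. The edges are those of `D`; the first source has edges to `x` if `Rt x` and to the
out-neighbours of vertices outside `U`, the second one to `x` if `Rt x`. -/
def CutOK (Rt : V → Prop) (D : V → V → Prop) (U : Set V) : Prop :=
  ∀ X : Set V, X ⊆ U → X.Nonempty →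
    (∀ z ∈ U, (∃ x ∈ X, Rt x) ∨ ∃ x ∈ X, ∃ c, c ∉ X ∧ c ≠ z ∧ D c x) ∧
    ((∃ x ∈ X, Rt x) ∨ ∃ x ∈ X, ∃ c ∈ U, c ∉ X ∧ D c x)

/-- Every vertex of `U` other than `v` is reachable from a root vertex inside `U ∖ {v}`. -/
def Placeable (Rt : V → Prop) (D : V → V → Prop) (U : Set V) (v : V) : Prop :=
  (Rt v ∨ ∃ c, c ∉ U ∧ D c v) ∧ ∀ x ∈ U, x ≠ v → ∃ h ∈ U, h ≠ v ∧ Rt h ∧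
    Relation.ReflTransGen (fun a b => D a b ∧ b ∈ U ∧ b ≠ v) h x

variable {Rt : V → Prop} {D : V → V → Prop} {U : Set V}

/-- A set that is separated from the second source by `v`. -/
def Separated (Rt : V → Prop) (D : V → V → Prop) (U : Set V) (v : V) (X : Set V) : Prop :=
  X ⊆ U ∧ v ∉ X ∧ ∀ x ∈ X, ¬ Rt x ∧ ∀ c ∈ U, D c x → c ∈ X ∨ c = v

/-- Only the condition on the second source needs an argument. A path inside `U \ {v}` from a root
vertex to a member of `X` either starts in `X` or enters it from `U \ {v}`. -/
theorem CutOK.diff (h : CutOK Rt D U) {v : V} (hv : Placeable Rt D U v) :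
    CutOK Rt D (U \ {v}) := by
  intro X hXU hX
  refine ⟨fun z hz => (h X (hXU.trans Set.sdiff_subset) hX).1 z hz.1, ?_⟩
  by_contra hneg
  push Not at hneg
  obtain ⟨x, hx⟩ := hX
  obtain ⟨r, hrU, hrv, hRt, hreach⟩ := hv.2 x (hXU hx).1 (hXU hx).2
  refine hneg.1 r ?_ hRt
  have : ∀ y, Relation.ReflTransGen (fun a b => D a b ∧ b ∈ U ∧ b ≠ v) r y → y ∈ X → r ∈ X := by
    intro y hy
    induction hy with
    | refl => exact id
    | @tail a b hra hab ih =>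
      intro hb
      refine ih ?_
      by_contra ha
      have haU : a ∈ U \ {v} := by
        rcases Relation.ReflTransGen.cases_tail hra with rfl | ⟨c, -, hc⟩
        · exact ⟨hrU, hrv⟩
        · exact ⟨hc.2.1, hc.2.2⟩
      exact hneg.2 b hb a haU ha hab.1
  exact this x hreach hx

/-- The vertices of `U \ {v}` that cannot be reached from a root vertex form a set separated by `v`.
-/
theorem placeable_of_not_separated {v : V} (hv : Rt v ∨ ∃ c, c ∉ U ∧ D c v)
    (h : ∀ X, Separated Rt D U v X → ¬ X.Nonempty) : Placeable Rt D U v := by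
  refine ⟨hv, fun x hx hxv => ?_⟩
  by_contra hneg
  refine h {y | y ∈ U ∧ y ≠ v ∧ ¬ ∃ h ∈ U, h ≠ v ∧ Rt h ∧
    Relation.ReflTransGen (fun a b => D a b ∧ b ∈ U ∧ b ≠ v) h y} ?_ ⟨x, hx, hxv, hneg⟩
  refine ⟨fun y hy => hy.1, fun hy => hy.2.1 rfl, fun y hy => ⟨fun hR => hy.2.2
    ⟨y, hy.1, hy.2.1, hR, Relation.ReflTransGen.refl⟩, fun c hc hcy => ?_⟩⟩
  by_contra hneg'
  rw [not_or] at hneg'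
  refine hneg'.1 ⟨hc, hneg'.2, ?_⟩
  rintro ⟨r, h1, h2, h3, h4⟩
  exact hy.2.2 ⟨r, h1, h2, h3, h4.tail ⟨hcy, hy.1, hy.2.1⟩⟩

/-- Otherwise each vertex `v` that could come next as far as its lower source is concerned separates
a nonempty set. The largest such set contains another vertex of the same kind, whose largest
separated set is strictly smaller, giving an infinite descent. -/
theorem CutOK.exists_placeable [Finite V] (h : CutOK Rt D U) (hU : U.Nonempty) :
    ∃ v ∈ U, Placeable Rt D U v := by
  by_contra hneg
  push Not at hneg
  have bad : ∀ v ∈ U, (Rt v ∨ ∃ c, c ∉ U ∧ D c v) → ∃ X, Separated Rt D U v X ∧ X.Nonempty := by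
    intro v hv hlow
    by_contra hc
    push Not at hc
    exact hneg v hv (placeable_of_not_separated hlow fun X hX => Set.not_nonempty_iff_eq_empty.2 (hc X hX))
  have key : ∀ k : ℕ, ∀ v ∈ U, (Rt v ∨ ∃ c, c ∉ U ∧ D c v) →
      ∀ M, Separated Rt D U v M → (∀ X, Separated Rt D U v X → X ⊆ M) → M.ncard = k → False := by
    intro k
    induction k using Nat.strong_induction_on with
    | _ k ih =>
      intro v hv hlow M hM hmax hk
      obtain ⟨X, hX, hXne⟩ := bad v hv hlow
      have hMne : M.Nonempty := hXne.mono (hmax X hX)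
      -- The vertex `v` alone does not separate `M` from the first source, so some `x ∈ M` has a
      -- derived in-edge from outside `U`.
      obtain ⟨x, hx, hRt⟩ | ⟨x, hx, c, hcM, hcv, hcx⟩ := (h M hM.1 hMne).1 v hv
      · exact (hM.2.2 x hx).1 hRt
      have hcU : c ∉ U := fun hc => ((hM.2.2 x hx).2 c hc hcx).elim hcM hcv
      set N : Set V := ⋃₀ {Y | Separated Rt D U x Y} with hN
      have hNsep : Separated Rt D U x N := by
        refine ⟨Set.sUnion_subset fun Y hY => hY.1, ?_, ?_⟩
        · rintro ⟨Y, hY, hxY⟩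
          exact hY.2.1 hxY
        · rintro y ⟨Y, hY, hyY⟩
          exact ⟨(hY.2.2 y hyY).1, fun d hd hdy => ((hY.2.2 y hyY).2 d hd hdy).imp_left
            fun hd => ⟨Y, hY, hd⟩⟩
      -- If `v ∈ N`, then `M ∪ N` has no derived in-edge from the rest of `U`: those into `M` could
      -- only start at `v ∈ N`, those into `N` only at `x ∈ M`. This contradicts the second cut
      -- condition.
      have hvN : v ∉ N := by
        intro hvN
        obtain ⟨y, hy, hRt⟩ | ⟨y, hy, d, hdU, hdX, hdy⟩ :=
          (h (M ∪ N) (Set.union_subset hM.1 hNsep.1) (hMne.mono Set.subset_union_left)).2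
        · rcases hy with hy | hy
          · exact (hM.2.2 y hy).1 hRt
          · exact (hNsep.2.2 y hy).1 hRt
        · refine hdX ?_
          rcases hy with hy | hy
          · rcases (hM.2.2 y hy).2 d hdU hdy with h' | rfl
            · exact Or.inl h'
            · exact Or.inr hvN
          · rcases (hNsep.2.2 y hy).2 d hdU hdy with h' | rfl
            · exact Or.inr h'
            · exact Or.inl hx
      have hsub : N ⊆ M := by
        refine Set.subset_union_right.trans (hmax (M ∪ N) ⟨Set.union_subset hM.1 hNsep.1, ?_, ?_⟩)
        · rintro (h' | h')
          · exact hM.2.1 h'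
          · exact hvN h'
        · rintro y (hy | hy)
          · exact ⟨(hM.2.2 y hy).1, fun d hd hdy => ((hM.2.2 y hy).2 d hd hdy).imp_left Or.inl⟩
          · refine ⟨(hNsep.2.2 y hy).1, fun d hd hdy => Or.inl ?_⟩
            rcases (hNsep.2.2 y hy).2 d hd hdy with h' | rfl
            · exact Or.inr h'
            · exact Or.inl hx
      have hlt : N.ncard < k := hk ▸ Set.ncard_lt_ncard
        ⟨hsub, fun h' => hNsep.2.1 (h' hx)⟩ (Set.toFinite M)
      exact ih _ hlt x (hM.1 hx) (Or.inr ⟨c, hcU, hcx⟩) N hNsep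
        (fun Y hY => Set.subset_sUnion_of_mem hY) rfl
  -- For `X = U` the second cut condition leaves only a root vertex, which starts the descent.
  obtain ⟨v, hv, hlow⟩ : ∃ v ∈ U, Rt v ∨ ∃ c, c ∉ U ∧ D c v := by
    obtain ⟨x, hx, hRt⟩ | ⟨x, hx, c, hcU, hcx, -⟩ := (h U subset_rfl hU).2
    · exact ⟨x, hx, Or.inl hRt⟩
    · exact absurd hcU hcx
  refine key _ v hv hlow (⋃₀ {Y | Separated Rt D U v Y}) ⟨Set.sUnion_subset fun Y hY => hY.1, ?_, ?_⟩
    (fun Y hY => Set.subset_sUnion_of_mem hY) rfl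
  · rintro ⟨Y, hY, hxY⟩
    exact hY.2.1 hxY
  · rintro y ⟨Y, hY, hyY⟩
    exact ⟨(hY.2.2 y hyY).1, fun d hd hdy => ((hY.2.2 y hyY).2 d hd hdy).imp_left
      fun hd => ⟨Y, hY, hd⟩⟩

/-- The state of the construction: `U` is the set of vertices not yet placed, `lt` the order of the
vertices placed so far, and `u` the root. -/
structure PartialOrdering (Rt : V → Prop) (D : V → V → Prop) (u : V) (U : Set V)
    (lt : V → V → Prop) : Prop where
  cut : CutOK Rt D U
  root : u ∉ U
  irrefl : ∀ x, ¬ lt x x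
  trans : ∀ x y z, lt x y → lt y z → lt x z
  mem : ∀ x y, lt x y → x ∉ U ∧ x ≠ u ∧ y ∉ U
  low : ∀ x, x ∉ U → x ≠ u → Rt x ∨ ∃ c, D c x ∧ lt c x
  high : ∀ x, x ∉ U → x ≠ u → Rt x ∨ ∃ c, D c x ∧ (lt x c ∨ c ∈ U)

/-- The new vertex comes last among those placed. Its lower neighbour comes from placeability, and
the in-neighbours that were still unplaced remain above all earlier vertices. -/
theorem PartialOrdering.place {u : V} {lt : V → V → Prop} (h : PartialOrdering Rt D u U lt)
    (hD : ∀ c x, D c x → c ≠ u) {v : V} (hv : v ∈ U) (hp : Placeable Rt D U v) :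
    PartialOrdering Rt D u (U \ {v}) (fun c x => lt c x ∨ (x = v ∧ c ∉ U ∧ c ≠ u)) := by
  refine ⟨h.cut.diff hp, fun hu => h.root hu.1, ?_, ?_, ?_, ?_, ?_⟩
  · rintro x (hx | ⟨rfl, hx, -⟩)
    · exact h.irrefl x hx
    · exact hx hv
  · rintro x y z (hxy | ⟨rfl, hx, hxu⟩) (hyz | ⟨rfl, hy, hyu⟩)
    · exact Or.inl (h.trans _ _ _ hxy hyz)
    · exact Or.inr ⟨rfl, (h.mem _ _ hxy).1, (h.mem _ _ hxy).2.1⟩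
    · exact absurd hv (h.mem _ _ hyz).1
    · exact absurd hv hy
  · rintro x y (hxy | ⟨rfl, hx, hxu⟩)
    · exact ⟨fun hx => (h.mem _ _ hxy).1 hx.1, (h.mem _ _ hxy).2.1,
        fun hy => (h.mem _ _ hxy).2.2 hy.1⟩
    · exact ⟨fun hx' => hx hx'.1, hxu, fun hy => hy.2 rfl⟩
  · intro x hx hxu
    by_cases hxv : x = v
    · subst hxv
      rcases hp.1 with h' | ⟨c, hc, hcx⟩
      · exact Or.inl h'
      · exact Or.inr ⟨c, hcx, Or.inr ⟨rfl, hc, hD _ _ hcx⟩⟩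
    · rcases h.low x (fun h' => hx ⟨h', hxv⟩) hxu with h' | ⟨c, hc, hcx⟩
      · exact Or.inl h'
      · exact Or.inr ⟨c, hc, Or.inl hcx⟩
  · intro x hx hxu
    by_cases hxv : x = v
    · subst hxv
      -- The second cut condition for the singleton gives a root edge or a derived in-neighbour that
      -- is still unplaced and will therefore come later.
      rcases (h.cut {x} (by simpa using hv) (by simp)).2 with ⟨y, rfl, hR⟩ | ⟨y, rfl, c, hc, hcx, hcy⟩
      · exact Or.inl hR
      · exact Or.inr ⟨c, hcy, Or.inr ⟨hc, hcx⟩⟩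
    · have hxU : x ∉ U := fun h' => hx ⟨h', hxv⟩
      rcases h.high x hxU hxu with h' | ⟨c, hc, hcx | hcx⟩
      · exact Or.inl h'
      · exact Or.inr ⟨c, hc, Or.inl (Or.inl hcx)⟩
      · by_cases hcv : c = v
        · exact Or.inr ⟨c, hc, Or.inl (Or.inr ⟨hcv, hxU, hxu⟩)⟩
        · exact Or.inr ⟨c, hc, Or.inr ⟨hcx, hcv⟩⟩

theorem PartialOrdering.exists_total [Finite V] {u : V} (hD : ∀ c x, D c x → c ≠ u)
    {lt : V → V → Prop} (h : PartialOrdering Rt D u U lt) :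
    ∃ lt', PartialOrdering Rt D u ∅ lt' := by
  induction hk : U.ncard using Nat.strong_induction_on generalizing U lt with
  | _ k ih =>
    rcases U.eq_empty_or_nonempty with rfl | hU
    · exact ⟨lt, h⟩
    · obtain ⟨v, hv, hp⟩ := h.cut.exists_placeable hU
      exact ih _ (hk ▸ Set.ncard_sdiff_singleton_lt_of_mem hv (Set.toFinite U)) (h.place hD hv hp) rfl

/-- Only the cut condition has content. Its second half is the case `z = u`, where a source other
than `u` automatically lies in the unplaced set. -/
theorem partialOrdering_init [Finite V] {E : Finset (V × V)} {u : V} (hr : ∀ x, Reach E u x) :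
    PartialOrdering (RootEdge E u) (Derived E u) u {u}ᶜ (fun _ _ => False) where
  cut := by
    rintro X hX ⟨x, hx⟩
    have key := fun z => exists_rootEdge_or_derived hr hx (fun h => hX h rfl) z
    refine ⟨fun z _ => key z, ?_⟩
    rcases key u with h | ⟨y, hy, c, hc, hcu, hd⟩
    · exact Or.inl h
    · exact Or.inr ⟨y, hy, c, hcu, hc, hd⟩
  root := fun h => h rfl
  irrefl := fun _ h => h
  trans := fun _ _ _ h => h.elim
  mem := fun _ _ h => h.elim
  low := fun _ hx hxu => absurd hxu hx
  high := fun _ hx hxu => absurd hxu hx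

/-- Lower neighbours give parents for the order, higher neighbours for its reversal, and a root edge
serves both. -/
theorem PartialOrdering.exists_cand {E : Finset (V × V)} {u : V} {lt : V → V → Prop}
    (h : PartialOrdering (RootEdge E u) (Derived E u) u ∅ lt) {x : V} (hx : x ≠ u) :
    (∃ p, Cand E u lt p x) ∧ ∃ p, Cand E u (Function.swap lt) p x := by
  constructor
  · rcases h.low x (by simp) hx with ⟨p, hpx, hp⟩ | ⟨c, ⟨-, hc, p, hpx, hp⟩, hlt⟩
    · exact ⟨p, hpx, Or.inl hp⟩
    · exact ⟨p, hpx, Or.inr ⟨c, hp, hc, hlt⟩⟩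
  · rcases h.high x (by simp) hx with ⟨p, hpx, hp⟩ | ⟨c, ⟨-, hc, p, hpx, hp⟩, hlt | hlt⟩
    · exact ⟨p, hpx, Or.inl hp⟩
    · exact ⟨p, hpx, Or.inr ⟨c, hp, hc, hlt⟩⟩
    · exact hlt.elim

theorem exists_areIndependentTrees [Fintype V] [DecidableEq V] {E : Finset (V × V)} {u : V}
    (hr : ∀ x, Reach E u x) : ∃ A B, AreIndependentTrees E u A B := by
  obtain ⟨lt, h⟩ := (partialOrdering_init hr).exists_total fun c x hD => hD.ne_root.1
  choose! a ha using fun x hx => (h.exists_cand (x := x) hx).1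
  choose! b hb using fun x hx => (h.exists_cand (x := x) hx).2
  exact ⟨_, _, areIndependentTrees_parentTree hr h.irrefl h.trans ha hb⟩

end Order

/-! ### Paths, spanning trees, and correctness and size of the algorithm's output. -/

section Trees

variable {V : Type*}

theorem IsPath.reach {E : Finset (V × V)} {u v : V} {p : List V} (h : IsPath E u v p) :
    Reach E u v :=
  h.rel_of_mem (fun _ _ h => h) (List.mem_of_mem_head? h.1)

theorem exists_isPath_of_reach {E : Finset (V × V)} {u v : V} (h : Reach E u v) :
    ∃ p, IsPath E u v p := by
  induction h using Relation.ReflTransGen.head_induction_on with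
  | refl => exact ⟨[v], by simp [IsPath]⟩
  | @head a b hab _ ih =>
    obtain ⟨p, h1, h2, h3, h4⟩ := ih
    by_cases ha : a ∈ p
    · obtain ⟨l, l', rfl⟩ := List.append_of_mem ha
      refine ⟨a :: l', rfl, by simpa [List.getLast?_append] using h2, ?_, ?_⟩
      · exact (List.nodup_append.1 h3).2.1
      · exact (List.isChain_append.1 h4).2.1
    · cases p with
      | nil => simp at h1
      | cons c l =>
        obtain rfl : c = b := by simpa using h1
        exact ⟨a :: c :: l, rfl, by simpa using h2, List.nodup_cons.2 ⟨ha, h3⟩,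
          List.isChain_cons_cons.2 ⟨hab, h4⟩⟩

variable [DecidableEq V]

theorem IsPath.deleteVertex {E : Finset (V × V)} {u v y : V} {p : List V} (h : IsPath E u v p)
    (hy : y ∉ p) : IsPath (deleteVertex E y) u v p := by
  refine ⟨h.1, h.2.1, h.2.2.1, ?_⟩
  have h4 := h.2.2.2
  clear h
  induction p with
  | nil => simp
  | cons a l ih =>
    cases l with
    | nil => simp
    | cons b l =>
      rw [List.isChain_cons_cons] at h4 ⊢
      simp only [List.mem_cons, not_or] at hy
      exact ⟨mem_deleteVertex.2 ⟨h4.1, Ne.symm hy.1, Ne.symm hy.2.1⟩,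
        ih (by simp [hy.2.1, hy.2.2]) h4.2⟩

theorem not_isDominator {E : Finset (V × V)} {u x y : V} (hx : x ≠ y)
    (h : Reach (deleteVertex E y) u x) : ¬ IsDominator E u y x := by
  intro hd
  obtain ⟨p, hp⟩ := exists_isPath_of_reach h
  have hp' : IsPath E u x p :=
    ⟨hp.1, hp.2.1, hp.2.2.1, hp.2.2.2.imp fun a b hab => deleteVertex_subset E y hab⟩
  have := hp.rel_of_mem (R := fun a b => (a, b) ∈ deleteVertex E y) (fun _ _ h => h) (hd p hp')
  rcases Relation.ReflTransGen.cases_head this with h' | ⟨c, hc, -⟩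
  · exact hx h'.symm
  · exact (mem_deleteVertex.1 hc).2.1 rfl

/-- If `y` lay on both tree paths to `x`, it would dominate `x`, which reachability without `y`
excludes. So one of the two paths survives the deletion. -/
theorem AreIndependentTrees.reach_deleteVertex {E A B : Finset (V × V)} {u y : V}
    (h : AreIndependentTrees E u A B)
    (hE : ∀ x, x ≠ y → Reach (deleteVertex E y) u x) :
    ∀ x, x ≠ y → Reach (deleteVertex (A ∪ B) y) u x := by
  intro x hx
  by_cases hxu : x = u
  · exact hxu ▸ Reach.refl _ _
  obtain ⟨p, hp⟩ := exists_isPath_of_reach (h.1.2.2.2.2.2 x trivial)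
  obtain ⟨r, hr⟩ := exists_isPath_of_reach (h.2.1.2.2.2.2.2 x trivial)
  by_cases hyp : y ∈ p
  · have hyr : y ∉ r := fun hyr => not_isDominator hx (hE x hx) (h.2.2 x hxu p r hp hr y hyp hyr)
    exact (hr.deleteVertex hyr).reach.mono (deleteVertex_mono Finset.subset_union_right y)
  · exact (hp.deleteVertex hyp).reach.mono (deleteVertex_mono Finset.subset_union_left y)

theorem not_isStrongArticulationPoint_of_reach {E : Finset (V × V)} {u y : V}
    (h : ∀ x, x ≠ y → Reach (deleteVertex E y) u x)
    (h' : ∀ x, x ≠ y → Reach (deleteVertex (reverse E) y) u x) :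
    ¬ IsStrongArticulationPoint E y := by
  rw [not_isStrongArticulationPoint_iff]
  intro a b ha hb
  have := h' a ha
  rw [deleteVertex_reverse, reach_reverse] at this
  exact this.trans (h b hb)

theorem not_isStrongArticulationPoint_of_trees {E A₁ A₂ B₁ B₂ C : Finset (V × V)} {u y : V}
    (hA : AreIndependentTrees E u A₁ A₂) (hB : AreIndependentTrees (reverse E) u B₁ B₂)
    (hAC : A₁ ∪ A₂ ⊆ C) (hBC : reverse (B₁ ∪ B₂) ⊆ C) (hy : y ≠ u)
    (hE : ¬ IsStrongArticulationPoint E y) : ¬ IsStrongArticulationPoint C y := by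
  refine not_isStrongArticulationPoint_of_reach (u := u) (fun x hx => ?_) (fun x hx => ?_)
  · refine (hA.reach_deleteVertex (fun x hx => ?_) x hx).mono (deleteVertex_mono hAC y)
    exact not_isStrongArticulationPoint_iff.1 hE u x hy.symm hx
  · refine (hB.reach_deleteVertex (fun x hx => ?_) x hx).mono
      (deleteVertex_mono (reverse_subset_iff.1 hBC) y)
    exact not_isStrongArticulationPoint_iff.1 (not_isStrongArticulationPoint_reverse hE) u x
      hy.symm hx

theorem IsSpanningTree.reach_deleteVertex {E A C : Finset (V × V)} {q y : V}
    (h : IsSpanningTree {y}ᶜ (deleteVertex E y) q A) (hAC : A ⊆ C) :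
    ∀ x, x ≠ y → Reach (deleteVertex C y) q x := by
  intro x hx
  refine (h.2.2.2.2.2 x hx).mono ?_
  rintro ⟨a, b⟩ hab
  exact mem_deleteVertex.2 ⟨hAC hab, h.2.2.1 a b hab⟩

theorem not_isStrongArticulationPoint_of_spanningTrees {E A B C : Finset (V × V)} {q y : V}
    (hA : IsSpanningTree {y}ᶜ (deleteVertex E y) q A)
    (hB : IsSpanningTree {y}ᶜ (deleteVertex (reverse E) y) q B)
    (hAC : A ⊆ C) (hBC : reverse B ⊆ C) : ¬ IsStrongArticulationPoint C y :=
  not_isStrongArticulationPoint_of_reach (hA.reach_deleteVertex hAC)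
    (hB.reach_deleteVertex (reverse_subset_iff.1 hBC))

omit [DecidableEq V] in
theorem IsSpanningTree.card_le [Fintype V] {S : Set V} {E A : Finset (V × V)} {q : V}
    (h : IsSpanningTree S E q A) : A.card ≤ Fintype.card V := by
  rw [← Finset.card_univ]
  refine Finset.card_le_card_of_injOn Prod.snd (fun _ _ => Finset.mem_coe.2 (Finset.mem_univ _)) ?_
  rintro ⟨a, v⟩ ha ⟨b, w⟩ hb (rfl : v = w)
  rw [h.2.2.2.2.1 a b v ha hb]

/-- In a minimal reachability-preserving edge set, deleting any edge makes its head unreachable.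
This leaves no edge into the root and no second edge into a vertex. -/
theorem isSpanningTree_of_minimal {S : Set V} {E A : Finset (V × V)} {q : V} (hq : q ∈ S)
    (hE : ∀ a b, (a, b) ∈ E → a ∈ S ∧ b ∈ S) (hAE : A ⊆ E) (hA : ∀ v ∈ S, Reach A q v)
    (hmin : ∀ e ∈ A, ¬ ∀ v ∈ S, Reach (A.erase e) q v) : IsSpanningTree S E q A := by
  have key : ∀ a v, (a, v) ∈ A → ¬ Reach (A.erase (a, v)) q v := by
    intro a v hav hr
    refine hmin _ hav fun x hx => ?_
    refine (hA x hx).mem_of_closed (S := {y | Reach (A.erase (a, v)) q y}) (Reach.refl _ _) ?_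
    intro b c hbc hb
    by_cases hcv : (b, c) = (a, v)
    · obtain ⟨rfl, rfl⟩ := Prod.mk.injEq _ _ _ _ ▸ hcv
      exact hr
    · exact Relation.ReflTransGen.tail hb (Finset.mem_erase.2 ⟨hcv, hbc⟩)
  refine ⟨hq, hAE, fun a b hab => hE a b (hAE hab), fun a ha => key a q ha (Reach.refl _ _), ?_, hA⟩
  intro a b v ha hb
  by_contra hne
  by_cases hqv : q = v
  · exact key a v ha (hqv ▸ Reach.refl _ _)
  -- `p` is the last vertex before the first visit to `v`. Every edge into `v` not coming from `p`
  -- is thus dispensable, and one of `a`, `b` differs from `p`.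
  obtain ⟨p, hp, hpv⟩ : ∃ p, Avoids A q v p ∧ (p, v) ∈ A := by
    by_contra hneg
    push Not at hneg
    exact ((hA v (hE _ _ (hAE ha)).2).mem_of_closed (S := {y | Avoids A q v y}) (avoids_root hqv)
      fun x y hxy hx => Avoids.tail hx hxy fun h => hneg x hx (h ▸ hxy)).ne rfl
  have hreach : ∀ c, p ≠ c → Reach (A.erase (c, v)) q v := by
    intro c hc
    refine Relation.ReflTransGen.tail (b := p) ?_
      (Finset.mem_erase.2 ⟨fun h => hc (Prod.mk.inj h).1, hpv⟩)
    exact Relation.ReflTransGen.mono (fun x y hxy => Finset.mem_erase.2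
      ⟨fun h => hxy.2 (Prod.mk.inj h).2, hxy.1⟩) _ _ hp.2
  by_cases hpa : p = a
  · exact key b v hb (hreach b fun h => hne (hpa ▸ h))
  · exact key a v ha (hreach a hpa)

theorem exists_isSpanningTree {E : Finset (V × V)} {q y : V} (hq : q ≠ y)
    (h : ∀ x, x ≠ y → Reach (deleteVertex E y) q x) :
    ∃ A, IsSpanningTree {y}ᶜ (deleteVertex E y) q A := by
  obtain ⟨A, hA, hP, hmin⟩ := exists_erase_minimal
    (fun A => ∀ v ∈ ({y}ᶜ : Set V), Reach A q v) (deleteVertex E y) h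
  exact ⟨A, isSpanningTree_of_minimal hq (fun a b hab => (mem_deleteVertex.1 hab).2) hA hP hmin⟩

theorem card_indep_le [Fintype V] {E E' A₁ A₂ B₁ B₂ : Finset (V × V)} {w : V}
    (hA : AreIndependentTrees E w A₁ A₂) (hB : AreIndependentTrees E' w B₁ B₂) :
    (A₁ ∪ A₂).card + (reverse (B₁ ∪ B₂)).card ≤ 4 * Fintype.card V := by
  have h1 := Finset.card_union_le A₁ A₂
  have h2 := Finset.card_union_le B₁ B₂
  have h3 := hA.1.card_le
  have h4 := hA.2.1.card_le
  have h5 := hB.1.card_le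
  have h6 := hB.2.1.card_le
  rw [card_reverse]
  omega

/-- The count gives `6n`: four independent trees rooted at `w` and two spanning trees avoiding `w`,
each with at most `n` edges. -/
theorem IsMinimalTwoVertexConnectedSubgraph.card_le [Fintype V] {E F : Finset (V × V)}
    (h : IsMinimalTwoVertexConnectedSubgraph E F) : F.card ≤ 8 * Fintype.card V := by
  obtain ⟨-, hF, hmin⟩ := h
  have : Nonempty V := Fintype.card_pos_iff.1 (by have := hF.1; omega)
  obtain ⟨w⟩ := this
  obtain ⟨q, hq, -⟩ := exists_ne_ne hF.1 w w
  obtain ⟨A₁, A₂, hA⟩ := exists_areIndependentTrees (hF.2.1 w)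
  obtain ⟨B₁, B₂, hB⟩ := exists_areIndependentTrees (hF.2.1.reverse w)
  -- Independent trees say nothing about the deletion of their own root `w`; spanning trees rooted
  -- at another vertex `q` take care of it.
  obtain ⟨A, hA'⟩ := exists_isSpanningTree hq
    fun x hx => not_isStrongArticulationPoint_iff.1 (hF.2.2 w) q x hq hx
  obtain ⟨B, hB'⟩ := exists_isSpanningTree hq fun x hx =>
    not_isStrongArticulationPoint_iff.1 (not_isStrongArticulationPoint_reverse (hF.2.2 w)) q x hq hx
  have hsub : (A₁ ∪ A₂) ∪ reverse (B₁ ∪ B₂) ∪ (A ∪ reverse B) ⊆ F := by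
    refine Finset.union_subset (Finset.union_subset ?_ ?_) (Finset.union_subset ?_ ?_)
    · exact Finset.union_subset hA.1.2.1 hA.2.1.2.1
    · exact reverse_subset_iff.2 (Finset.union_subset hB.1.2.1 hB.2.1.2.1)
    · exact hA'.2.1.trans (deleteVertex_subset _ _)
    · exact reverse_subset_iff.2 (hB'.2.1.trans (deleteVertex_subset _ _))
  have hart : ∀ y, ¬ IsStrongArticulationPoint
      ((A₁ ∪ A₂) ∪ reverse (B₁ ∪ B₂) ∪ (A ∪ reverse B)) y := by
    intro y
    by_cases hy : y = w
    · subst hy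
      exact not_isStrongArticulationPoint_of_spanningTrees hA' hB'
        (Finset.subset_union_left.trans Finset.subset_union_right)
        (Finset.subset_union_right.trans Finset.subset_union_right)
    · exact not_isStrongArticulationPoint_of_trees hA hB
        (Finset.subset_union_left.trans Finset.subset_union_left)
        (Finset.subset_union_right.trans Finset.subset_union_left) hy (hF.2.2 y)
  rw [← eq_of_erase_minimal TwoVertexConnected.mono hmin hsub
    ⟨hF.1, stronglyConnected_of_no_articulationPoint hF.1 hart, hart⟩]
  have h1 := Finset.card_union_le ((A₁ ∪ A₂) ∪ reverse (B₁ ∪ B₂)) (A ∪ reverse B)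
  have h2 := Finset.card_union_le (A₁ ∪ A₂) (reverse (B₁ ∪ B₂))
  have h3 := Finset.card_union_le A (reverse B)
  have h4 := card_indep_le hA hB
  have h5 := hA'.card_le
  have h6 := hB'.card_le
  rw [card_reverse] at h3
  omega

/-- For `T ≠ V` the minimal subgraph costs `4n`. Two pairs of spanning trees, or four independent
trees, cost at most `4n` more. -/
theorem AlgorithmOutput.card_le [Fintype V] {E F : Finset (V × V)} {T : Finset V}
    (h : AlgorithmOutput E T F) : F.card ≤ 8 * Fintype.card V := by
  cases h with
  | empty hT F hF => exact hF.card_le.trans (by omega)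
  | full hT hT' F hF => exact hF.card_le
  | small hT hT' hcard F hF q A B hq hA hB =>
    refine (Finset.card_union_le _ _).trans ?_
    have h1 := hF.card_le
    have h2 : (T.biUnion fun y => A y ∪ reverse (B y)).card ≤ T.card * (2 * Fintype.card V) := by
      refine Finset.card_biUnion_le_card_mul _ _ _ fun y hy => ?_
      have h3 := Finset.card_union_le (A y) (reverse (B y))
      have h4 := (hA y hy).card_le
      have h5 := (hB y hy).card_le
      rw [card_reverse] at h3
      omega
    have h3 := Nat.mul_le_mul_right (2 * Fintype.card V) hcard.2
    omega
  | large hT hT' hcard F hF w hw A₁ A₂ B₁ B₂ hA hB =>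
    have h1 := Finset.card_union_le (F ∪ (A₁ ∪ A₂)) (reverse (B₁ ∪ B₂))
    have h2 := Finset.card_union_le F (A₁ ∪ A₂)
    have h3 := card_indep_le hA hB
    have h4 := hF.card_le
    omega

/-- 2-edge-connectedness is inherited from `F`. The added trees protect each vertex of `T`; in the
last branch this uses that the root lies outside `T`. -/
theorem AlgorithmOutput.isFeasible [Fintype V] {E F : Finset (V × V)} {T : Finset V}
    (hE : TwoTConnected E T) (h : AlgorithmOutput E T F) : IsFeasible E T F := by
  cases h with
  | empty hT F hF =>
    exact ⟨hF.1, hF.2.1.1, hF.2.1, by simp [hT]⟩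
  | full hT hT' F hF =>
    exact ⟨hF.1, hF.2.1.2.1, hF.2.1.twoEdgeConnected, fun w _ => hF.2.1.2.2 w⟩
  | small hT hT' hcard F hF q A B hq hA hB =>
    have h2 : TwoEdgeConnected (F ∪ T.biUnion fun y => A y ∪ reverse (B y)) :=
      hF.2.1.mono Finset.subset_union_left
    refine ⟨Finset.union_subset hF.1 (Finset.biUnion_subset.2 fun y hy => ?_), h2.1, h2,
      fun y hy => ?_⟩
    · exact Finset.union_subset ((hA y hy).2.1.trans (deleteVertex_subset _ _))
        (reverse_subset_iff.2 ((hB y hy).2.1.trans (deleteVertex_subset _ _)))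
    · have h3 := (Finset.subset_biUnion_of_mem (fun y => A y ∪ reverse (B y)) hy).trans
        (Finset.subset_union_right (s₁ := F))
      exact not_isStrongArticulationPoint_of_spanningTrees (hA y hy) (hB y hy)
        (Finset.subset_union_left.trans h3) (Finset.subset_union_right.trans h3)
  | large hT hT' hcard F hF w hw A₁ A₂ B₁ B₂ hA hB =>
    have h2 : TwoEdgeConnected (F ∪ (A₁ ∪ A₂) ∪ reverse (B₁ ∪ B₂)) :=
      hF.2.1.mono (Finset.subset_union_left.trans Finset.subset_union_left)
    refine ⟨Finset.union_subset (Finset.union_subset hF.1 ?_) ?_, h2.1, h2, fun y hy => ?_⟩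
    · exact Finset.union_subset hA.1.2.1 hA.2.1.2.1
    · exact reverse_subset_iff.2 (Finset.union_subset hB.1.2.1 hB.2.1.2.1)
    · exact not_isStrongArticulationPoint_of_trees hA hB
        (Finset.subset_union_right.trans Finset.subset_union_left) Finset.subset_union_right
        (fun h => hw (h ▸ hy)) (hE.2.2 y hy)

end Trees

/-! ### Execution with time bounds -/

/-- `P` halts in `s'` within `b` steps when started in `s`. -/
def Runs (P : Prog) (s : Store) (b : ℕ) (s' : Store) : Prop := ∃ k ≤ b, Exec P s k s'

theorem Runs.mono {P : Prog} {s s' : Store} {b c : ℕ} (h : Runs P s b s') (hbc : b ≤ c) :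
    Runs P s c s' := ⟨h.choose, h.choose_spec.1.trans hbc, h.choose_spec.2⟩

theorem Runs.seq {P Q : Prog} {s s' s'' : Store} {b c : ℕ} (h : Runs P s b s')
    (h' : Runs Q s' c s'') : Runs (.seq P Q) s (b + c) s'' := by
  obtain ⟨k, hk, hP⟩ := h
  obtain ⟨l, hl, hQ⟩ := h'
  exact ⟨k + l, add_le_add hk hl, .seq hP hQ⟩

theorem Runs.iteTrue {e : Exp} {P Q : Prog} {s s' : Store} {b : ℕ} (he : e.eval s ≠ 0)
    (h : Runs P s b s') : Runs (.ite e P Q) s (e.cost + b + 1) s' := by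
  obtain ⟨k, hk, hP⟩ := h
  exact ⟨_, by omega, .iteTrue he hP⟩

theorem Runs.iteFalse {e : Exp} {P Q : Prog} {s s' : Store} {b : ℕ} (he : e.eval s = 0)
    (h : Runs Q s b s') : Runs (.ite e P Q) s (e.cost + b + 1) s' := by
  obtain ⟨k, hk, hP⟩ := h
  exact ⟨_, by omega, .iteFalse he hP⟩

theorem runs_skip (s : Store) : Runs .skip s 1 s := ⟨1, le_rfl, .skip s⟩

theorem runs_assign (x : ℕ) (e : Exp) (s : Store) :
    Runs (.assign x e) s (e.cost + 1) (s.setVar x (e.eval s)) := ⟨_, le_rfl, .assign x e s⟩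

theorem runs_write (a : ℕ) (i j e : Exp) (s : Store) :
    Runs (.write a i j e) s (i.cost + j.cost + e.cost + 1)
      (s.setArr a (i.eval s) (j.eval s) (e.eval s)) := ⟨_, le_rfl, .write a i j e s⟩

@[simp] theorem Store.setVar_var (s : Store) (x v y : ℕ) :
    (s.setVar x v).var y = if y = x then v else s.var y := by
  simp [Store.setVar, Function.update_apply]

@[simp] theorem Store.setVar_arr (s : Store) (x v : ℕ) : (s.setVar x v).arr = s.arr := rfl

@[simp] theorem Store.setArr_var (s : Store) (a i j v : ℕ) : (s.setArr a i j v).var = s.var := rfl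

@[simp] theorem Store.setArr_arr (s : Store) (a i j v a' i' j' : ℕ) :
    (s.setArr a i j v).arr a' i' j' =
      if a' = a ∧ i' = i ∧ j' = j then v else s.arr a' i' j' := rfl

/-- Run `P` for the values `0, …, n - 1` of the variable `x`, where `n` is the value of the
variable `0`. -/
def forVar (x : ℕ) (P : Prog) : Prog :=
  .seq (.assign x (.const 0)) (.loop (.sub (.var 0) (.var x))
    (.seq P (.assign x (.add (.var x) (.const 1)))))

/-- An iteration costs `c` for the body and 8 for test, increment and bookkeeping; the remaining 6
pay for initialization and the final test. The body must leave the counter unchanged. -/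
theorem runs_forVar {x n c : ℕ} {P : Prog} {s : Store} (Inv : ℕ → Store → Prop)
    (hvar : ∀ i s, Inv i s → s.var 0 = n ∧ s.var x = i) (h0 : Inv 0 (s.setVar x 0))
    (hP : ∀ i < n, ∀ s, Inv i s →
      ∃ s', Runs P s c s' ∧ s'.var x = i ∧ Inv (i + 1) (s'.setVar x (i + 1))) :
    ∃ s', Runs (forVar x P) s (n * (c + 8) + 6) s' ∧ Inv n s' := by
  have key : ∀ d i s, i + d = n → Inv i s → ∃ s', Runs (.loop (.sub (.var 0) (.var x))
      (.seq P (.assign x (.add (.var x) (.const 1))))) s (d * (c + 8) + 4) s' ∧ Inv n s' := by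
    intro d
    induction d with
    | zero =>
      intro i s hi hs
      obtain ⟨h1, h2⟩ := hvar i s hs
      refine ⟨s, ⟨4, by omega, ?_⟩, ?_⟩
      · have hb : (Exp.sub (.var 0) (.var x)).eval s = 0 := by simp [Exp.eval, h1, h2]; omega
        exact Exec.loopDone hb
      · obtain rfl : i = n := by omega
        exact hs
    | succ d ih =>
      intro i s hi hs
      obtain ⟨h1, h2⟩ := hvar i s hs
      obtain ⟨s', ⟨k, hk, hrun⟩, hx, hs'⟩ := hP i (by omega) s hs
      obtain ⟨s'', ⟨l, hl, hrun'⟩, hs''⟩ := ih (i + 1) _ (by omega) hs'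
      have hb : (Exp.sub (.var 0) (.var x)).eval s ≠ 0 := by simp [Exp.eval, h1, h2]; omega
      have hassign := Exec.assign x (.add (.var x) (.const 1)) s'
      have he : (Exp.add (.var x) (.const 1)).eval s' = i + 1 := by simp [Exp.eval, hx]
      rw [he] at hassign
      refine ⟨s'', ⟨_, ?_, Exec.loopStep hb (.seq hrun hassign) hrun'⟩, hs''⟩
      simp only [Exp.cost]
      have : (d + 1) * (c + 8) = d * (c + 8) + (c + 8) := by ring
      omega
  obtain ⟨s', hrun, hs'⟩ := key n 0 _ (by omega) h0
  refine ⟨s', ?_, hs'⟩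
  have h1 : Runs (.assign x (.const 0)) s 2 (s.setVar x 0) := runs_assign x (.const 0) s
  exact (h1.seq hrun).mono (by omega)

/-- `s'` agrees with `s` on the variables below `x` and the arrays below `a`. -/
structure Frame (x a : ℕ) (s s' : Store) : Prop where
  var : ∀ y < x, s'.var y = s.var y
  arr : ∀ b < a, s'.arr b = s.arr b

theorem Frame.refl (x a : ℕ) (s : Store) : Frame x a s s := ⟨fun _ _ => rfl, fun _ _ => rfl⟩

theorem Frame.trans {x a x' a' : ℕ} {s s' s'' : Store} (h : Frame x a s s')
    (h' : Frame x' a' s' s'') (hx : x ≤ x') (ha : a ≤ a') : Frame x a s s'' :=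
  ⟨fun y hy => (h'.var y (hy.trans_le hx)).trans (h.var y hy),
    fun y hy => (h'.arr y (hy.trans_le ha)).trans (h.arr y hy)⟩

theorem Frame.setVar {x a : ℕ} {s s' : Store} (h : Frame x a s s') {y v : ℕ} (hy : x ≤ y) :
    Frame x a s (s'.setVar y v) :=
  ⟨fun z hz => by rw [Store.setVar_var, if_neg (by omega), h.var z hz], h.arr⟩

theorem Frame.setArr {x a : ℕ} {s s' : Store} (h : Frame x a s s') {b i j v : ℕ} (hb : a ≤ b) :
    Frame x a s (s'.setArr b i j v) :=
  ⟨h.var, fun c hc => by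
    rw [← h.arr c hc]
    funext i' j'
    rw [Store.setArr_arr, if_neg (by omega)]⟩

/-! ### Formulas and loop programs over finite structures -/

/-- A valuation extended by a value for a new last variable. -/
def push {n k : ℕ} (env : Fin k → Fin n) (v : Fin n) : Fin (k + 1) → Fin n :=
  Fin.snoc (α := fun _ => Fin n) env v

@[simp] theorem push_castSucc {n k : ℕ} (env : Fin k → Fin n) (v : Fin n) (i : Fin k) :
    push env v i.castSucc = env i := Fin.snoc_castSucc (α := fun _ => Fin n) _ _ _

@[simp] theorem push_last {n k : ℕ} (env : Fin k → Fin n) (v : Fin n) :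
    push env v (Fin.last k) = v := Fin.snoc_last (α := fun _ => Fin n) _ _

/-- The number of arrays that loop programs work on. -/
abbrev numArr : ℕ := 6

/-- Six binary relations on `Fin n`. -/
abbrev State (n : ℕ) : Type := Fin numArr → Fin n → Fin n → Prop

/-- First-order formulas with reflexive transitive closure, in `k` free variables, about the
order of `Fin n` and the relations of a state. -/
inductive Fml : ℕ → Type
  | rel {k : ℕ} (a : Fin numArr) (x y : Fin k) : Fml k
  | lt {k : ℕ} (x y : Fin k) : Fml k
  | not {k : ℕ} (φ : Fml k) : Fml k
  | and {k : ℕ} (φ ψ : Fml k) : Fml k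
  | ex {k : ℕ} (φ : Fml (k + 1)) : Fml k
  | reach {k : ℕ} (φ : Fml (k + 2)) (x y : Fin k) : Fml k

/-- The truth value of a formula. -/
def Fml.sat {n : ℕ} (B : State n) : {k : ℕ} → Fml k → (Fin k → Fin n) → Prop
  | _, .rel a x y, env => B a (env x) (env y)
  | _, .lt x y, env => env x < env y
  | _, .not φ, env => ¬ φ.sat B env
  | _, .and φ ψ, env => φ.sat B env ∧ ψ.sat B env
  | _, .ex φ, env => ∃ v, φ.sat B (push env v)
  | _, .reach φ x y, env =>
    Relation.ReflTransGen (fun a b => φ.sat B (push (push env a) b)) (env x) (env y)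

/-- Programs with loops over all elements of `Fin n` that modify a state. -/
inductive LProg : ℕ → Type
  | skip {k : ℕ} : LProg k
  | write {k : ℕ} (a : Fin numArr) (x y : Fin k) (b : Bool) : LProg k
  | seq {k : ℕ} (P Q : LProg k) : LProg k
  | ite {k : ℕ} (φ : Fml k) (P Q : LProg k) : LProg k
  | all {k : ℕ} (P : LProg (k + 1)) : LProg k

open Classical in
/-- The state in which a loop program ends. -/
noncomputable def LProg.eval {n : ℕ} : {k : ℕ} → LProg k → (Fin k → Fin n) → State n → State n
  | _, .skip, _, B => B
  | _, .write a x y b, env, B => fun a' i j =>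
      if a' = a ∧ i = env x ∧ j = env y then b = true else B a' i j
  | _, .seq P Q, env, B => Q.eval env (P.eval env B)
  | _, .ite φ P Q, env, B => if φ.sat B env then P.eval env B else Q.eval env B
  | _, .all P, env, B => (List.finRange n).foldl (fun B v => P.eval (push env v) B) B

/-! ### Compilation -/

/-- The program that evaluates a formula; with `k` free variables, the `i`-th one is kept in the
variable `3 * i + 1`, and the result is put into `3 * k + 2`. -/
def Fml.compile : {k : ℕ} → Fml k → Prog
  | k, .rel a x y => .assign (3 * k + 2) (.read a (.var (3 * x + 1)) (.var (3 * y + 1)))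
  | k, .lt x y => .assign (3 * k + 2) (.sub (.var (3 * y + 1)) (.var (3 * x + 1)))
  | k, .not φ => .seq φ.compile (.assign (3 * k + 2) (.sub (.const 1) (.var (3 * k + 2))))
  | k, .and φ ψ => .seq φ.compile (.ite (.var (3 * k + 2)) ψ.compile .skip)
  | k, .ex φ => .seq (.assign (3 * k + 2) (.const 0)) (forVar (3 * k + 1)
      (.seq φ.compile (.ite (.var (3 * k + 5)) (.assign (3 * k + 2) (.const 1)) .skip)))
  | k, .reach φ x y =>
    .seq (forVar (3 * k + 1) (.write (numArr + k) (.var (3 * k + 1)) (.const 0) (.const 0)))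
    (.seq (.write (numArr + k) (.var (3 * x + 1)) (.const 0) (.const 1))
    (.seq (forVar (3 * k + 3) (forVar (3 * k + 1) (forVar (3 * k + 4)
      (.seq φ.compile (.ite (.var (3 * k + 8))
        (.ite (.read (numArr + k) (.var (3 * k + 1)) (.const 0))
          (.write (numArr + k) (.var (3 * k + 4)) (.const 0) (.const 1)) .skip) .skip)))))
    (.assign (3 * k + 2) (.read (numArr + k) (.var (3 * y + 1)) (.const 0)))))

/-- The program that carries out a loop program. -/
def LProg.compile : {k : ℕ} → LProg k → Prog
  | _, .skip => .skip
  | _, .write a x y b =>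
    .write a (.var (3 * x + 1)) (.var (3 * y + 1)) (.const (if b then 1 else 0))
  | _, .seq P Q => .seq P.compile Q.compile
  | k, .ite φ P Q => .seq φ.compile (.ite (.var (3 * k + 2)) P.compile Q.compile)
  | k, .all P => forVar (3 * k + 1) P.compile

/-- The store `s` represents the state `B` and the valuation `env`. -/
structure Represents {n k : ℕ} (B : State n) (env : Fin k → Fin n) (s : Store) : Prop where
  size : s.var 0 = n
  env : ∀ i : Fin k, s.var (3 * i + 1) = env i
  arr : ∀ (a : Fin numArr) (i j : Fin n), s.arr a i j ≠ 0 ↔ B a i j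

theorem Represents.frame {n k x a : ℕ} {B : State n} {env : Fin k → Fin n} {s s' : Store}
    (h : Represents B env s) (hf : Frame x a s s') (hx : 3 * k ≤ x + 1) (hx' : 0 < x)
    (ha : numArr ≤ a) : Represents B env s' where
  size := (hf.var 0 hx').trans h.size
  env i := (hf.var _ (by omega)).trans (h.env i)
  arr b i j := by
    rw [hf.arr b (lt_of_lt_of_le b.2 ha)]
    exact h.arr b i j

theorem Represents.push {n k : ℕ} {B : State n} {env : Fin k → Fin n} {s : Store}
    (h : Represents B env s) {v : Fin n} (hv : s.var (3 * k + 1) = v) :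
    Represents B (push env v) s where
  size := h.size
  env i := by
    refine Fin.lastCases ?_ (fun i => ?_) i
    · simpa using hv
    · simpa using h.env i
  arr := h.arr

/-- A formula is evaluated correctly within `b` steps. -/
def Fml.Correct {k : ℕ} (φ : Fml k) (b : ℕ → ℕ) : Prop :=
  ∀ (n : ℕ) (B : State n) (env : Fin k → Fin n) (s : Store), Represents B env s →
    ∃ s', Runs φ.compile s (b n) s' ∧ Frame (3 * k + 1) (numArr + k) s s' ∧
      (s'.var (3 * k + 2) ≠ 0 ↔ φ.sat B env)

/-- The invariant says that the result cell is nonzero exactly if a witness has been found among the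
values already tried. Evaluating the body does not touch this cell, since it only writes to
variables from `3 * k + 4` on. -/
theorem Fml.Correct.ex {k : ℕ} {φ : Fml (k + 1)} {b : ℕ → ℕ} (hφ : φ.Correct b) :
    (Fml.ex φ).Correct fun n => n * (b n + 12) + 8 := by
  intro n B env s hs
  set s₁ := s.setVar (3 * k + 2) 0 with hs₁
  have hf₁ : Frame (3 * k + 1) (numArr + k) s s₁ := (Frame.refl _ _ _).setVar (by omega)
  obtain ⟨s', hrun, hs'⟩ := runs_forVar (x := 3 * k + 1) (n := n) (c := b n + 4) (s := s₁)
    (P := .seq φ.compile (.ite (.var (3 * k + 5)) (.assign (3 * k + 2) (.const 1)) .skip))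
    (fun i s' => Frame (3 * k + 1) (numArr + k) s s' ∧ s'.var (3 * k + 1) = i ∧
      (s'.var (3 * k + 2) ≠ 0 ↔ ∃ v : Fin n, v.1 < i ∧ φ.sat B (push env v)))
    (fun i s' h => ⟨(h.1.var 0 (by omega)).trans hs.size, h.2.1⟩)
    ⟨hf₁.setVar le_rfl, by simp, by simp [hs₁]⟩
    (fun i hi t ht => by
      obtain ⟨hft, hti, htr⟩ := ht
      obtain ⟨t', hrun, hft', ht'⟩ := hφ n B (push env ⟨i, hi⟩) t
        ((hs.frame hft (by omega) (by omega) (by omega)).push hti)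
      have hF : Frame (3 * k + 1) (numArr + k) s t' := hft.trans hft' (by omega) (by omega)
      have hi' : t'.var (3 * k + 1) = i := (hft'.var _ (by omega)).trans hti
      have hr' : t'.var (3 * k + 2) = t.var (3 * k + 2) := hft'.var _ (by omega)
      by_cases hsat : φ.sat B (push env ⟨i, hi⟩)
      · refine ⟨t'.setVar (3 * k + 2) 1, (hrun.seq ((runs_assign _ _ _).iteTrue
          (e := .var (3 * k + 5)) (ht'.2 hsat))).mono (by simp [Exp.cost]), by simp [hi'], ?_, by simp, ?_⟩
        · exact (hF.setVar (by omega)).setVar le_rfl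
        · simp only [Store.setVar_var]
          simp
          exact ⟨⟨i, hi⟩, le_rfl, hsat⟩
      · refine ⟨t', (hrun.seq ((runs_skip _).iteFalse ?_)).mono (by simp [Exp.cost]), hi',
          hF.setVar le_rfl, by simp, ?_⟩
        · exact not_not.1 (mt ht'.1 hsat)
        · simp only [Store.setVar_var]
          rw [if_neg (by omega), hr', htr]
          constructor
          · rintro ⟨v, hv, h⟩
            exact ⟨v, by omega, h⟩
          · rintro ⟨v, hv, h⟩
            refine ⟨v, ?_, h⟩
            rcases Nat.lt_succ_iff_lt_or_eq.1 hv with h' | h'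
            · exact h'
            · exact absurd ((Fin.ext h' : v = ⟨i, hi⟩) ▸ h) hsat)
  refine ⟨s', ((runs_assign _ _ _).seq hrun).mono (by simp [Exp.cost]; ring_nf; omega), hs'.1, ?_⟩
  rw [hs'.2.2]
  simp [Fml.sat]

/-- Either some round adds nothing, and then the set is closed under `R`, or each of the first `n +
1` rounds adds an element, which is impossible among `n` elements. -/
theorem mem_of_iterate_closed {n : ℕ} (R : Fin n → Fin n → Prop) (x y : Fin n)
    (h : Relation.ReflTransGen R x y) (N : ℕ → Fin n → Prop) (h0 : N 0 x)
    (hs : ∀ t v, N (t + 1) v ↔ N t v ∨ ∃ a, N t a ∧ R a v) : N n y := by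
  classical
  have hmono : ∀ t d v, N t v → N (t + d) v := by
    intro t d v hv
    induction d with
    | zero => exact hv
    | succ d ih => exact (hs _ _).2 (Or.inl ih)
  have hx : ∀ t, N t x := fun t => by simpa using hmono 0 t x h0
  by_cases hst : ∃ t ≤ n, ∀ v, N (t + 1) v → N t v
  · obtain ⟨t, ht, hst⟩ := hst
    have hy : N t y := by
      induction h with
      | refl => exact hx t
      | tail _ hab ih => exact hst _ ((hs _ _).2 (Or.inr ⟨_, ih, hab⟩))
    simpa [Nat.add_sub_cancel' ht] using hmono t (n - t) y hy
  · push Not at hst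
    have key : ∀ t ≤ n + 1, t ≤ (Finset.univ.filter fun v => N t v).card := by
      intro t
      induction t with
      | zero => simp
      | succ t ih =>
        intro ht
        obtain ⟨v, hv, hv'⟩ := hst t (by omega)
        refine (Nat.succ_le_succ (ih (by omega))).trans (Nat.succ_le_of_lt (Finset.card_lt_card ?_))
        refine Finset.ssubset_iff_of_subset (fun w hw => ?_) |>.2 ⟨v, by simpa using hv, by simpa using hv'⟩
        simp only [Finset.mem_filter, Finset.mem_univ, true_and] at hw ⊢
        exact (hs _ _).2 (Or.inl hw)
    have h1 := key (n + 1) le_rfl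
    have h2 := Finset.card_le_univ (Finset.univ.filter fun v => N (n + 1) v)
    simp at h2
    omega

/-- The vertices reached from `x` in at most `t` steps. -/
def reachWithin {n : ℕ} (R : Fin n → Fin n → Prop) (x : Fin n) : ℕ → Fin n → Prop
  | 0 => fun v => v = x
  | t + 1 => fun v => reachWithin R x t v ∨ ∃ a, reachWithin R x t a ∧ R a v

theorem reachWithin_of_reflTransGen {n : ℕ} {R : Fin n → Fin n → Prop} {x y : Fin n} :
    Relation.ReflTransGen R x y → reachWithin R x n y := fun h =>
  mem_of_iterate_closed R x y h (reachWithin R x) rfl fun _ _ => Iff.rfl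

/-- Reachability is computed by `n` rounds of relaxing all pairs, with marks in the scratch array
`numArr + k`. The round counter `3 * k + 3` is a spare cell below everything the inner formula may
change. -/
theorem Fml.Correct.reach {k : ℕ} {φ : Fml (k + 2)} {b : ℕ → ℕ} (hφ : φ.Correct b)
    (x y : Fin k) : (Fml.reach φ x y).Correct
      fun n => n * (n * (n * (b n + 22) + 14) + 14) + n * 12 + 30 := by
  intro n B env s hs
  set S := numArr + k with hS
  set R : Fin n → Fin n → Prop := fun a b => φ.sat B (M2TC.push (M2TC.push env a) b) with hR
  let inS : Store → Fin n → Prop := fun t v => t.arr S v 0 ≠ 0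
  -- The soundness half of the invariant: every marked vertex is reachable.
  let G : Store → Prop := fun t => Frame (3 * k + 1) S s t ∧
    ∀ v, inS t v → Relation.ReflTransGen R (env x) v
  have hGrep : ∀ t, G t → Represents B env t := fun t ht =>
    hs.frame ht.1 (by omega) (by omega) (by omega)
  have hinner : ∀ (a : Fin n) (t : Store), G t → t.var (3 * k + 1) = a →
      ∃ t', Runs (forVar (3 * k + 4) (.seq φ.compile (.ite (.var (3 * k + 8))
        (.ite (.read S (.var (3 * k + 1)) (.const 0))
          (.write S (.var (3 * k + 4)) (.const 0) (.const 1)) .skip) .skip))) t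
          (n * (b n + 22) + 6) t' ∧
        G t' ∧ t'.var (3 * k + 1) = a ∧ t'.var (3 * k + 3) = t.var (3 * k + 3) ∧
        (∀ v, inS t v → inS t' v) ∧ (inS t a → ∀ c, R a c → inS t' c) := by
    intro a t ht hta
    obtain ⟨t', hrun, ht'⟩ := runs_forVar (x := 3 * k + 4) (n := n) (c := b n + 14) (s := t)
      (P := .seq φ.compile (.ite (.var (3 * k + 8))
        (.ite (.read S (.var (3 * k + 1)) (.const 0))
          (.write S (.var (3 * k + 4)) (.const 0) (.const 1)) .skip) .skip))
      (fun i t' => t'.var (3 * k + 4) = i ∧ G t' ∧ t'.var (3 * k + 1) = a ∧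
        t'.var (3 * k + 3) = t.var (3 * k + 3) ∧ (∀ v, inS t v → inS t' v) ∧
        (inS t a → ∀ c : Fin n, c.1 < i → R a c → inS t' c))
      (fun i t' h => ⟨(hGrep t' h.2.1).size, h.1⟩)
      ⟨by simp, ⟨ht.1.setVar (by omega), ht.2⟩, by simp [hta], by simp, fun v hv => hv, by simp⟩
      (fun i hi r hr => by
        obtain ⟨hri, hGr, hra, hrt, hmono, hnew⟩ := hr
        obtain ⟨r', hrun, hf, hsat⟩ := hφ n B (M2TC.push (M2TC.push env a) ⟨i, hi⟩) r
          (((hGrep r hGr).push hra).push hri)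
        have harr : r'.arr S = r.arr S := hf.arr S (by omega)
        have hv1 : r'.var (3 * k + 1) = a := (hf.var _ (by omega)).trans hra
        have hv3 : r'.var (3 * k + 3) = t.var (3 * k + 3) := (hf.var _ (by omega)).trans hrt
        have hv4 : r'.var (3 * k + 4) = i := (hf.var _ (by omega)).trans hri
        have hF : Frame (3 * k + 1) S s r' := hGr.1.trans hf (by omega) (by omega)
        have hinS : ∀ v, inS r' v ↔ inS r v := fun v => by simp only [inS, harr]
        by_cases hadd : R a ⟨i, hi⟩ ∧ inS r a
        · have hev : (Exp.read S (.var (3 * k + 1)) (.const 0)).eval r' ≠ 0 := by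
            simp only [Exp.eval, hv1]
            exact (hinS a).2 hadd.2
          have hin2 : ∀ v, inS (r'.setArr S i 0 1) v ↔ v = ⟨i, hi⟩ ∨ inS r v := by
            intro v
            rw [← hinS]
            simp only [inS, Store.setArr_arr, true_and, and_true, Fin.ext_iff]
            by_cases hvi : v.1 = i <;> simp [hvi]
          have hw := runs_write S (.var (3 * k + 4)) (.const 0) (.const 1) r'
          simp only [Exp.eval, hv4] at hw
          refine ⟨_, (hrun.seq ((hw.iteTrue hev).iteTrue (e := .var (3 * k + 8))
            (hsat.2 hadd.1))).mono (by simp [Exp.cost]), by simpa using hv4, by simp,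
            ⟨(hF.setArr le_rfl).setVar (by omega), ?_⟩, by simpa using hv1, by simpa using hv3,
            fun v hv => (hin2 v).2 (Or.inr (hmono v hv)), fun ha c hc hac => (hin2 c).2 ?_⟩
          · intro v hv
            rcases (hin2 v).1 hv with rfl | hv
            · exact (hGr.2 a hadd.2).tail hadd.1
            · exact hGr.2 v hv
          · rcases Nat.lt_succ_iff_lt_or_eq.1 hc with h | h
            · exact Or.inr (hnew ha c h hac)
            · exact Or.inl (Fin.ext h)
        · refine ⟨r', ?_, hv4, by simp, ⟨hF.setVar (by omega), fun v hv =>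
            hGr.2 v ((hinS v).1 hv)⟩, by simpa using hv1, by simpa using hv3,
            fun v hv => (hinS v).2 (hmono v hv), fun ha c hc hac => (hinS c).2 ?_⟩
          · by_cases hs1 : R a ⟨i, hi⟩
            · have hev : (Exp.read S (.var (3 * k + 1)) (.const 0)).eval r' = 0 := by
                simp only [Exp.eval, hv1]
                exact not_not.1 fun h => hadd ⟨hs1, (hinS a).1 h⟩
              exact (hrun.seq (((runs_skip r').iteFalse hev).iteTrue (e := .var (3 * k + 8))
                (hsat.2 hs1))).mono (by simp [Exp.cost])
            · exact (hrun.seq ((runs_skip r').iteFalse (e := .var (3 * k + 8))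
                (not_not.1 (mt hsat.1 hs1)))).mono (by simp [Exp.cost])
          · rcases Nat.lt_succ_iff_lt_or_eq.1 hc with h | h
            · exact hnew ha c h hac
            · exact absurd ⟨(Fin.ext h : c = ⟨i, hi⟩) ▸ hac, hmono a ha⟩ hadd)
    exact ⟨t', hrun.mono le_rfl, ht'.2.1, ht'.2.2.1, ht'.2.2.2.1, ht'.2.2.2.2.1,
      fun ha c => ht'.2.2.2.2.2 ha c c.2⟩
  have hmid : ∀ t : Store, G t →
      ∃ t', Runs (forVar (3 * k + 1) (forVar (3 * k + 4) (.seq φ.compile (.ite (.var (3 * k + 8))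
        (.ite (.read S (.var (3 * k + 1)) (.const 0))
          (.write S (.var (3 * k + 4)) (.const 0) (.const 1)) .skip) .skip)))) t
          (n * (n * (b n + 22) + 14) + 6) t' ∧
        G t' ∧ t'.var (3 * k + 3) = t.var (3 * k + 3) ∧
        (∀ v, inS t v → inS t' v) ∧ (∀ a c, inS t a → R a c → inS t' c) := by
    intro t ht
    obtain ⟨t', hrun, ht'⟩ := runs_forVar (x := 3 * k + 1) (n := n)
      (c := n * (b n + 22) + 6) (s := t) (P := forVar (3 * k + 4) (.seq φ.compile
        (.ite (.var (3 * k + 8)) (.ite (.read S (.var (3 * k + 1)) (.const 0))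
          (.write S (.var (3 * k + 4)) (.const 0) (.const 1)) .skip) .skip)))
      (fun i t' => t'.var (3 * k + 1) = i ∧ G t' ∧
        t'.var (3 * k + 3) = t.var (3 * k + 3) ∧ (∀ v, inS t v → inS t' v) ∧
        (∀ a : Fin n, a.1 < i → ∀ c, inS t a → R a c → inS t' c))
      (fun i t' h => ⟨(hGrep t' h.2.1).size, h.1⟩)
      ⟨by simp, ⟨ht.1.setVar (by omega), ht.2⟩, by simp, fun v hv => hv, by simp⟩
      (fun i hi r hr => by
        obtain ⟨hri, hGr, hrt, hmono, hnew⟩ := hr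
        obtain ⟨r', hrun, hG', h1, h3, hmono', hnew'⟩ := hinner ⟨i, hi⟩ r hGr hri
        refine ⟨r', hrun, h1, by simp, ⟨hG'.1.setVar le_rfl, hG'.2⟩, by simp [h3, hrt],
          fun v hv => hmono' v (hmono v hv), fun a ha c hac hR => ?_⟩
        rcases Nat.lt_succ_iff_lt_or_eq.1 ha with h | h
        · exact hmono' c (hnew a h c hac hR)
        · obtain rfl : a = ⟨i, hi⟩ := Fin.ext h
          exact hnew' (hmono _ hac) c hR)
    exact ⟨t', hrun.mono le_rfl, ht'.2.1, ht'.2.2.1, ht'.2.2.2.1, fun a => ht'.2.2.2.2 a a.2⟩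
  obtain ⟨s₁, hrun₁, hs₁⟩ := runs_forVar (x := 3 * k + 1) (n := n) (c := 4) (s := s)
    (P := .write S (.var (3 * k + 1)) (.const 0) (.const 0))
    (fun i t => Frame (3 * k + 1) S s t ∧ t.var (3 * k + 1) = i ∧
      ∀ v : Fin n, v.1 < i → ¬ inS t v)
    (fun i t h => ⟨(h.1.var 0 (by omega)).trans hs.size, h.2.1⟩)
    ⟨(Frame.refl _ _ _).setVar le_rfl, by simp, by simp⟩
    (fun i hi t ht => by
      have hw := runs_write S (.var (3 * k + 1)) (.const 0) (.const 0) t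
      simp only [Exp.eval, ht.2.1] at hw
      refine ⟨_, hw, by simpa using ht.2.1, (ht.1.setArr le_rfl).setVar le_rfl, by simp, ?_⟩
      intro v hv
      rcases Nat.lt_succ_iff_lt_or_eq.1 hv with h | h
      · have := ht.2.2 v h
        simp only [inS, not_not] at this ⊢
        simp [this]
      · simp [inS, h])
  have hx₁ : s₁.var (3 * x + 1) = env x := (hs₁.1.var _ (by omega)).trans (hs.env x)
  have hw := runs_write S (.var (3 * x + 1)) (.const 0) (.const 1) s₁
  simp only [Exp.eval, hx₁] at hw
  set s₂ := s₁.setArr S (env x) 0 1 with hs₂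
  have hin₂ : ∀ v, inS s₂ v ↔ v = env x := by
    intro v
    have := hs₁.2.2 v v.2
    simp only [inS, not_not] at this
    simp only [inS, hs₂, Store.setArr_arr, true_and, and_true, this, Fin.ext_iff]
    by_cases h : v.1 = (env x).1 <;> simp [h]
  have hG₂ : G s₂ := ⟨hs₁.1.setArr le_rfl, fun v hv => (hin₂ v).1 hv ▸ Relation.ReflTransGen.refl⟩
  obtain ⟨s₃, hrun₃, hs₃⟩ := runs_forVar (x := 3 * k + 3) (n := n)
    (c := n * (n * (b n + 22) + 14) + 6) (s := s₂)
    (P := forVar (3 * k + 1) (forVar (3 * k + 4) (.seq φ.compile (.ite (.var (3 * k + 8))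
        (.ite (.read S (.var (3 * k + 1)) (.const 0))
          (.write S (.var (3 * k + 4)) (.const 0) (.const 1)) .skip) .skip))))
    -- The completeness half. Marks are set in place, so one round may advance several steps; only
    -- an inclusion is maintained.
    (fun i t => t.var (3 * k + 3) = i ∧ G t ∧ ∀ v, reachWithin R (env x) i v → inS t v)
    (fun i t h => ⟨(hGrep t h.2.1).size, h.1⟩)
    ⟨by simp, ⟨hG₂.1.setVar (by omega), hG₂.2⟩, fun v hv => (hin₂ v).2 hv⟩
    (fun i hi t ht => by
      obtain ⟨hti, hGt, hreach⟩ := ht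
      obtain ⟨t', hrun, hG', h3, hmono, hnew⟩ := hmid t hGt
      refine ⟨t', hrun, h3.trans hti, by simp, ⟨hG'.1.setVar (by omega), hG'.2⟩, ?_⟩
      rintro v (hv | ⟨a, ha, hav⟩)
      · exact hmono v (hreach v hv)
      · exact hnew a v (hreach a ha) hav)
  have hy₃ : s₃.var (3 * y + 1) = env y := (hs₃.2.1.1.var _ (by omega)).trans (hs.env y)
  have ha := runs_assign (3 * k + 2) (.read S (.var (3 * y + 1)) (.const 0)) s₃
  simp only [Exp.eval, hy₃] at ha
  refine ⟨_, (hrun₁.seq (hw.seq (hrun₃.seq ha))).mono ?_, hs₃.2.1.1.setVar (by omega), ?_⟩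
  · simp only [Exp.cost]
    ring_nf
    omega
  · simp only [Store.setVar_var, if_true]
    exact ⟨fun h => hs₃.2.1.2 (env y) h, fun h => hs₃.2.2 _ (reachWithin_of_reflTransGen h)⟩

theorem Fml.exists_correct {k : ℕ} (φ : Fml k) : ∃ p : Polynomial ℕ, φ.Correct fun n => p.eval n := by
  induction φ with
  | @rel k a x y =>
    refine ⟨4, fun n B env s hs => ⟨_, (runs_assign _ _ _).mono (by simp [Exp.cost]),
      (Frame.refl _ _ _).setVar (by omega), ?_⟩⟩
    simp only [Store.setVar_var, if_true, Exp.eval, hs.env, Fml.sat]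
    exact hs.arr a (env x) (env y)
  | @lt k x y =>
    refine ⟨4, fun n B env s hs => ⟨_, (runs_assign _ _ _).mono (by simp [Exp.cost]),
      (Frame.refl _ _ _).setVar (by omega), ?_⟩⟩
    simp only [Store.setVar_var, if_true, Exp.eval, hs.env, Fml.sat, Fin.lt_def]
    omega
  | @not k φ ih =>
    obtain ⟨p, hp⟩ := ih
    refine ⟨p + 4, fun n B env s hs => ?_⟩
    obtain ⟨s', hrun, hf, hsat⟩ := hp n B env s hs
    refine ⟨_, (hrun.seq (runs_assign _ _ _)).mono (by simp [Exp.cost]), hf.setVar (by omega), ?_⟩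
    simp only [Store.setVar_var, if_true, Exp.eval, Fml.sat, ← hsat]
    omega
  | @and k φ ψ ih ih' =>
    obtain ⟨p, hp⟩ := ih
    obtain ⟨q, hq⟩ := ih'
    refine ⟨p + q + 3, fun n B env s hs => ?_⟩
    obtain ⟨s', hrun, hf, hsat⟩ := hp n B env s hs
    by_cases h : φ.sat B env
    · obtain ⟨s'', hrun', hf', hsat'⟩ := hq n B env s'
        (hs.frame hf (by omega) (by omega) (by omega))
      refine ⟨s'', (hrun.seq (hrun'.iteTrue (e := .var (3 * k + 2)) (hsat.2 h))).mono ?_,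
        hf.trans hf' le_rfl le_rfl, ?_⟩
      · simp [Exp.cost]; omega
      · rw [hsat']
        simp [Fml.sat, h]
    · have h0 : s'.var (3 * k + 2) = 0 := not_not.1 (mt hsat.1 h)
      refine ⟨s', (hrun.seq ((runs_skip s').iteFalse (e := .var (3 * k + 2)) h0)).mono ?_, hf, ?_⟩
      · simp [Exp.cost]
      · simp [Fml.sat, h, h0]
  | @ex k φ ih =>
    obtain ⟨p, hp⟩ := ih
    refine ⟨Polynomial.X * (p + 12) + 8, fun n B env s hs => ?_⟩
    obtain ⟨s', hrun, h⟩ := hp.ex n B env s hs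
    exact ⟨s', hrun.mono (by simp), h⟩
  | @reach k φ x y ih =>
    obtain ⟨p, hp⟩ := ih
    refine ⟨Polynomial.X * (Polynomial.X * (Polynomial.X * (p + 22) + 14) + 14) +
      Polynomial.X * 12 + 30, fun n B env s hs => ?_⟩
    obtain ⟨s', hrun, h⟩ := hp.reach x y n B env s hs
    exact ⟨s', hrun.mono (by simp), h⟩

/-- The polynomial is found by induction on the program: a loop multiplies by `n` up to overhead.
Preserving all variables up to `3 * k` protects the counters of the enclosing loops. -/
theorem LProg.exists_correct {k : ℕ} (P : LProg k) : ∃ p : Polynomial ℕ,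
    ∀ (n : ℕ) (B : State n) (env : Fin k → Fin n) (s : Store), Represents B env s →
      ∃ s', Runs P.compile s (p.eval n) s' ∧ (∀ y < 3 * k + 1, s'.var y = s.var y) ∧
        Represents (P.eval env B) env s' := by
  induction P with
  | skip => exact ⟨1, fun n B env s hs => ⟨s, by simpa [LProg.compile] using runs_skip s, fun _ _ => rfl, hs⟩⟩
  | @write k a x y b =>
    refine ⟨4, fun n B env s hs => ⟨_, (runs_write _ _ _ _ s).mono (by simp [Exp.cost]),
      fun _ _ => rfl, hs.size, hs.env, fun a' i j => ?_⟩⟩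
    simp only [Store.setArr_arr, Exp.eval, hs.env, LProg.eval, ← Fin.ext_iff]
    by_cases h : a' = a ∧ i = env x ∧ j = env y
    · cases b <;> simp [h]
    · rw [if_neg h, if_neg h]
      exact hs.arr a' i j
  | @seq k P Q ih ih' =>
    obtain ⟨p, hp⟩ := ih
    obtain ⟨q, hq⟩ := ih'
    refine ⟨p + q, fun n B env s hs => ?_⟩
    obtain ⟨s', hrun, hf, hs'⟩ := hp n B env s hs
    obtain ⟨s'', hrun', hf', hs''⟩ := hq n _ env s' hs'
    exact ⟨s'', (hrun.seq hrun').mono (by simp), fun y hy => (hf' y hy).trans (hf y hy), hs''⟩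
  | @ite k φ P Q ih ih' =>
    obtain ⟨r, hr⟩ := φ.exists_correct
    obtain ⟨p, hp⟩ := ih
    obtain ⟨q, hq⟩ := ih'
    refine ⟨r + p + q + 2, fun n B env s hs => ?_⟩
    obtain ⟨t, hrun, hf, hsat⟩ := hr n B env s hs
    have ht := hs.frame hf (by omega) (by omega) (by omega)
    by_cases h : φ.sat B env
    · obtain ⟨s', hrun', hf', hs'⟩ := hp n B env t ht
      refine ⟨s', (hrun.seq (hrun'.iteTrue (e := .var (3 * k + 2)) (hsat.2 h))).mono ?_,
        fun y hy => (hf' y hy).trans (hf.var y hy), by simpa [LProg.eval, h] using hs'⟩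
      simp [Exp.cost]; omega
    · obtain ⟨s', hrun', hf', hs'⟩ := hq n B env t ht
      refine ⟨s', (hrun.seq (hrun'.iteFalse (e := .var (3 * k + 2))
        (not_not.1 (mt hsat.1 h)))).mono ?_,
        fun y hy => (hf' y hy).trans (hf.var y hy), by simpa [LProg.eval, h] using hs'⟩
      simp [Exp.cost]; omega
  | @all k P ih =>
    obtain ⟨p, hp⟩ := ih
    refine ⟨Polynomial.X * (p + 8) + 6, fun n B env s hs => ?_⟩
    have h0 := hs.frame ((Frame.refl (3 * k + 1) numArr s).setVar (v := 0) le_rfl) (by omega)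
      (by omega) le_rfl
    obtain ⟨s', hrun, hs'⟩ := runs_forVar (x := 3 * k + 1) (n := n) (c := p.eval n) (s := s)
      (P := P.compile)
      (fun i t => t.var (3 * k + 1) = i ∧ (∀ y < 3 * k + 1, t.var y = s.var y) ∧
        Represents (((List.finRange n).take i).foldl (fun B v => P.eval (push env v) B) B) env t)
      (fun i t h => ⟨h.2.2.size, h.1⟩)
      ⟨by simp, fun y hy => by simp [show y ≠ 3 * k + 1 by omega],
        by simpa using h0⟩
      (fun i hi t ht => by
        obtain ⟨hti, hvar, hrep⟩ := ht
        obtain ⟨t', hrun, hf, ht'⟩ := hp n _ (push env ⟨i, hi⟩) t (hrep.push hti)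
        refine ⟨t', hrun, (hf _ (by omega)).trans hti, by simp, fun y hy => ?_, ?_⟩
        · rw [Store.setVar_var, if_neg (by omega), hf y (by omega), hvar y hy]
        · rw [List.take_add_one]
          have : (List.finRange n)[i]? = some ⟨i, hi⟩ := by simp [hi]
          rw [this]
          simp only [Option.toList_some, List.foldl_append, List.foldl_cons, List.foldl_nil]
          refine ⟨?_, fun j => ?_, ht'.arr⟩
          · simpa using ht'.size
          · have := ht'.env j.castSucc
            simp only [push_castSucc, Fin.val_castSucc] at this
            rw [Store.setVar_var, if_neg (by omega), this])
    refine ⟨s', hrun.mono (by simp), hs'.2.1, ?_⟩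
    have := hs'.2.2
    rwa [List.take_of_length_le (by simp)] at this

/-! ### Formulas for the graph properties -/

section Formulas

variable {n k : ℕ}

/-- Disjunction. -/
def Fml.or (φ ψ : Fml k) : Fml k := .not (.and (.not φ) (.not ψ))

/-- Universal quantification. -/
def Fml.all (φ : Fml (k + 1)) : Fml k := .not (.ex (.not φ))

/-- Implication. -/
def Fml.imp (φ ψ : Fml k) : Fml k := .not (.and φ (.not ψ))

/-- Equality. -/
def Fml.eq (x y : Fin k) : Fml k := .and (.not (.lt x y)) (.not (.lt y x))

/-- Edges of an array, reversed if `r.2` is true. -/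
def Fml.edge (r : Fin numArr × Bool) (x y : Fin k) : Fml k :=
  if r.2 then .rel r.1 y x else .rel r.1 x y

variable {B : State n} {env : Fin k → Fin n}

@[simp] theorem Fml.sat_rel (a : Fin numArr) (x y : Fin k) :
    (Fml.rel a x y).sat B env ↔ B a (env x) (env y) := Iff.rfl

@[simp] theorem Fml.sat_lt (x y : Fin k) : (Fml.lt x y).sat B env ↔ env x < env y := Iff.rfl

@[simp] theorem Fml.sat_not (φ : Fml k) : (Fml.not φ).sat B env ↔ ¬ φ.sat B env := Iff.rfl

@[simp] theorem Fml.sat_and (φ ψ : Fml k) :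
    (Fml.and φ ψ).sat B env ↔ φ.sat B env ∧ ψ.sat B env := Iff.rfl

@[simp] theorem Fml.sat_ex (φ : Fml (k + 1)) :
    (Fml.ex φ).sat B env ↔ ∃ v, φ.sat B (push env v) := Iff.rfl

@[simp] theorem Fml.sat_reach (φ : Fml (k + 2)) (x y : Fin k) :
    (Fml.reach φ x y).sat B env ↔ Relation.ReflTransGen
      (fun a b => φ.sat B (push (push env a) b)) (env x) (env y) := Iff.rfl

@[simp] theorem Fml.sat_or (φ ψ : Fml k) :
    (Fml.or φ ψ).sat B env ↔ φ.sat B env ∨ ψ.sat B env := by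
  simp only [Fml.or, sat_not, sat_and]; tauto

@[simp] theorem Fml.sat_all (φ : Fml (k + 1)) :
    (Fml.all φ).sat B env ↔ ∀ v, φ.sat B (push env v) := by
  simp [Fml.all]

@[simp] theorem Fml.sat_imp (φ ψ : Fml k) :
    (Fml.imp φ ψ).sat B env ↔ (φ.sat B env → ψ.sat B env) := by
  simp [Fml.imp]

@[simp] theorem Fml.sat_eq (x y : Fin k) : (Fml.eq x y).sat B env ↔ env x = env y := by
  simp only [Fml.eq, sat_and, sat_not, sat_lt, not_lt]
  exact ⟨fun h => le_antisymm h.2 h.1, fun h => ⟨h.ge, h.le⟩⟩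

/-- The array `r.1` contains the edge set `E`, reversed if `r.2` is true. -/
def Holds (B : State n) (r : Fin numArr × Bool) (E : Finset (Fin n × Fin n)) : Prop :=
  ∀ x y, (x, y) ∈ E ↔ if r.2 then B r.1 y x else B r.1 x y

theorem Holds.sat_edge {r : Fin numArr × Bool} {E : Finset (Fin n × Fin n)} (h : Holds B r E)
    (x y : Fin k) : (Fml.edge r x y).sat B env ↔ (env x, env y) ∈ E := by
  rw [h]
  obtain ⟨a, _ | _⟩ := r <;> simp [Fml.edge]

theorem Holds.reverse {a : Fin numArr} {E : Finset (Fin n × Fin n)} (h : Holds B (a, false) E) :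
    Holds B (a, true) (reverse E) := fun x y => by
  rw [mem_reverse]
  simpa using h y x

theorem Holds.congr {B' : State n} {r : Fin numArr × Bool} {E : Finset (Fin n × Fin n)}
    (h : Holds B r E) (hB : B' r.1 = B r.1) : Holds B' r E := fun x y => by
  rw [hB]
  exact h x y

/-- Reachability without the edge `(i, j)`. -/
def Fml.reachErase (r : Fin numArr × Bool) (i j u v : Fin k) : Fml k :=
  .reach (.and (.not (.and (.eq (Fin.last k).castSucc i.castSucc.castSucc)
    (.eq (Fin.last (k + 1)) j.castSucc.castSucc)))
    (.edge r (Fin.last k).castSucc (Fin.last (k + 1)))) u v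

/-- Reachability without the vertex `z`. -/
def Fml.reachDelete (r : Fin numArr × Bool) (z u v : Fin k) : Fml k :=
  .reach (.and (.edge r (Fin.last k).castSucc (Fin.last (k + 1)))
    (.and (.not (.eq (Fin.last k).castSucc z.castSucc.castSucc))
      (.not (.eq (Fin.last (k + 1)) z.castSucc.castSucc)))) u v

/-- 2-edge-connectedness. -/
def Fml.twoEdge (r : Fin numArr × Bool) : Fml k :=
  .all (.all (.all (.all (.reachErase r (Fin.last k).castSucc.castSucc.castSucc
    (Fin.last (k + 1)).castSucc.castSucc (Fin.last (k + 2)).castSucc (Fin.last (k + 3))))))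

/-- Absence of strong articulation points. -/
def Fml.twoVertex (r : Fin numArr × Bool) : Fml k :=
  .all (.all (.all (.imp (.not (.eq (Fin.last (k + 1)).castSucc (Fin.last k).castSucc.castSucc))
    (.imp (.not (.eq (Fin.last (k + 2)) (Fin.last k).castSucc.castSucc))
      (.reachDelete r (Fin.last k).castSucc.castSucc (Fin.last (k + 1)).castSucc
        (Fin.last (k + 2)))))))

/-- All vertices other than `y` are reachable from `q`. -/
def Fml.reachAll (r : Fin numArr × Bool) (y q : Fin k) : Fml k :=
  .all (.imp (.not (.eq (Fin.last k) y.castSucc))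
    (.reach (.edge r (Fin.last (k + 1)).castSucc (Fin.last (k + 2))) q.castSucc (Fin.last k)))

section

variable {r : Fin numArr × Bool} {E : Finset (Fin n × Fin n)} (h : Holds B r E)
include h

theorem Holds.sat_reachErase (i j u v : Fin k) : (Fml.reachErase r i j u v).sat B env ↔
    Reach (E.erase (env i, env j)) (env u) (env v) := by
  simp [Fml.reachErase, h.sat_edge, Reach]

theorem Holds.sat_reachDelete (z u v : Fin k) : (Fml.reachDelete r z u v).sat B env ↔
    Reach (deleteVertex E (env z)) (env u) (env v) := by
  simp [Fml.reachDelete, h.sat_edge, Reach, mem_deleteVertex]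

/-- The formula quantifies over all pairs, including non-edges, whose deletion changes nothing.
Strong connectivity itself follows from any one deletion, which needs a vertex. -/
theorem Holds.sat_twoEdge (hn : 0 < n) :
    (Fml.twoEdge r : Fml k).sat B env ↔ TwoEdgeConnected E := by
  simp only [Fml.twoEdge, Fml.sat_all, h.sat_reachErase, push_castSucc, push_last]
  rw [twoEdgeConnected_iff]
  refine ⟨fun h => ⟨fun u v => (h ⟨0, hn⟩ ⟨0, hn⟩ u v).mono (Finset.erase_subset _ _),
    fun e u v => h e.1 e.2 u v⟩, fun h i j u v => h.2 (i, j) u v⟩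

theorem Holds.sat_twoVertex (hn : 3 ≤ n) :
    (Fml.twoVertex r : Fml k).sat B env ↔ TwoVertexConnected E := by
  simp only [Fml.twoVertex, Fml.sat_all, Fml.sat_imp, Fml.sat_not, Fml.sat_eq, h.sat_reachDelete,
    push_castSucc, push_last]
  have hn' : 3 ≤ Fintype.card (Fin n) := by simpa using hn
  constructor
  · intro h
    have hart : ∀ w, ¬ IsStrongArticulationPoint E w := fun w =>
      not_isStrongArticulationPoint_iff.2 fun u v hu hv => h w u v hu hv
    exact ⟨hn', stronglyConnected_of_no_articulationPoint hn' hart, hart⟩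
  · exact fun h w u v hu hv => not_isStrongArticulationPoint_iff.1 (h.2.2 w) u v hu hv

theorem Holds.sat_reachAll (y q : Fin k) : (Fml.reachAll r y q).sat B env ↔
    ∀ x ∈ ({env y}ᶜ : Set (Fin n)), Reach E (env q) x := by
  simp [Fml.reachAll, h.sat_edge, Reach]

end

/-- `z` dominates `x`; here and below `w` is the root. -/
def Fml.dom (r : Fin numArr × Bool) (w z x : Fin k) : Fml k :=
  .imp (.not (.eq w z)) (.not (.reach (.and
    (.edge r (Fin.last k).castSucc (Fin.last (k + 1)))
    (.not (.eq (Fin.last (k + 1)) z.castSucc.castSucc))) w x))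

/-- `z` strictly dominates `x`. -/
def Fml.sDom (r : Fin numArr × Bool) (w z x : Fin k) : Fml k :=
  .and (.not (.eq z x)) (.dom r w z x)

/-- `c` and `x` have the same strict dominators. -/
def Fml.sib (r : Fin numArr × Bool) (w c x : Fin k) : Fml k :=
  .all (.and (.imp (.sDom r w.castSucc (Fin.last k) c.castSucc)
      (.sDom r w.castSucc (Fin.last k) x.castSucc))
    (.imp (.sDom r w.castSucc (Fin.last k) x.castSucc)
      (.sDom r w.castSucc (Fin.last k) c.castSucc)))

/-- Some in-neighbour strictly dominates `x`. -/
def Fml.root (r : Fin numArr × Bool) (w x : Fin k) : Fml k :=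
  .ex (.and (.edge r (Fin.last k) x.castSucc) (.sDom r w.castSucc (Fin.last k) x.castSucc))

/-- There is a derived edge from `c` to `x`. -/
def Fml.derived (r : Fin numArr × Bool) (w c x : Fin k) : Fml k :=
  .and (.not (.eq c x)) (.and (.sib r w c x)
    (.ex (.and (.edge r (Fin.last k) x.castSucc) (.dom r w.castSucc c.castSucc (Fin.last k)))))

/-- `v` is not yet placed in the order kept in the array `o`. -/
def Fml.unplaced (o : Fin numArr) (w v : Fin k) : Fml k :=
  .and (.not (.eq v w)) (.not (.rel o v v))

/-- `v` can be placed next. -/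
def Fml.placeable (r : Fin numArr × Bool) (o : Fin numArr) (w v : Fin k) : Fml k :=
  .and (.or (.root r w v) (.ex (.and (.not (.unplaced o w.castSucc (Fin.last k)))
      (.derived r w.castSucc (Fin.last k) v.castSucc))))
    (.all (.imp (.unplaced o w.castSucc (Fin.last k)) (.imp (.not (.eq (Fin.last k) v.castSucc))
      (.ex (.and (.unplaced o w.castSucc.castSucc (Fin.last (k + 1)))
        (.and (.not (.eq (Fin.last (k + 1)) v.castSucc.castSucc))
        (.and (.root r w.castSucc.castSucc (Fin.last (k + 1)))
          (.reach (.and (.derived r w.castSucc.castSucc.castSucc.castSucc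
              (Fin.last (k + 2)).castSucc (Fin.last (k + 3)))
            (.and (.unplaced o w.castSucc.castSucc.castSucc.castSucc (Fin.last (k + 3)))
              (.not (.eq (Fin.last (k + 3)) v.castSucc.castSucc.castSucc.castSucc))))
            (Fin.last (k + 1)) (Fin.last k).castSucc))))))))

/-- The order kept in the array `o`, reversed if `b` is true. -/
def Fml.before (o : Fin numArr) (b : Bool) (c x : Fin k) : Fml k :=
  .and (.not (.eq c x)) (.edge (o, b) c x)

/-- `p` may be the parent of `x`. -/
def Fml.cand (r : Fin numArr × Bool) (o : Fin numArr) (b : Bool) (w p x : Fin k) : Fml k :=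
  .and (.edge r p x) (.or (.sDom r w p x) (.ex (.and
    (.dom r w.castSucc (Fin.last k) p.castSucc) (.and (.sib r w.castSucc (Fin.last k) x.castSucc)
      (.before o b (Fin.last k) x.castSucc)))))

/-- `p` is the least possible parent of `x`. -/
def Fml.parent (r : Fin numArr × Bool) (o : Fin numArr) (b : Bool) (w p x : Fin k) : Fml k :=
  .and (.not (.eq x w)) (.and (.cand r o b w p x) (.all (.imp (.lt (Fin.last k) p.castSucc)
    (.not (.cand r o b w.castSucc (Fin.last k) x.castSucc)))))

/-- The vertices not yet placed in the order kept in the array `o`. -/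
def unplaced (B : State n) (o : Fin numArr) (w : Fin n) : Set (Fin n) := {v | v ≠ w ∧ ¬ B o v v}

/-- The order kept in the array `o`. -/
def before (B : State n) (o : Fin numArr) (c x : Fin n) : Prop := c ≠ x ∧ B o c x

theorem Fml.sat_unplaced (o : Fin numArr) (w v : Fin k) :
    (Fml.unplaced o w v).sat B env ↔ env v ∈ M2TC.unplaced B o (env w) := by
  simp [Fml.unplaced, M2TC.unplaced]

theorem Fml.sat_before (o : Fin numArr) (c x : Fin k) :
    (Fml.before o false c x).sat B env ↔ M2TC.before B o (env c) (env x) := by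
  simp [Fml.before, M2TC.before, Fml.edge]

theorem Fml.sat_before_swap (o : Fin numArr) (c x : Fin k) :
    (Fml.before o true c x).sat B env ↔
      Function.swap (M2TC.before B o) (env c) (env x) := by
  simp [Fml.before, M2TC.before, Fml.edge, ne_comm]

section

variable {r : Fin numArr × Bool} {E : Finset (Fin n × Fin n)} (h : Holds B r E)
include h

theorem Holds.sat_dom (w z x : Fin k) : (Fml.dom r w z x).sat B env ↔
    Dom E (env w) (env z) (env x) := by
  simp [Fml.dom, h.sat_edge, Dom, Avoids]

theorem Holds.sat_sDom (w z x : Fin k) : (Fml.sDom r w z x).sat B env ↔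
    SDom E (env w) (env z) (env x) := by
  simp [Fml.sDom, h.sat_dom, SDom]

theorem Holds.sat_sib (w c x : Fin k) : (Fml.sib r w c x).sat B env ↔
    Sib E (env w) (env c) (env x) := by
  simp [Fml.sib, h.sat_sDom, Sib, iff_def]

theorem Holds.sat_root (w x : Fin k) : (Fml.root r w x).sat B env ↔
    RootEdge E (env w) (env x) := by
  simp [Fml.root, h.sat_sDom, h.sat_edge, RootEdge]

theorem Holds.sat_derived (w c x : Fin k) : (Fml.derived r w c x).sat B env ↔
    Derived E (env w) (env c) (env x) := by
  simp [Fml.derived, h.sat_sib, h.sat_dom, h.sat_edge, Derived]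

theorem Holds.sat_placeable (o : Fin numArr) (w v : Fin k) :
    (Fml.placeable r o w v).sat B env ↔ Placeable (RootEdge E (env w)) (Derived E (env w))
      (M2TC.unplaced B o (env w)) (env v) := by
  simp [Fml.placeable, h.sat_root, h.sat_derived, Fml.sat_unplaced, Placeable]

theorem Holds.sat_cand (o : Fin numArr) (w p x : Fin k) :
    (Fml.cand r o false w p x).sat B env ↔
      Cand E (env w) (M2TC.before B o) (env p) (env x) := by
  simp [Fml.cand, h.sat_edge, h.sat_sDom, h.sat_dom, h.sat_sib, Cand, Fml.sat_before]

theorem Holds.sat_cand_swap (o : Fin numArr) (w p x : Fin k) :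
    (Fml.cand r o true w p x).sat B env ↔
      Cand E (env w) (Function.swap (M2TC.before B o)) (env p) (env x) := by
  simp [Fml.cand, h.sat_edge, h.sat_sDom, h.sat_dom, h.sat_sib, Cand, Fml.sat_before_swap]

end

/-- Choosing the least candidate makes the parent relation definable by a formula. -/
theorem exists_least_choice {Q : Fin n → Fin n → Prop} {w : Fin n}
    (hQ : ∀ x, x ≠ w → ∃ p, Q p x) : ∃ a : Fin n → Fin n, (∀ x, x ≠ w → Q (a x) x) ∧
      ∀ p x, (p, x) ∈ parentTree w a ↔ x ≠ w ∧ Q p x ∧ ∀ p' < p, ¬ Q p' x := by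
  have : ∀ x, x ≠ w → ∃ p, Q p x ∧ ∀ p' < p, ¬ Q p' x := by
    intro x hx
    obtain ⟨p, hp, hmin⟩ := wellFounded_lt.has_min {p | Q p x} (hQ x hx)
    exact ⟨p, hp, fun p' hp' h => hmin p' h hp'⟩
  choose! a ha using this
  refine ⟨a, fun x hx => (ha x hx).1, fun p x => ?_⟩
  rw [mem_parentTree]
  constructor
  · rintro ⟨hx, rfl⟩
    exact ⟨hx, ha x hx⟩
  · rintro ⟨hx, hp, hmin⟩
    refine ⟨hx, le_antisymm ?_ ?_⟩
    · exact not_lt.1 fun h => hmin _ h (ha x hx).1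
    · exact not_lt.1 fun h => (ha x hx).2 _ h hp

end Formulas

/-! ### Rules for loops -/

section Loops

variable {n k : ℕ}

theorem foldl_finRange_inv {α : Type*} (f : α → Fin n → α) (Inv : Set (Fin n) → α → Prop) {a : α}
    (h0 : Inv ∅ a) (hs : ∀ D i a, i ∉ D → Inv D a → Inv (insert i D) (f a i)) :
    Inv Set.univ ((List.finRange n).foldl f a) := by
  have key : ∀ (l : List (Fin n)) (D : Set (Fin n)) (a : α), l.Nodup → (∀ i ∈ l, i ∉ D) →
      Inv D a → Inv (D ∪ {i | i ∈ l}) (l.foldl f a) := by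
    intro l
    induction l with
    | nil => intro D a _ _ h; simpa using h
    | cons i l ih =>
      intro D a hl hD h
      rw [List.nodup_cons] at hl
      have := ih (insert i D) (f a i) hl.2 (fun j hj => ?_) (hs D i a (hD i (by simp)) h)
      · rw [List.foldl_cons]
        convert this using 1
        ext j
        simp only [Set.mem_union, Set.mem_ofPred_eq, List.mem_cons, Set.mem_insert_iff]
        tauto
      · rintro (rfl | hj')
        · exact hl.1 hj
        · exact hD j (by simp [hj]) hj'
  have := key (List.finRange n) ∅ a (List.nodup_finRange n) (by simp) h0
  simpa using this

theorem LProg.all_inv (P : LProg (k + 1)) (env : Fin k → Fin n)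
    (Inv : Set (Fin n) → State n → Prop) {B : State n} (h0 : Inv ∅ B)
    (hs : ∀ D i B, i ∉ D → Inv D B → Inv (insert i D) (P.eval (push env i) B)) :
    Inv Set.univ ((LProg.all P).eval env B) :=
  foldl_finRange_inv _ Inv h0 hs

/-- Within row `i` the processed pairs are the earlier rows together with the processed part of this
row. -/
theorem LProg.all_all_inv (P : LProg (k + 2)) (env : Fin k → Fin n)
    (Inv : Set (Fin n × Fin n) → State n → Prop) {B : State n} (h0 : Inv ∅ B)
    (hs : ∀ D i j B, (i, j) ∉ D → Inv D B →
      Inv (insert (i, j) D) (P.eval (push (push env i) j) B)) :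
    Inv Set.univ ((LProg.all (LProg.all P)).eval env B) := by
  have := LProg.all_inv (.all P) env (fun D B => Inv {e | e.1 ∈ D} B) (B := B) (by simpa using h0) ?_
  · simpa using this
  intro D i B hi hB
  have := LProg.all_inv P (push env i) (fun D' B => Inv {e | e.1 ∈ D ∨ e.1 = i ∧ e.2 ∈ D'} B)
    (B := B) (by simpa using hB) ?_
  · convert this using 1
    ext e
    simp [or_comm]
  · intro D' j B hj hB
    convert hs _ i j B ?_ hB using 1
    · ext ⟨x, y⟩
      simp only [Set.mem_insert_iff, Set.mem_ofPred_eq, Prod.mk.injEq]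
      tauto
    · simp [hi, hj]

theorem LProg.eval_seq (P Q : LProg k) (env : Fin k → Fin n) (B : State n) :
    (LProg.seq P Q).eval env B = Q.eval env (P.eval env B) := rfl

theorem LProg.eval_ite_pos {φ : Fml k} {P Q : LProg k} {env : Fin k → Fin n} {B : State n}
    (h : φ.sat B env) : (LProg.ite φ P Q).eval env B = P.eval env B := if_pos h

theorem LProg.eval_ite_neg {φ : Fml k} {P Q : LProg k} {env : Fin k → Fin n} {B : State n}
    (h : ¬ φ.sat B env) : (LProg.ite φ P Q).eval env B = Q.eval env B := if_neg h

/-- This expresses a choice of one vertex: the guard singles out `q` both before and after the body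
has run, so the body runs exactly once. -/
theorem LProg.eval_all_ite_unique {φ : Fml (k + 1)} {P : LProg (k + 1)} {env : Fin k → Fin n}
    {B : State n} {q : Fin n} (h : ∀ i, φ.sat B (push env i) ↔ i = q)
    (h' : ∀ i, φ.sat (P.eval (push env q) B) (push env i) ↔ i = q) :
    (LProg.all (.ite φ P .skip)).eval env B = P.eval (push env q) B := by
  have := LProg.all_inv (.ite φ P .skip) env
    (fun D B' => (q ∉ D ∧ B' = B) ∨ (q ∈ D ∧ B' = P.eval (push env q) B)) (B := B) (by simp) ?_
  · simpa using this
  rintro D i B' hi (⟨hq, rfl⟩ | ⟨hq, rfl⟩)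
  · by_cases hiq : i = q
    · subst hiq
      right
      exact ⟨by simp, LProg.eval_ite_pos ((h i).2 rfl)⟩
    · left
      exact ⟨by simp [hq, Ne.symm hiq], LProg.eval_ite_neg (mt (h i).1 hiq)⟩
  · right
    refine ⟨by simp [hq], LProg.eval_ite_neg (mt (h' i).1 ?_)⟩
    rintro rfl
    exact hi hq

/-- The relation given by an edge set. -/
def memRel (F : Finset (Fin n × Fin n)) : Fin n → Fin n → Prop := fun x y => (x, y) ∈ F

theorem holds_of_eq {B : State n} {a : Fin numArr} {F : Finset (Fin n × Fin n)}
    (h : B a = memRel F) : Holds B (a, false) F := fun x y => by simp [h, memRel]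

theorem eval_write_true (a : Fin numArr) (x y : Fin k) (env : Fin k → Fin n) (B : State n)
    (F : Finset (Fin n × Fin n)) : (LProg.write a x y true).eval env (Function.update B a (memRel F))
      = Function.update B a (memRel (insert (env x, env y) F)) := by
  funext b i j
  by_cases hb : b = a
  · subst hb
    by_cases h : i = env x ∧ j = env y <;> simp [LProg.eval, h, memRel]
  · simp [LProg.eval, hb]

theorem eval_write_false (a : Fin numArr) (x y : Fin k) (env : Fin k → Fin n) (B : State n)
    (F : Finset (Fin n × Fin n)) : (LProg.write a x y false).eval env (Function.update B a (memRel F))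
      = Function.update B a (memRel (F.erase (env x, env y))) := by
  funext b i j
  by_cases hb : b = a
  · subst hb
    by_cases h : i = env x ∧ j = env y <;> simp [LProg.eval, h, memRel]
  · simp [LProg.eval, hb]

/-! ### Assigning a relation -/

/-- Put the pairs that satisfy `φ` into the array `a`. -/
def LProg.setRel (a : Fin numArr) (φ : Fml (k + 2)) : LProg k :=
  .all (.all (.ite φ (.write a (Fin.last k).castSucc (Fin.last (k + 1)) true)
    (.write a (Fin.last k).castSucc (Fin.last (k + 1)) false)))

/-- Add the pairs that satisfy `φ` to the array `a`. -/
def LProg.addRel (a : Fin numArr) (φ : Fml (k + 2)) : LProg k :=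
  .all (.all (.ite φ (.write a (Fin.last k).castSucc (Fin.last (k + 1)) true) .skip))

open Classical in
theorem exists_eq_memRel (R : Fin n → Fin n → Prop) : ∃ F, R = memRel F :=
  ⟨Finset.univ.filter fun e => R e.1 e.2, by funext x y; simp [memRel]⟩

/-- The formula must not depend on the array being written, since it is evaluated at intermediate
contents; hence the quantifier over `R`. -/
theorem eval_addRel {a : Fin numArr} {φ : Fml (k + 2)} {env : Fin k → Fin n} {B : State n}
    {F C : Finset (Fin n × Fin n)} (hB : B a = memRel F)
    (hφ : ∀ R x y, φ.sat (Function.update B a R) (push (push env x) y) ↔ (x, y) ∈ C) :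
    (LProg.addRel a φ).eval env B = Function.update B a (memRel (F ∪ C)) := by
  classical
  have := LProg.all_all_inv (.ite φ (.write a (Fin.last k).castSucc (Fin.last (k + 1)) true) .skip)
    env (fun D B' => B' = Function.update B a (memRel (F ∪ C.filter (· ∈ D)))) (B := B)
    (by simp [← hB]) ?_
  · simpa [LProg.addRel] using this
  rintro D i j B' hij rfl
  by_cases h : (i, j) ∈ C
  · rw [LProg.eval_ite_pos ((hφ _ i j).2 h), eval_write_true]
    congr 2
    ext e
    by_cases he : e = (i, j)
    · simp [he, h]
    · simp [he]
  · rw [LProg.eval_ite_neg (mt (hφ _ i j).1 h)]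
    simp only [LProg.eval]
    congr 3
    ext e
    by_cases he : e = (i, j)
    · simp [he, h]
    · simp [he]

theorem eval_setRel {a : Fin numArr} {φ : Fml (k + 2)} {env : Fin k → Fin n} {B : State n}
    {C : Finset (Fin n × Fin n)}
    (hφ : ∀ R x y, φ.sat (Function.update B a R) (push (push env x) y) ↔ (x, y) ∈ C) :
    (LProg.setRel a φ).eval env B = Function.update B a (memRel C) := by
  classical
  obtain ⟨F, hF⟩ := exists_eq_memRel (B a)
  have := LProg.all_all_inv (.ite φ (.write a (Fin.last k).castSucc (Fin.last (k + 1)) true)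
    (.write a (Fin.last k).castSucc (Fin.last (k + 1)) false))
    env (fun D B' => B' = Function.update B a
      (memRel (F.filter (· ∉ D) ∪ C.filter (· ∈ D)))) (B := B) (by simp [← hF]) ?_
  · simpa [LProg.setRel] using this
  rintro D i j B' hij rfl
  by_cases h : (i, j) ∈ C
  · rw [LProg.eval_ite_pos ((hφ _ i j).2 h), eval_write_true]
    congr 2
    ext e
    by_cases he : e = (i, j)
    · simp [he, h]
    · simp [he]
  · rw [LProg.eval_ite_neg (mt (hφ _ i j).1 h), eval_write_false]
    congr 2
    ext e
    by_cases he : e = (i, j)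
    · simp [he, h]
    · simp [he]

/-! ### Greedy deletion -/

/-- Delete from the array `a` every pair whose deletion preserves `φ`. -/
def LProg.greedy (a : Fin numArr) (φ : Fml (k + 2)) : LProg k :=
  .all (.all (.ite (.rel a (Fin.last k).castSucc (Fin.last (k + 1)))
    (.seq (.write a (Fin.last k).castSucc (Fin.last (k + 1)) false)
      (.ite φ .skip (.write a (Fin.last k).castSucc (Fin.last (k + 1)) true))) .skip))

/-- One pass suffices for a monotone property: an edge that was indispensable when tested stays so
in every smaller set. -/
theorem eval_greedy {a : Fin numArr} {φ : Fml (k + 2)} {env : Fin k → Fin n} {B : State n}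
    {F₀ : Finset (Fin n × Fin n)} {P : Finset (Fin n × Fin n) → Prop} (hB : B a = memRel F₀)
    (hφ : ∀ F x y, φ.sat (Function.update B a (memRel F)) (push (push env x) y) ↔ P F)
    (hmono : ∀ {C F}, C ⊆ F → P C → P F) (hP : P F₀) :
    ∃ F ⊆ F₀, P F ∧ (∀ e ∈ F, ¬ P (F.erase e)) ∧
      (LProg.greedy a φ).eval env B = Function.update B a (memRel F) := by
  have := LProg.all_all_inv (.ite (.rel a (Fin.last k).castSucc (Fin.last (k + 1)))
    (.seq (.write a (Fin.last k).castSucc (Fin.last (k + 1)) false)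
      (.ite φ .skip (.write a (Fin.last k).castSucc (Fin.last (k + 1)) true))) .skip)
    env (fun D B' => ∃ F ⊆ F₀, P F ∧ (∀ e ∈ F, e ∈ D → ¬ P (F.erase e)) ∧
      B' = Function.update B a (memRel F)) (B := B) ⟨F₀, subset_rfl, hP, by simp, by simp [← hB]⟩ ?_
  · simpa [LProg.greedy] using this
  rintro D i j B' hij ⟨F, hF, hPF, hD, rfl⟩
  by_cases h : (i, j) ∈ F
  · rw [LProg.eval_ite_pos (by simpa [memRel] using h)]
    simp only [LProg.eval_seq]
    rw [eval_write_false]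
    simp only [push_castSucc, push_last]
    by_cases hPe : P (F.erase (i, j))
    · rw [LProg.eval_ite_pos ((hφ _ i j).2 hPe)]
      refine ⟨F.erase (i, j), (Finset.erase_subset _ _).trans hF, hPe, ?_, rfl⟩
      rintro e he (rfl | heD) hc
      · simp at he
      · exact hD e (Finset.mem_of_mem_erase he) heD
          (hmono (Finset.erase_subset_erase _ (Finset.erase_subset _ _)) hc)
    · rw [LProg.eval_ite_neg (mt (hφ _ i j).1 hPe), eval_write_true]
      refine ⟨F, hF, hPF, ?_, by simp [Finset.insert_erase h]⟩
      rintro e he (rfl | heD)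
      · exact hPe
      · exact hD e he heD
  · rw [LProg.eval_ite_neg (by simpa [memRel] using h)]
    refine ⟨F, hF, hPF, ?_, rfl⟩
    rintro e he (rfl | heD)
    · exact absurd he h
    · exact hD e he heD

end Loops

/-! ### Spanning trees -/

section SpanningTreeProgram

variable {n k : ℕ}

/-- Add the edges of a spanning tree without `y`, rooted at `q`, to the array `2`. -/
def LProg.addTree (b : Bool) (y q : Fin k) : LProg k :=
  .seq (.setRel 3 (.and (.edge (0, false) (Fin.last k).castSucc (Fin.last (k + 1)))
    (.and (.not (.eq (Fin.last k).castSucc y.castSucc.castSucc))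
      (.not (.eq (Fin.last (k + 1)) y.castSucc.castSucc)))))
  (.seq (.greedy 3 (.reachAll (3, b) y.castSucc.castSucc q.castSucc.castSucc))
    (.addRel 2 (.rel 3 (Fin.last k).castSucc (Fin.last (k + 1)))))

/-- `E`, reversed if `b` is true. -/
def orient (b : Bool) (E : Finset (Fin n × Fin n)) : Finset (Fin n × Fin n) :=
  if b then reverse E else E

theorem holds_orient {B : State n} {a : Fin numArr} {F : Finset (Fin n × Fin n)} (b : Bool)
    (h : B a = memRel F) : Holds B (a, b) (orient b F) := by
  cases b
  · exact holds_of_eq h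
  · exact (holds_of_eq h).reverse

theorem orient_mono (b : Bool) {E F : Finset (Fin n × Fin n)} (h : E ⊆ F) :
    orient b E ⊆ orient b F := by
  cases b
  · exact h
  · exact reverse_subset h

theorem orient_orient (b : Bool) (E : Finset (Fin n × Fin n)) : orient b (orient b E) = E := by
  cases b
  · rfl
  · exact reverse_reverse E

theorem deleteVertex_orient (b : Bool) (E : Finset (Fin n × Fin n)) (y : Fin n) :
    deleteVertex (orient b E) y = orient b (deleteVertex E y) := by
  cases b
  · rfl
  · exact deleteVertex_reverse E y

theorem exists_orient_erase (b : Bool) (E : Finset (Fin n × Fin n)) {e : Fin n × Fin n}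
    (he : e ∈ orient b E) : ∃ e' ∈ E, orient b (E.erase e') = (orient b E).erase e := by
  cases b
  · exact ⟨e, he, rfl⟩
  · exact ⟨(e.2, e.1), mem_reverse.1 he, (erase_reverse E e.1 e.2).symm⟩

/-- Array `3` is scratch space: it is filled with the graph without `y` and thinned out greedily
while `q` still reaches everything else, which leaves a spanning tree. -/
theorem eval_addTree {b : Bool} {y q : Fin k} {env : Fin k → Fin n} {B : State n}
    {E F : Finset (Fin n × Fin n)} (hE : B 0 = memRel E) (hF : B 2 = memRel F)
    (hq : env q ≠ env y)
    (hr : ∀ x, x ≠ env y → Reach (deleteVertex (orient b E) (env y)) (env q) x) :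
    ∃ A, IsSpanningTree {env y}ᶜ (deleteVertex (orient b E) (env y)) (env q) A ∧
      ((LProg.addTree b y q).eval env B) 0 = B 0 ∧ ((LProg.addTree b y q).eval env B) 1 = B 1 ∧
      ((LProg.addTree b y q).eval env B) 2 = memRel (F ∪ orient b A) := by
  simp only [LProg.addTree, LProg.eval_seq]
  rw [eval_setRel (C := deleteVertex E (env y)) fun R x z => by
    rw [Fml.sat_and, (((holds_of_eq hE).congr (B' := Function.update B 3 R) rfl)).sat_edge]
    simp [mem_deleteVertex]]
  obtain ⟨A, hA, hP, hmin, heval⟩ := eval_greedy (a := 3) (env := env)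
    (φ := .reachAll (3, b) y.castSucc.castSucc q.castSucc.castSucc)
    (B := Function.update B 3 (memRel (deleteVertex E (env y))))
    (P := fun A => ∀ v ∈ ({env y}ᶜ : Set (Fin n)), Reach (orient b A) (env q) v)
    (F₀ := deleteVertex E (env y)) (by simp)
    (fun A x z => by
      rw [(holds_orient (F := A) b (by simp)).sat_reachAll]
      simp)
    (fun hCF hC v hv => (hC v hv).mono (orient_mono b hCF))
    (fun v hv => by rw [← deleteVertex_orient]; exact hr v hv)
  rw [heval, eval_addRel (F := F) (C := A) (by simp [hF]) fun R x z => by simp [memRel]]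
  refine ⟨orient b A, isSpanningTree_of_minimal hq (fun a c hac => (mem_deleteVertex.1 hac).2) ?_
    hP ?_, by simp, by simp, by simp [orient_orient]⟩
  · rw [deleteVertex_orient]
    exact orient_mono b hA
  · intro e he
    obtain ⟨e', he', h⟩ := exists_orient_erase b A he
    rw [← h]
    exact hmin e' he'

end SpanningTreeProgram

/-! ### Independent trees -/

section IndependentTreesProgram

variable {n k : ℕ}

/-- Place `v` last in the order kept in the array `o`. -/
def LProg.place (o : Fin numArr) (w v : Fin k) : LProg k :=
  .all (.ite (.or (.eq (Fin.last k) v.castSucc) (.and (.rel o (Fin.last k) (Fin.last k))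
    (.not (.eq (Fin.last k) w.castSucc)))) (.write o (Fin.last k) v.castSucc true) .skip)

/-- Build up an order in the array `o`. -/
def LProg.order (r : Fin numArr × Bool) (o : Fin numArr) (w : Fin k) : LProg k :=
  .all (.all (.ite (.and (.unplaced o w.castSucc.castSucc (Fin.last (k + 1)))
      (.placeable r o w.castSucc.castSucc (Fin.last (k + 1))))
    (.place o w.castSucc.castSucc (Fin.last (k + 1))) .skip))

/-- The diagonal of `o` marks placed vertices. The writes go to the column of `v` only, so they do
not disturb the diagonal entries still to be tested. -/
theorem eval_place {o : Fin numArr} {w v : Fin k} {env : Fin k → Fin n} {B : State n} :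
    (LProg.place o w v).eval env B = Function.update B o fun c x =>
      B o c x ∨ (x = env v ∧ (c = env v ∨ (B o c c ∧ c ≠ env w))) := by
  have := LProg.all_inv (.ite (.or (.eq (Fin.last k) v.castSucc) (.and
    (.rel o (Fin.last k) (Fin.last k)) (.not (.eq (Fin.last k) w.castSucc))))
      (.write o (Fin.last k) v.castSucc true) .skip) env
    (fun D B' => B' = Function.update B o fun c x =>
      B o c x ∨ (c ∈ D ∧ x = env v ∧ (c = env v ∨ (B o c c ∧ c ≠ env w)))) (B := B) (by simp) ?_
  · simpa [LProg.place] using this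
  rintro D i B' hi rfl
  by_cases h : i = env v ∨ (B o i i ∧ i ≠ env w)
  · rw [LProg.eval_ite_pos (by simpa [hi] using h)]
    funext a c x
    by_cases ha : a = o
    · subst ha
      by_cases hc : c = i
      · subst hc
        by_cases hx : x = env v <;> simp [LProg.eval, hx, h, hi]
      · simp [LProg.eval, hc]
    · simp [LProg.eval, ha]
  · rw [LProg.eval_ite_neg (by simpa [hi] using h)]
    funext a c x
    by_cases ha : a = o
    · subst ha
      by_cases hc : c = i
      · subst hc
        simp [LProg.eval, h, hi]
      · simp [LProg.eval, hc]
    · simp [LProg.eval, ha]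

theorem PartialOrdering.eval_place {E : Finset (Fin n × Fin n)} {o : Fin numArr} {w v : Fin k}
    {env : Fin k → Fin n} {B : State n}
    (h : PartialOrdering (RootEdge E (env w)) (Derived E (env w)) (env w) (unplaced B o (env w))
      (before B o)) (hv : env v ∈ unplaced B o (env w))
    (hp : Placeable (RootEdge E (env w)) (Derived E (env w)) (unplaced B o (env w)) (env v)) :
    unplaced ((LProg.place o w v).eval env B) o (env w) = unplaced B o (env w) \ {env v} ∧
    PartialOrdering (RootEdge E (env w)) (Derived E (env w)) (env w)
      (unplaced ((LProg.place o w v).eval env B) o (env w))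
      (before ((LProg.place o w v).eval env B) o) := by
  have h1 : unplaced ((LProg.place o w v).eval env B) o (env w) =
      unplaced B o (env w) \ {env v} := by
    rw [M2TC.eval_place]
    ext x
    simp only [unplaced, Function.update_self, Set.mem_ofPred_eq, Set.mem_sdiff,
      Set.mem_singleton_iff]
    tauto
  refine ⟨h1, ?_⟩
  rw [h1]
  convert h.place (fun c x hD => hD.ne_root.1) hv hp using 1
  rw [M2TC.eval_place]
  funext c x
  have hvv := hv.2
  simp only [before, unplaced, Function.update_self, Set.mem_ofPred_eq, eq_iff_iff]
  constructor
  · rintro ⟨hcx, hB | ⟨rfl, rfl | hB⟩⟩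
    · exact Or.inl ⟨hcx, hB⟩
    · exact absurd rfl hcx
    · exact Or.inr ⟨rfl, fun h => h.2 hB.1, hB.2⟩
  · rintro (⟨hcx, hB⟩ | ⟨rfl, hc, hcw⟩)
    · exact ⟨hcx, Or.inl hB⟩
    · have hcc : B o c c := not_not.1 fun h => hc ⟨hcw, h⟩
      exact ⟨fun h => hvv (h ▸ hcc), Or.inr ⟨rfl, Or.inr ⟨hcc, hcw⟩⟩⟩

/-- Each pass over the vertices places at least one if any is left, because a pass without effect
would have found no placeable vertex. Hence `n` passes suffice. -/
theorem eval_order {r : Fin numArr × Bool} {o : Fin numArr} {w : Fin k} {env : Fin k → Fin n}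
    {B : State n} {E : Finset (Fin n × Fin n)} (hE : Holds B r E) (hro : r.1 ≠ o)
    (ho : B o = fun _ _ => False) (hr : ∀ x, Reach E (env w) x) :
    ∃ R, (LProg.order r o w).eval env B = Function.update B o R ∧
      PartialOrdering (RootEdge E (env w)) (Derived E (env w)) (env w) ∅
        (before ((LProg.order r o w).eval env B) o) := by
  let K : State n → Prop := fun B' => (∃ R, B' = Function.update B o R) ∧
    PartialOrdering (RootEdge E (env w)) (Derived E (env w)) (env w) (unplaced B' o (env w))
      (before B' o)
  have hinner : ∀ (i : Fin n) (B' : State n), K B' →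
      K ((LProg.all (.ite (.and (.unplaced o w.castSucc.castSucc (Fin.last (k + 1)))
        (.placeable r o w.castSucc.castSucc (Fin.last (k + 1))))
        (.place o w.castSucc.castSucc (Fin.last (k + 1))) .skip)).eval (push env i) B') ∧
      ((unplaced B' o (env w)).Nonempty →
        (unplaced ((LProg.all (.ite (.and (.unplaced o w.castSucc.castSucc (Fin.last (k + 1)))
          (.placeable r o w.castSucc.castSucc (Fin.last (k + 1))))
          (.place o w.castSucc.castSucc (Fin.last (k + 1))) .skip)).eval (push env i) B') o
            (env w)).ncard < (unplaced B' o (env w)).ncard) ∧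
      (unplaced ((LProg.all (.ite (.and (.unplaced o w.castSucc.castSucc (Fin.last (k + 1)))
        (.placeable r o w.castSucc.castSucc (Fin.last (k + 1))))
        (.place o w.castSucc.castSucc (Fin.last (k + 1))) .skip)).eval (push env i) B') o
          (env w)).ncard ≤ (unplaced B' o (env w)).ncard := by
    intro i B' hB'
    -- Either nothing has changed yet and all scanned vertices were unsuitable, or the number of
    -- unplaced vertices has already dropped.
    have := LProg.all_inv (.ite (.and (.unplaced o w.castSucc.castSucc (Fin.last (k + 1)))
        (.placeable r o w.castSucc.castSucc (Fin.last (k + 1))))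
        (.place o w.castSucc.castSucc (Fin.last (k + 1))) .skip) (push env i)
      (fun D B'' => K B'' ∧ ((B'' = B' ∧ ∀ v ∈ D, v ∈ unplaced B' o (env w) →
        ¬ Placeable (RootEdge E (env w)) (Derived E (env w)) (unplaced B' o (env w)) v) ∨
        (unplaced B'' o (env w)).ncard < (unplaced B' o (env w)).ncard))
      (B := B') ⟨hB', Or.inl ⟨rfl, by simp⟩⟩ ?_
    · refine ⟨this.1, fun hne => ?_, ?_⟩
      · rcases this.2 with ⟨-, h⟩ | h
        · obtain ⟨v, hv, hp⟩ := hB'.2.cut.exists_placeable hne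
          exact absurd hp (h v trivial hv)
        · exact h
      · rcases this.2 with ⟨h, -⟩ | h
        · rw [h]
        · exact h.le
    rintro D v B'' - ⟨hK, hB''⟩
    have hEB : Holds B'' r E := by
      obtain ⟨R, rfl⟩ := hK.1
      exact hE.congr (by simp [hro])
    by_cases hsat : v ∈ unplaced B'' o (env w) ∧
      Placeable (RootEdge E (env w)) (Derived E (env w)) (unplaced B'' o (env w)) v
    · rw [LProg.eval_ite_pos (by
        rw [Fml.sat_and, Fml.sat_unplaced, hEB.sat_placeable]
        simpa using hsat)]
      have hw : push (push env i) v w.castSucc.castSucc = env w := by simp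
      have hv : push (push env i) v (Fin.last (k + 1)) = v := by simp
      have key := PartialOrdering.eval_place (E := E) (o := o) (w := w.castSucc.castSucc)
        (v := Fin.last (k + 1)) (env := push (push env i) v) (B := B'')
      rw [hw, hv] at key
      obtain ⟨h1, h2⟩ := key hK.2 hsat.1 hsat.2
      have hlt : (unplaced B'' o (env w) \ {v}).ncard < (unplaced B'' o (env w)).ncard :=
        Set.ncard_sdiff_singleton_lt_of_mem hsat.1 (Set.toFinite _)
      refine ⟨⟨?_, h2⟩, Or.inr ?_⟩
      · obtain ⟨R, rfl⟩ := hK.1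
        rw [M2TC.eval_place]
        exact ⟨_, Function.update_idem _ _ _⟩
      · rw [h1]
        rcases hB'' with ⟨rfl, -⟩ | h
        · exact hlt
        · exact hlt.trans h
    · rw [LProg.eval_ite_neg (by
        rw [Fml.sat_and, Fml.sat_unplaced, hEB.sat_placeable]
        simpa using hsat)]
      refine ⟨hK, ?_⟩
      rcases hB'' with ⟨rfl, h⟩ | h
      · refine Or.inl ⟨rfl, ?_⟩
        rintro x (rfl | hx) hxU hp
        · exact hsat ⟨hxU, hp⟩
        · exact h x hx hxU hp
      · exact Or.inr h
  have houter := LProg.all_inv (.all (.ite (.and (.unplaced o w.castSucc.castSucc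
        (Fin.last (k + 1))) (.placeable r o w.castSucc.castSucc (Fin.last (k + 1))))
        (.place o w.castSucc.castSucc (Fin.last (k + 1))) .skip)) env
    -- After `|D|` passes at most `n - |D|` vertices are unplaced.
    (fun D B' => K B' ∧ (unplaced B' o (env w)).ncard + D.ncard ≤ n) (B := B) ?_ ?_
  · obtain ⟨⟨⟨R, hR⟩, hord⟩, hcard⟩ := houter
    refine ⟨R, hR, ?_⟩
    have h0 : (unplaced ((LProg.order r o w).eval env B) o (env w)).ncard = 0 := by
      simp only [Set.ncard_univ, Nat.card_eq_fintype_card, Fintype.card_fin] at hcard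
      exact Nat.eq_zero_of_le_zero (by unfold LProg.order; omega)
    rw [Set.ncard_eq_zero (Set.toFinite _)] at h0
    rw [← h0]
    exact hord
  · have h1 : unplaced B o (env w) = {env w}ᶜ := by
      ext x; simp [unplaced, ho]
    have h2 : before B o = fun _ _ => False := by
      funext c x; simp [before, ho]
    refine ⟨⟨⟨B o, by simp⟩, ?_⟩, ?_⟩
    · rw [h1, h2]
      exact partialOrdering_init hr
    · have := Set.ncard_le_card (unplaced B o (env w))
      simpa using this
  · rintro D i B' hi ⟨hK, hcard⟩
    obtain ⟨hK', hlt, hle⟩ := hinner i B' hK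
    refine ⟨hK', ?_⟩
    rw [Set.ncard_insert_of_notMem hi (Set.toFinite _)]
    rcases (unplaced B' o (env w)).eq_empty_or_nonempty with h0 | hne
    · rw [h0, Set.ncard_empty, Nat.le_zero] at hle
      rw [hle]
      have := Set.ncard_le_card (insert i D)
      rw [Set.ncard_insert_of_notMem hi (Set.toFinite _)] at this
      simpa using this
    · have := hlt hne
      omega

/-- Add the edges of four independent trees rooted at `w` to the array `2`. -/
def LProg.addIndependent (w : Fin k) : LProg k :=
  .seq (.order (0, false) 4 w) (.seq (.order (0, true) 5 w) (.addRel 2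
    (.or (.or (.parent (0, false) 4 false w.castSucc.castSucc (Fin.last k).castSucc (Fin.last (k + 1)))
      (.parent (0, false) 4 true w.castSucc.castSucc (Fin.last k).castSucc (Fin.last (k + 1))))
    (.or (.parent (0, true) 5 false w.castSucc.castSucc (Fin.last (k + 1)) (Fin.last k).castSucc)
      (.parent (0, true) 5 true w.castSucc.castSucc (Fin.last (k + 1)) (Fin.last k).castSucc)))))

/-- Agreement of `B'` with `B` is required only on the graph and the order, so the formulas keep
their meaning while the output array is being filled. -/
theorem exists_independent_of_order {r : Fin numArr × Bool} {o : Fin numArr} {w : Fin n}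
    {B : State n} {E : Finset (Fin n × Fin n)} (hE : Holds B r E) (hr : ∀ x, Reach E w x)
    (hord : PartialOrdering (RootEdge E w) (Derived E w) w ∅ (before B o)) :
    ∃ A₁ A₂, AreIndependentTrees E w A₁ A₂ ∧ ∀ (B' : State n), B' r.1 = B r.1 → B' o = B o →
      ∀ {k : ℕ} (env : Fin k → Fin n) (w' p x : Fin k), env w' = w →
        ((Fml.parent r o false w' p x).sat B' env ↔ (env p, env x) ∈ A₁) ∧
        ((Fml.parent r o true w' p x).sat B' env ↔ (env p, env x) ∈ A₂) := by
  obtain ⟨a, ha, ha'⟩ := exists_least_choice (Q := Cand E w (before B o)) (w := w)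
    fun x hx => (hord.exists_cand hx).1
  obtain ⟨b, hb, hb'⟩ := exists_least_choice (Q := Cand E w (Function.swap (before B o))) (w := w)
    fun x hx => (hord.exists_cand hx).2
  refine ⟨_, _, areIndependentTrees_parentTree hr hord.irrefl hord.trans ha hb, ?_⟩
  intro B' h1 h2 k env w' p x hw
  have hE' := hE.congr h1
  have hbef : before B' o = before B o := by
    funext c y
    simp [before, h2]
  rw [ha', hb']
  constructor
  · simp [Fml.parent, hE'.sat_cand, hbef, hw]
  · simp [Fml.parent, hE'.sat_cand_swap, hbef, hw]

/-- Array `4` holds an order for the graph and array `5` one for its reverse. For the latter the two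
arguments of the parent formula are exchanged, which stores the edges in their original direction.
-/
theorem eval_addIndependent {w : Fin k} {env : Fin k → Fin n} {B : State n}
    {E F : Finset (Fin n × Fin n)} (hE : B 0 = memRel E) (hF : B 2 = memRel F)
    (h4 : B 4 = fun _ _ => False) (h5 : B 5 = fun _ _ => False) (hconn : StronglyConnected E) :
    ∃ A₁ A₂ B₁ B₂, AreIndependentTrees E (env w) A₁ A₂ ∧
      AreIndependentTrees (reverse E) (env w) B₁ B₂ ∧
      ((LProg.addIndependent w).eval env B) 1 = B 1 ∧
      ((LProg.addIndependent w).eval env B) 2 =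
        memRel (F ∪ ((A₁ ∪ A₂) ∪ reverse (B₁ ∪ B₂))) := by
  simp only [LProg.addIndependent, LProg.eval_seq]
  obtain ⟨R, hR, hord⟩ := eval_order (w := w) (env := env) (holds_of_eq hE) (o := 4) (by decide) h4
    (hconn (env w))
  rw [hR] at hord ⊢
  obtain ⟨A₁, A₂, hA, hA'⟩ := exists_independent_of_order
    ((holds_of_eq hE).congr (B' := Function.update B 4 R) rfl) (hconn (env w)) hord
  obtain ⟨R', hR', hord'⟩ := eval_order (w := w) (env := env)
    (((holds_of_eq hE).congr (B' := Function.update B 4 R) rfl).reverse) (o := 5) (by decide)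
    (by simpa using h5) (hconn.reverse (env w))
  rw [hR'] at hord' ⊢
  obtain ⟨B₁, B₂, hB, hB'⟩ := exists_independent_of_order (((holds_of_eq hE).congr
    (B' := Function.update (Function.update B 4 R) 5 R') rfl).reverse) (hconn.reverse (env w)) hord'
  refine ⟨A₁, A₂, B₁, B₂, hA, hB, ?_⟩
  rw [eval_addRel (F := F) (C := (A₁ ∪ A₂) ∪ reverse (B₁ ∪ B₂)) (by simpa using hF)]
  · exact ⟨by simp, by simp⟩
  intro Q x y
  have h1 := hA' (Function.update (Function.update (Function.update B 4 R) 5 R') 2 Q) rfl (by simp)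
    (push (push env x) y) w.castSucc.castSucc (Fin.last k).castSucc (Fin.last (k + 1)) (by simp)
  have h2 := hB' (Function.update (Function.update (Function.update B 4 R) 5 R') 2 Q) rfl (by simp)
    (push (push env x) y) w.castSucc.castSucc (Fin.last (k + 1)) (Fin.last k).castSucc (by simp)
  rw [Fml.sat_or, Fml.sat_or, Fml.sat_or, h1.1, h1.2, h2.1, h2.2]
  simp [mem_reverse, or_assoc]

end IndependentTreesProgram

/-! ### The algorithm as a program -/

section Algorithm

variable {n k : ℕ}

/-- `x` belongs to the vertex set whose indicator is the first column of the array `1`. -/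
def Fml.memT (x : Fin k) : Fml k :=
  .ex (.and (.rel 1 x.castSucc (Fin.last k))
    (.all (.not (.lt (Fin.last (k + 1)) (Fin.last k).castSucc))))

/-- The first column of the array `1` is the indicator of `T`. -/
def HoldsSet (B : State n) (T : Finset (Fin n)) : Prop :=
  ∀ x, (∃ z, B 1 x z ∧ ∀ z', ¬ z' < z) ↔ x ∈ T

theorem HoldsSet.congr {B B' : State n} {T : Finset (Fin n)} (h : HoldsSet B T)
    (hB : B' 1 = B 1) : HoldsSet B' T := fun x => by
  rw [hB]
  exact h x

theorem HoldsSet.sat_memT {B : State n} {T : Finset (Fin n)} (h : HoldsSet B T)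
    {env : Fin k → Fin n} (x : Fin k) : (Fml.memT x).sat B env ↔ env x ∈ T := by
  rw [← h]
  simp [Fml.memT]

/-- Add spanning trees for every vertex of `T`. -/
def LProg.small : LProg 0 :=
  .all (.ite (.memT 0) (.all (.ite (.and (.not (.eq 1 0)) (.all (.imp (.lt 2 1) (.eq 2 0))))
    (.seq (.addTree false 0 1) (.addTree true 0 1)) .skip)) .skip)

/-- Add independent trees rooted at a vertex outside `T`. -/
def LProg.large : LProg 0 :=
  .all (.ite (.and (.not (.memT 0)) (.all (.imp (.lt 1 0) (.memT 1)))) (.addIndependent 0) .skip)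

/-- The algorithm. -/
def LProg.main : LProg 0 :=
  .seq (.setRel 2 (.rel 0 0 1))
  (.ite (.all (.memT 0)) (.greedy 2 (.twoVertex (2, false)))
  (.seq (.greedy 2 (.twoEdge (2, false)))
  (.ite (.all (.not (.memT 0))) .skip
  (.ite (.ex (.ex (.ex (.and (.and (.memT 0) (.and (.memT 1) (.memT 2)))
      (.and (.not (.eq 0 1)) (.and (.not (.eq 0 2)) (.not (.eq 1 2))))))))
    .large .small))))

theorem exists_least {Q : Fin n → Prop} (h : ∃ q, Q q) : ∃ q, Q q ∧ ∀ i < q, ¬ Q i := by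
  obtain ⟨q, hq, hmin⟩ := wellFounded_lt.has_min {q | Q q} h
  exact ⟨q, hq, fun i hi h => hmin i h hi⟩

theorem least_iff {Q : Fin n → Prop} {q : Fin n} (hq : Q q) (hmin : ∀ i < q, ¬ Q i) (i : Fin n) :
    (Q i ∧ ∀ j < i, ¬ Q j) ↔ i = q := by
  constructor
  · rintro ⟨hi, h⟩
    exact le_antisymm (not_lt.1 fun h' => h q h' hq) (not_lt.1 fun h' => hmin i h' hi)
  · rintro rfl
    exact ⟨hq, hmin⟩

/-- The edges that the algorithm adds for the vertex `y`. -/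
def TreePair (E : Finset (Fin n × Fin n)) (y : Fin n) (C : Finset (Fin n × Fin n)) : Prop :=
  ∃ q A B, q ≠ y ∧ IsSpanningTree {y}ᶜ (deleteVertex E y) q A ∧
    IsSpanningTree {y}ᶜ (deleteVertex (reverse E) y) q B ∧ C = A ∪ reverse B

theorem eval_small {B : State n} {env : Fin 0 → Fin n} {E F : Finset (Fin n × Fin n)}
    {T : Finset (Fin n)} (hn : 3 ≤ n) (hE : B 0 = memRel E) (hT : HoldsSet B T)
    (hF : B 2 = memRel F) (hart : ∀ y ∈ T, ¬ IsStrongArticulationPoint E y) :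
    ∃ C : Fin n → Finset (Fin n × Fin n), (∀ y ∈ T, TreePair E y (C y)) ∧
      (LProg.small.eval env B) 2 = memRel (F ∪ T.biUnion C) := by
  classical
  obtain ⟨part, hpart⟩ : ∃ part : Set (Fin n) → Finset (Fin n), ∀ D x, x ∈ part D ↔ x ∈ T ∧ x ∈ D :=
    ⟨fun D => T.filter (· ∈ D), fun D x => Finset.mem_filter⟩
  have := LProg.all_inv (.ite (.memT 0) (.all (.ite (.and (.not (.eq 1 0))
      (.all (.imp (.lt 2 1) (.eq 2 0)))) (.seq (.addTree false 0 1) (.addTree true 0 1)) .skip))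
      .skip) env
    (fun D B' => B' 0 = B 0 ∧ B' 1 = B 1 ∧ ∃ C : Fin n → Finset (Fin n × Fin n),
      (∀ y ∈ T, y ∈ D → TreePair E y (C y)) ∧ B' 2 = memRel (F ∪ (part D).biUnion C))
    (B := B) ⟨rfl, rfl, fun _ => ∅, by simp, by
      rw [hF]
      congr 1
      ext e
      simp⟩ ?_
  · obtain ⟨-, -, C, h1, h2⟩ := this
    refine ⟨C, fun y hy => h1 y hy trivial, ?_⟩
    have huniv : part Set.univ = T := by
      ext x
      simp [hpart]
    rwa [huniv] at h2
  rintro D y B' hy ⟨h0, h1, C, hC, h2⟩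
  have hsat := (hT.congr h1).sat_memT (env := push env y) 0
  have hpy : push env y 0 = y := push_last env y
  rw [hpy] at hsat
  by_cases hyT : y ∈ T
  swap
  · rw [LProg.eval_ite_neg (mt hsat.1 hyT)]
    refine ⟨h0, h1, C, ?_, ?_⟩
    · rintro x hxT (rfl | hxD)
      · exact absurd hxT hyT
      · exact hC x hxT hxD
    · rw [← show part D = part (insert y D) by
        ext x
        simp only [hpart, Set.mem_insert_iff]
        constructor
        · exact fun h => ⟨h.1, Or.inr h.2⟩
        · rintro ⟨hx, rfl | hxD⟩
          · exact absurd hx hyT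
          · exact ⟨hx, hxD⟩]
      exact h2
  rw [LProg.eval_ite_pos (hsat.2 hyT)]
  obtain ⟨q, hq, hmin⟩ := exists_least (Q := fun q => q ≠ y)
    ((exists_ne_ne (by simpa using hn) y y).imp fun _ h => h.1)
  -- The guard mentions no array, so it selects the same `q` in every state.
  have hleast : ∀ (B'' : State n) i, (Fml.and (.not (.eq 1 0)) (.all (.imp (.lt 2 1) (.eq 2 0)))
      : Fml 2).sat B'' (push (push env y) i) ↔ i = q := by
    intro B'' i
    rw [← least_iff (Q := fun q => q ≠ y) hq hmin i]
    have e0 : push (push env y) i 0 = y := (push_castSucc (push env y) i 0).trans hpy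
    have e1 : push (push env y) i 1 = i := push_last (push env y) i
    have f0 : ∀ j, push (push (push env y) i) j 0 = y :=
      fun j => (push_castSucc (push (push env y) i) j 0).trans e0
    have f1 : ∀ j, push (push (push env y) i) j 1 = i :=
      fun j => (push_castSucc (push (push env y) i) j 1).trans e1
    have f2 : ∀ j, push (push (push env y) i) j 2 = j := fun j => push_last _ j
    simp [e0, e1, f0, f1, f2]
  rw [LProg.eval_all_ite_unique (hleast _) (hleast _), LProg.eval_seq]
  have e0 : push (push env y) q 0 = y := (push_castSucc (push env y) q 0).trans hpy
  have e1 : push (push env y) q 1 = q := push_last (push env y) q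
  have hr := not_isStrongArticulationPoint_iff.1 (hart y hyT)
  have hr' := not_isStrongArticulationPoint_iff.1
    (not_isStrongArticulationPoint_reverse (hart y hyT))
  obtain ⟨A₁, hA₁, k0, k1, k2⟩ := eval_addTree (b := false) (y := 0) (q := 1)
    (env := push (push env y) q) (h0.trans hE) h2 (by rw [e0, e1]; exact hq)
    (by rw [e0, e1]; exact fun x hx => hr q x hq hx)
  obtain ⟨A₂, hA₂, l0, l1, l2⟩ := eval_addTree (b := true) (y := 0) (q := 1)
    (env := push (push env y) q) (k0.trans (h0.trans hE)) k2 (by rw [e0, e1]; exact hq)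
    (by rw [e0, e1]; exact fun x hx => hr' q x hq hx)
  rw [e0, e1] at hA₁ hA₂
  refine ⟨l0.trans (k0.trans h0), l1.trans (k1.trans h1), Function.update C y (A₁ ∪ reverse A₂), ?_, ?_⟩
  · intro x hxT hx
    by_cases hxy : x = y
    · subst hxy
      exact ⟨q, A₁, A₂, hq, hA₁, hA₂, by simp⟩
    · rw [Function.update_of_ne hxy]
      exact hC x hxT (hx.resolve_left hxy)
  · rw [l2]
    congr 1
    have hfilter : part (insert y D) = insert y (part D) := by
      ext x
      simp only [hpart, Set.mem_insert_iff, Finset.mem_insert]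
      constructor
      · tauto
      · rintro (rfl | h)
        · exact ⟨hyT, Or.inl rfl⟩
        · exact ⟨h.1, Or.inr h.2⟩
    rw [hfilter, Finset.biUnion_insert, Function.update_self]
    have hcongr : (part D).biUnion (Function.update C y (A₁ ∪ reverse A₂)) =
        (part D).biUnion C := by
      refine Finset.biUnion_congr rfl fun x hx => Function.update_of_ne ?_ _ _
      rintro rfl
      exact hy ((hpart D _).1 hx).2
    rw [hcongr]
    ext e
    simp only [orient, Finset.mem_union, if_true, Bool.false_eq_true, if_false]
    tauto

theorem eval_large {B : State n} {env : Fin 0 → Fin n} {E F : Finset (Fin n × Fin n)}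
    {T : Finset (Fin n)} (hE : B 0 = memRel E) (hT : HoldsSet B T)
    (hF : B 2 = memRel F) (h4 : B 4 = fun _ _ => False) (h5 : B 5 = fun _ _ => False)
    (hconn : StronglyConnected E) (hTn : T ≠ Finset.univ) :
    ∃ w ∉ T, ∃ A₁ A₂ B₁ B₂, AreIndependentTrees E w A₁ A₂ ∧
      AreIndependentTrees (reverse E) w B₁ B₂ ∧
      (LProg.large.eval env B) 2 = memRel (F ∪ (A₁ ∪ A₂) ∪ reverse (B₁ ∪ B₂)) := by
  obtain ⟨w, hw, hmin⟩ := exists_least (Q := fun w => w ∉ T) (by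
    by_contra hc
    push Not at hc
    exact hTn (Finset.eq_univ_iff_forall.2 hc))
  -- The guard reads only array `1`, which the body leaves intact.
  have hleast : ∀ (B' : State n), B' 1 = B 1 → ∀ i, (Fml.and (.not (.memT 0))
      (.all (.imp (.lt 1 0) (.memT 1))) : Fml 1).sat B' (push env i) ↔ i = w := by
    intro B' hB' i
    rw [← least_iff (Q := fun w => w ∉ T) hw hmin i]
    have e0 : push env i 0 = i := push_last env i
    have f0 : ∀ j, push (push env i) j 0 = i :=
      fun j => (push_castSucc (push env i) j 0).trans e0
    have f1 : ∀ j, push (push env i) j 1 = j := fun j => push_last _ j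
    simp [(hT.congr hB').sat_memT, e0, f0, f1]
  obtain ⟨A₁, A₂, B₁, B₂, hA, hB, h1, h2⟩ := eval_addIndependent (w := 0) (env := push env w)
    hE hF h4 h5 hconn
  have e0 : push env w 0 = w := push_last env w
  rw [e0] at hA hB
  refine ⟨w, hw, A₁, A₂, B₁, B₂, hA, hB, ?_⟩
  rw [LProg.large, LProg.eval_all_ite_unique (hleast B rfl) (hleast _ h1), h2, Finset.union_assoc F]

/-- The branches of the program match those of `AlgorithmOutput`. The case `T = V` is tested before
anything is deleted, since it starts from the full graph with a different property. -/
theorem eval_main {B : State n} {env : Fin 0 → Fin n} {E : Finset (Fin n × Fin n)}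
    {T : Finset (Fin n)} (hn : 3 ≤ n) (hE : B 0 = memRel E) (hT : HoldsSet B T)
    (h4 : B 4 = fun _ _ => False) (h5 : B 5 = fun _ _ => False) (hET : TwoTConnected E T) :
    ∃ F, AlgorithmOutput E T F ∧ (LProg.main.eval env B) 2 = memRel F := by
  have hall : ∀ (B' : State n), B' 1 = B 1 →
      ((Fml.all (.memT 0) : Fml 0).sat B' env ↔ T = Finset.univ) := by
    intro B' hB'
    have e0 : ∀ i, push env i 0 = i := fun i => push_last env i
    simp [(hT.congr hB').sat_memT, e0, Finset.eq_univ_iff_forall]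
  have hnone : ∀ (B' : State n), B' 1 = B 1 →
      ((Fml.all (.not (.memT 0)) : Fml 0).sat B' env ↔ T = ∅) := by
    intro B' hB'
    have e0 : ∀ i, push env i 0 = i := fun i => push_last env i
    simp [(hT.congr hB').sat_memT, e0, Finset.eq_empty_iff_forall_notMem]
  have hthree : ∀ (B' : State n), B' 1 = B 1 →
      ((Fml.ex (.ex (.ex (.and (.and (.memT 0) (.and (.memT 1) (.memT 2)))
        (.and (.not (.eq 0 1)) (.and (.not (.eq 0 2)) (.not (.eq 1 2))))))) : Fml 0).sat B' env ↔
          2 < T.card) := by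
    intro B' hB'
    have e0 : ∀ i j l, push (push (push env i) j) l 0 = i := fun i j l =>
      (push_castSucc (push (push env i) j) l 0).trans
        ((push_castSucc (push env i) j 0).trans (push_last env i))
    have e1 : ∀ i j l, push (push (push env i) j) l 1 = j := fun i j l =>
      (push_castSucc (push (push env i) j) l 1).trans (push_last (push env i) j)
    have e2 : ∀ i j l, push (push (push env i) j) l 2 = l := fun i j l => push_last _ l
    simp [(hT.congr hB').sat_memT, e0, e1, e2, Finset.two_lt_card_iff, and_assoc]
  have e0 : ∀ i j, push (push env i) j 0 = i := fun i j =>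
    (push_castSucc (push env i) j 0).trans (push_last env i)
  have e1 : ∀ i j, push (push env i) j 1 = j := fun i j => push_last _ j
  simp only [LProg.main, LProg.eval_seq]
  rw [eval_setRel (C := E) fun R x y => by simp [hE, memRel, e0, e1]]
  set B₁ := Function.update B 2 (memRel E) with hB₁
  have hB₁2 : B₁ 2 = memRel E := by simp [hB₁]
  by_cases huniv : T = Finset.univ
  · rw [LProg.eval_ite_pos ((hall B₁ (by simp [hB₁])).2 huniv)]
    have hn' : 3 ≤ Fintype.card (Fin n) := by simpa using hn
    obtain ⟨F, hFE, hF, hmin, heval⟩ := eval_greedy (a := 2) (env := env) (B := B₁)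
      (φ := .twoVertex (2, false)) (P := TwoVertexConnected) hB₁2
      (fun F x y => (holds_of_eq (by simp)).sat_twoVertex hn) TwoVertexConnected.mono
      ⟨hn', hET.1, fun w => hET.2.2 w (by simp [huniv])⟩
    refine ⟨F, .full ?_ huniv F ⟨hFE, hF, hmin⟩, by rw [heval]; simp⟩
    -- Testing `T = V` before `T = ∅` is harmless, because `V` is nonempty.
    rw [huniv]
    exact (Finset.univ_nonempty_iff.2 ⟨⟨0, by omega⟩⟩).ne_empty
  rw [LProg.eval_ite_neg (mt (hall B₁ (by simp [hB₁])).1 huniv), LProg.eval_seq]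
  obtain ⟨F, hFE, hF, hmin, heval⟩ := eval_greedy (a := 2) (env := env) (B := B₁)
    (φ := .twoEdge (2, false)) (P := TwoEdgeConnected) hB₁2
    (fun F x y => (holds_of_eq (by simp)).sat_twoEdge (by omega)) TwoEdgeConnected.mono hET.2.1
  rw [heval]
  set B₂ := Function.update B₁ 2 (memRel F) with hB₂
  have hB₂0 : B₂ 0 = memRel E := by simpa [hB₂, hB₁] using hE
  have hB₂1 : B₂ 1 = B 1 := by simp [hB₂, hB₁]
  have hB₂2 : B₂ 2 = memRel F := by simp [hB₂]
  by_cases hempty : T = ∅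
  · rw [LProg.eval_ite_pos ((hnone B₂ hB₂1).2 hempty)]
    exact ⟨F, .empty hempty F ⟨hFE, hF, hmin⟩, hB₂2⟩
  rw [LProg.eval_ite_neg (mt (hnone B₂ hB₂1).1 hempty)]
  by_cases hcard : 2 < T.card
  · rw [LProg.eval_ite_pos ((hthree B₂ hB₂1).2 hcard)]
    obtain ⟨w, hw, A₁, A₂, C₁, C₂, hA, hC, h2⟩ := eval_large (env := env) hB₂0 (hT.congr hB₂1) hB₂2
      (by simpa [hB₂, hB₁] using h4) (by simpa [hB₂, hB₁] using h5) hET.1 huniv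
    exact ⟨_, .large hempty huniv (by omega) F ⟨hFE, hF, hmin⟩ w hw A₁ A₂ C₁ C₂ hA hC, h2⟩
  · rw [LProg.eval_ite_neg (mt (hthree B₂ hB₂1).1 hcard)]
    obtain ⟨C, hC, h2⟩ := eval_small (env := env) hn hB₂0 (hT.congr hB₂1) hB₂2 hET.2.2
    choose! q A D hq hA hD hCeq using hC
    rw [Finset.biUnion_congr rfl hCeq] at h2
    have hpos := Finset.card_pos.2 (Finset.nonempty_iff_ne_empty.2 hempty)
    exact ⟨_, .small hempty huniv ⟨hpos, by omega⟩ F ⟨hFE, hF, hmin⟩ q A D hq hA hD, h2⟩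

/-- The state given by the input. -/
def inputState (n : ℕ) (E : Finset (Fin n × Fin n)) (T : Finset (Fin n)) : State n :=
  fun a i j => (inputStore n E T).arr a i j ≠ 0

theorem main_implementsInPolynomialTime : ImplementsInPolynomialTime LProg.main.compile := by
  obtain ⟨p, hp⟩ := LProg.main.exists_correct
  refine ⟨p, fun n E T hn hET => ?_⟩
  obtain ⟨s, ⟨k, hk, hrun⟩, -, hs⟩ := hp n (inputState n E T) (fun i => i.elim0)
    (inputStore n E T) ⟨by simp [inputStore], fun i => i.elim0, fun _ _ _ => Iff.rfl⟩
  obtain ⟨F, hF, hF2⟩ := eval_main (B := inputState n E T) (env := fun i => i.elim0) (E := E)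
    (T := T) hn
    (by funext i j; simp [inputState, inputStore, memRel])
    (by
      intro x
      simp only [inputState, inputStore]
      constructor
      · rintro ⟨z, hz, -⟩
        by_contra hx
        simp [hx] at hz
      · intro hx
        exact ⟨⟨0, by omega⟩, by simp [hx, show 0 < n by omega], fun z' h => by simp [Fin.lt_def] at h⟩)
    (by funext i j; simp [inputState, inputStore, numArr])
    (by funext i j; simp [inputState, inputStore, numArr]) hET
  refine ⟨k, s, hrun, hk, ?_⟩
  have : outputEdges n s = F := by
    ext ⟨i, j⟩
    have := hs.arr 2 i j
    rw [hF2, show ((2 : Fin numArr) : ℕ) = 2 from rfl] at this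
    simpa [outputEdges, memRel] using this
  rw [this]
  exact hF

end Algorithm
end M2TC

open M2TC
theorem mainTheorem1 :
    (∀ (V : Type*) [Fintype V] [DecidableEq V] (E : Finset (V × V)) (T : Finset V),
      3 ≤ Fintype.card V → TwoTConnected E T →
        2 * Fintype.card V ≤ E.card ∧
        ∀ F : Finset (V × V), AlgorithmOutput E T F →
          F.card ≤ 8 * Fintype.card V ∧
          IsFeasible E T F ∧
          ∀ F' : Finset (V × V), IsOptimal E T F' → F.card ≤ 4 * F'.card) ∧
    ∃ P : Prog, ImplementsInPolynomialTime P := by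
  refine ⟨fun V _ _ E T hn hE => ⟨hE.2.1.two_mul_card_le hn, fun F hF =>
    ⟨hF.card_le, hF.isFeasible hE, fun F' hF' => ?_⟩⟩, _, main_implementsInPolynomialTime⟩
  -- The approximation ratio: `|F| ≤ 8n = 4 · 2n ≤ 4 |F'|`.
  have h1 := hF.card_le
  have h2 := hF'.1.2.2.1.two_mul_card_le hn
  omega
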